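/- **Proposition 2.3.** Let $I=[-1,1]$ and $c=0$. A map $f:I\to I$ is called *S-unimodal* if it is $C^3$, $f(-1)=f(1)=-1$, $f'>0$ on $[-1,0)$, $f'<0$ on $(0,1]$, $f''(0)<0$, and its Schwarzian derivative $\frac{f'''}{f'}-\frac32\left(\frac{f''}{f'}\right)^2$ is negative on $I\setminus\{0\}$. (Derivatives at the end points of $I$ are one-sided.) Let $f$ be an S-unimodal map all of whose periodic points are repelling (if $x\in I$, $p\ge 1$ and $f^p(x)=x$, then $|(f^p)'(x)|>1$) and whose postcritical orbit $\{f^k(c): k\ge 1\}$ is infinite. Let $v:I\to\mathbb{C}$ be a $C^1$ function with $v'(c)=0$ and such that $v(f^{i_0}(c))\neq 0$ for some $i_0\ge 0$. Let $\Sigma$ be the set of points $x\in I$ such that $f^n(x)\ne c$ for every $n\ge 0$ and such that the series $$\alpha_{cand}(x)=-\sum_{i=0}^{\infty}\frac{v(f^i(x))}{(f^{i+1})'(x)}$$ diverges, that is, its partial sums have no limit in $\mathbb{C}$. Then for every nonempty (relatively) open set $A\subset I$, the intersection $A\cap\Sigma$ contains a Cantor set, that is, a set homeomorphic to $\{0,1\}^{\mathbb{N}}$.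 -/

import Mathlib

open Filter Topology

/-- The phase space `I = [-1, 1]`. -/
abbrev phaseI : Set ℝ := Set.Icc (-1) 1

/-- The `k`-th derivative of `g` on `I` (one-sided at the end points of `I`). -/
noncomputable def derivI (k : ℕ) (g : ℝ → ℝ) (x : ℝ) : ℝ :=
  iteratedDerivWithin k g phaseI x

/-- The Schwarzian derivative `f''' / f' - (3 / 2) (f'' / f') ^ 2` on `I`; meaningful where
`f' ≠ 0`. -/
noncomputable def schwarzianI (f : ℝ → ℝ) (x : ℝ) : ℝ :=
  derivI 3 f x / derivI 1 f x - 3 / 2 * (derivI 2 f x / derivI 1 f x) ^ 2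

/-- `f` restricts to an S-unimodal map `I → I`, with critical point `c = 0`. Only the values of `f`
on `I` matter. -/
structure IsSUnimodal (f : ℝ → ℝ) : Prop where
  mapsTo : Set.MapsTo f phaseI phaseI
  contDiffOn : ContDiffOn ℝ 3 f phaseI
  map_neg_one : f (-1) = -1
  map_one : f 1 = -1
  deriv_pos : ∀ x ∈ Set.Ico (-1 : ℝ) 0, 0 < derivI 1 f x
  deriv_neg : ∀ x ∈ Set.Ioc (0 : ℝ) 1, derivI 1 f x < 0
  deriv_two_neg : derivI 2 f 0 < 0
  schwarzian_neg : ∀ x ∈ phaseI, x ≠ 0 → schwarzianI f x < 0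

/-- Every periodic point of `f` in `I` is repelling: its multiplier `(f ^ p)'(x)` has absolute
value larger than `1`. -/
def AllPeriodicRepelling (f : ℝ → ℝ) : Prop :=
  ∀ x ∈ phaseI, ∀ p : ℕ, 0 < p → f^[p] x = x → 1 < |derivI 1 (f^[p]) x|

/-- The postcritical orbit `{f ^ k (c) : k ≥ 1}`, where `c = 0`. -/
def postcriticalOrbit (f : ℝ → ℝ) : Set ℝ := {y | ∃ k : ℕ, 1 ≤ k ∧ y = f^[k] 0}

/-- The `n`-th partial sum of the formal series
`α_cand(x) = - ∑ j ≥ 0, v(f ^ j (x)) / (f ^ (j + 1))'(x)`. -/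
noncomputable def alphaCandPartial (f : ℝ → ℝ) (v : ℝ → ℂ) (x : ℝ) (n : ℕ) : ℂ :=
  -∑ j ∈ Finset.range n, v (f^[j] x) / ((derivI 1 (f^[j + 1]) x : ℝ) : ℂ)

/-- The set `Σ` of points of `I` whose orbit avoids `c = 0` and at which the series `α_cand`
diverges, that is, its partial sums have no limit. -/
def divergenceSet (f : ℝ → ℝ) (v : ℝ → ℂ) : Set ℝ :=
  {x | x ∈ phaseI ∧ (∀ n : ℕ, f^[n] x ≠ 0) ∧
    ¬ ∃ l : ℂ, Tendsto (alphaCandPartial f v x) atTop (𝓝 l)}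

/-- A Cantor set: a subset homeomorphic to the Cantor space `{0, 1} ^ ℕ`. -/
def IsCantorSet (K : Set ℝ) : Prop := Nonempty (K ≃ₜ (ℕ → Bool))

/-! The series diverges wherever infinitely many of its terms have modulus above `1`, and such terms
are forced near preimages of the critical point. If `z` first reaches `0` at time `n`, then
`(f^[n+i+1])'(z) = 0` while `v (f^[n+i] z) = v (f^[i] 0)`, which is nonzero for a suitable `i`. So
for `x ≠ z` close to `z` the term of index `n+i` is large, and the orbit of `x` avoids `0` up to
that time. If preimages of `0` are dense, then for every `N` the points having a large term of index
at least `N` form a dense open set (`exists_mem_largeTermSet`, `isOpen_largeTermSet`). By Baire's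
theorem the points with infinitely many large terms form an uncountable Borel subset of any open
set, and such a set contains a Cantor set.

The substance is therefore `exists_preimage`: there is no interval `J` on which all iterates are
monotone. The repelling hypothesis excludes monotone iterates mapping an interval into itself
(`not_strictOn_selfmap`). Hence the iterates of `J` are pairwise disjoint (`disjoint_iterates`) and
their lengths tend to `0`.

Negative Schwarzian derivative means that monotone iterates expand cross-ratios
(`four_point_iterate`). Suppose that, for infinitely many `n`, `f^[n]` extends monotonically beyond
both ends of `J`, and that the extended image has on either side of `f^[n] J` a piece comparable
with `f^[n] J`. Pulling these pieces back leaves a definite amount of room at each end of `J`,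
against the maximality of `J` on the left (`not_space`).

Such times `n` come from closest returns of `J` to the critical point. A maximal extension ends at a
point `y` with `f^[i] y = 0` for some `i < n`. Either its image covers a whole earlier iterate of
`J`, up to the folding, or `f^[n-i]` has a restrictive interval around `0`; the latter is not much
contracted because it lies in an interval bounded by a repelling periodic point
(`restrictive_bound`). If there are only finitely many closest returns, the iterates stay away from
`0` and room is easier to find (`not_eventually_away`). -/

/-! ### Negative Schwarzian derivative: convexity and cross-ratio inequalities -/

/-- Data of a `C³` map with positive derivative and negative Schwarzian derivative on an open
interval. -/
structure NegSchwarzianData (g g1 g2 g3 : ℝ → ℝ) (α β : ℝ) : Prop where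
  hasDeriv : ∀ x ∈ Set.Ioo α β, HasDerivAt g (g1 x) x
  hasDeriv1 : ∀ x ∈ Set.Ioo α β, HasDerivAt g1 (g2 x) x
  hasDeriv2 : ∀ x ∈ Set.Ioo α β, HasDerivAt g2 (g3 x) x
  pos : ∀ x ∈ Set.Ioo α β, 0 < g1 x
  schw : ∀ x ∈ Set.Ioo α β, g3 x / g1 x - 3 / 2 * (g2 x / g1 x) ^ 2 < 0

namespace NegSchwarzianData
variable {g g1 g2 g3 : ℝ → ℝ} {α β : ℝ}

/-- The second derivative of `g'^(-1/2)` is `-(1/2) g'^(-1/2)` times the Schwarzian derivative of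
`g`. All later inequalities rest on this convexity. -/
lemma convexOn_inv_sqrt (h : NegSchwarzianData g g1 g2 g3 α β) :
    ConvexOn ℝ (Set.Ioo α β) (fun x => (Real.sqrt (g1 x))⁻¹) := by
  have hd1 : ∀ x ∈ Set.Ioo α β, HasDerivAt (fun x => (Real.sqrt (g1 x))⁻¹)
      (-(1 / 2) * g2 x * ((Real.sqrt (g1 x))⁻¹) ^ 3) x := by
    intro x hx
    have hp := h.pos x hx
    have hs := Real.sqrt_pos.2 hp
    refine (((h.hasDeriv1 x hx).sqrt hp.ne').inv hs.ne').congr_deriv ?_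
    field_simp
  have hd2 : ∀ x ∈ Set.Ioo α β, HasDerivAt
      (fun x => -(1 / 2) * g2 x * ((Real.sqrt (g1 x))⁻¹) ^ 3)
      (-(1 / 2) * g3 x * ((Real.sqrt (g1 x))⁻¹) ^ 3 + 3 / 4 * g2 x ^ 2 *
        ((Real.sqrt (g1 x))⁻¹) ^ 5) x := by
    intro x hx
    refine (((h.hasDeriv2 x hx).const_mul (-(1 / 2))).mul ((hd1 x hx).pow 3)).congr_deriv ?_
    simp only [Pi.pow_apply]
    push_cast
    ring
  refine convexOn_of_hasDerivWithinAt2_nonneg (convex_Ioo α β)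
    (fun x hx => (hd1 x hx).continuousAt.continuousWithinAt)
    (fun x hx => (hd1 x (by simpa using hx)).hasDerivWithinAt)
    (fun x hx => (hd2 x (by simpa using hx)).hasDerivWithinAt) ?_
  intro x hx
  rw [interior_Ioo] at hx
  have hp := h.pos x hx
  have hs := Real.sqrt_pos.2 hp
  have hsq : Real.sqrt (g1 x) ^ 2 = g1 x := Real.sq_sqrt hp.le
  have := h.schw x hx
  rw [← hsq] at this
  have h2 : -(1 / 2) * g3 x * ((Real.sqrt (g1 x))⁻¹) ^ 3 + 3 / 4 * g2 x ^ 2 *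
        ((Real.sqrt (g1 x))⁻¹) ^ 5 = -(1 / 2) * (Real.sqrt (g1 x))⁻¹ *
        (g3 x / Real.sqrt (g1 x) ^ 2 - 3 / 2 * (g2 x / Real.sqrt (g1 x) ^ 2) ^ 2) := by
    field_simp
    ring
  rw [h2]
  have hi : 0 < (Real.sqrt (g1 x))⁻¹ := inv_pos.2 hs
  nlinarith

lemma strictMonoOn (h : NegSchwarzianData g g1 g2 g3 α β) : StrictMonoOn g (Set.Ioo α β) := by
  refine strictMonoOn_of_deriv_pos (convex_Ioo α β)
    (fun x hx => (h.hasDeriv x hx).continuousAt.continuousWithinAt) ?_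
  intro x hx
  rw [interior_Ioo] at hx
  rw [(h.hasDeriv x hx).deriv]
  exact h.pos x hx

/-- The square of the average derivative dominates the product of the end point derivatives. -/
lemma mul_deriv_le (h : NegSchwarzianData g g1 g2 g3 α β) {x y : ℝ} (hx : x ∈ Set.Ioo α β)
    (hy : y ∈ Set.Ioo α β) (hxy : x < y) :
    g1 x * g1 y * (y - x) ^ 2 ≤ (g y - g x) ^ 2 := by
  set U : ℝ → ℝ := fun x => (Real.sqrt (g1 x))⁻¹ with hU
  have hUpos : ∀ s ∈ Set.Ioo α β, 0 < U s := fun s hs => inv_pos.2 (Real.sqrt_pos.2 (h.pos s hs))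
  have hUg : ∀ s ∈ Set.Ioo α β, g1 s = (U s ^ 2)⁻¹ := by
    intro s hs
    simp [hU, Real.sq_sqrt (h.pos s hs).le]
  set k : ℝ := (U y - U x) / (y - x) with hk
  have hyx : 0 < y - x := sub_pos.2 hxy
  have hsub : ∀ s ∈ Set.Icc x y, s ∈ Set.Ioo α β := fun s hs =>
    ⟨hx.1.trans_le hs.1, hs.2.trans_lt hy.2⟩
  have hconv : ∀ s ∈ Set.Icc x y, U s ≤ U x + k * (s - x) := by
    intro s hs
    have := h.convexOn_inv_sqrt.2 hx hy
      (div_nonneg (sub_nonneg.2 hs.2) hyx.le) (div_nonneg (sub_nonneg.2 hs.1) hyx.le)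
      (by field_simp; ring)
    simp only [smul_eq_mul] at this
    have e1 : (y - s) / (y - x) * x + (s - x) / (y - x) * y = s := by field_simp; ring
    rw [e1] at this
    refine this.trans (le_of_eq ?_)
    change (y - s) / (y - x) * U x + (s - x) / (y - x) * U y = _
    rw [hk]; field_simp; ring
  -- With `ℓ s = U x + k * (s - x)` the chord of `U`, convexity gives `g' = U⁻² ≥ ℓ⁻²`. The
  -- subtracted Möbius function is the primitive of `ℓ⁻²` vanishing at `x`; at `y` it equals `(y -
  -- x) / (U x * U y)`.
  have hmono : MonotoneOn (fun s => g s - (s - x) / (U x * (U x + k * (s - x)))) (Set.Icc x y) := by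
    have hderiv : ∀ s ∈ Set.Icc x y, HasDerivAt
        (fun s => g s - (s - x) / (U x * (U x + k * (s - x))))
        (g1 s - ((U x + k * (s - x)) ^ 2)⁻¹) s := by
      intro s hs
      have hl : 0 < U x + k * (s - x) := (hUpos s (hsub s hs)).trans_le (hconv s hs)
      have hUx := hUpos x hx
      have h1 : HasDerivAt (fun s : ℝ => s - x) 1 s := (hasDerivAt_id s).sub_const x
      have h2 : HasDerivAt (fun s : ℝ => U x * (U x + k * (s - x))) (U x * (k * 1)) s :=
        ((h1.const_mul k).const_add (U x)).const_mul (U x)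
      refine ((h.hasDeriv s (hsub s hs)).sub (h1.div h2 (mul_pos hUx hl).ne')).congr_deriv ?_
      congr 1
      field_simp
      ring
    refine monotoneOn_of_hasDerivWithinAt_nonneg (convex_Icc x y)
      (fun s hs => (hderiv s hs).continuousAt.continuousWithinAt)
      (fun s hs => (hderiv s (interior_subset hs)).hasDerivWithinAt) ?_
    intro s hs
    have hs := interior_subset hs
    rw [hUg s (hsub s hs), sub_nonneg]
    have hUs := hUpos s (hsub s hs)
    exact inv_anti₀ (by positivity) (pow_le_pow_left₀ hUs.le (hconv s hs) 2)
  have hfin := hmono (Set.left_mem_Icc.2 hxy.le) (Set.right_mem_Icc.2 hxy.le) hxy.le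
  have e2 : U x + k * (y - x) = U y := by rw [hk]; field_simp; ring
  simp only [sub_self, zero_div, sub_zero, e2] at hfin
  have hUx := hUpos x hx
  have hUy := hUpos y hy
  have h3 : 0 ≤ (y - x) / (U x * U y) := by positivity
  calc g1 x * g1 y * (y - x) ^ 2 = ((y - x) / (U x * U y)) ^ 2 := by
        rw [hUg x hx, hUg y hy]; field_simp
    _ ≤ (g y - g x) ^ 2 := pow_le_pow_left₀ h3 (by linarith) 2

/-- By `mul_deriv_le` this derivative is nonpositive, so the function of `s` decreases on each side
of its singularity `t`. Comparing two values on one side gives the three-point inequalities. -/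
lemma hasDerivAt_aux (h : NegSchwarzianData g g1 g2 g3 α β) {t s : ℝ} (ht : t ∈ Set.Ioo α β)
    (hs : s ∈ Set.Ioo α β) (hst : s ≠ t) :
    HasDerivAt (fun s => g1 t / (g t - g s) - 1 / (t - s))
      (g1 t * g1 s / (g t - g s) ^ 2 - 1 / (t - s) ^ 2) s := by
  have hne : g t - g s ≠ 0 := sub_ne_zero.2 fun e => hst (h.strictMonoOn.injOn hs ht e.symm)
  have hne' : t - s ≠ 0 := sub_ne_zero.2 hst.symm
  have h1 := (((h.hasDeriv s hs).const_sub (g t)).inv hne).const_mul (g1 t)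
  have h2 := (((hasDerivAt_id s).const_sub t).inv hne')
  have h3 := h1.sub h2
  refine (h3.congr_of_eventuallyEq (.of_forall fun z => ?_)).congr_deriv ?_
  · simp [div_eq_mul_inv]
  · simp only [id]; ring

lemma deriv_aux_nonpos (h : NegSchwarzianData g g1 g2 g3 α β) {t s : ℝ} (ht : t ∈ Set.Ioo α β)
    (hs : s ∈ Set.Ioo α β) (hst : s ≠ t) :
    g1 t * g1 s / (g t - g s) ^ 2 - 1 / (t - s) ^ 2 ≤ 0 := by
  have hne : g t - g s ≠ 0 := sub_ne_zero.2 fun e => hst (h.strictMonoOn.injOn hs ht e.symm)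
  have hne' : t - s ≠ 0 := sub_ne_zero.2 hst.symm
  have h1 : 0 < (g t - g s) ^ 2 := by positivity
  have h2 : 0 < (t - s) ^ 2 := by positivity
  rw [sub_nonpos, div_le_div_iff₀ h1 h2]
  rcases lt_or_gt_of_ne hst with h3 | h3
  · have := h.mul_deriv_le hs ht h3
    linarith
  · have := h.mul_deriv_le ht hs h3
    nlinarith

lemma three_point_left (h : NegSchwarzianData g g1 g2 g3 α β) {a b t : ℝ} (ha : a ∈ Set.Ioo α β)
    (ht : t ∈ Set.Ioo α β) (hab : a < b) (hbt : b < t) :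
    g1 t / (g t - g b) - g1 t / (g t - g a) ≤ 1 / (t - b) - 1 / (t - a) := by
  have hsub : ∀ s ∈ Set.Icc a b, s ∈ Set.Ioo α β ∧ s ≠ t := fun s hs =>
    ⟨⟨ha.1.trans_le hs.1, hs.2.trans_lt (hbt.trans ht.2)⟩, (hs.2.trans_lt hbt).ne⟩
  have := antitoneOn_of_hasDerivWithinAt_nonpos (convex_Icc a b)
    (fun s hs => (h.hasDerivAt_aux ht (hsub s hs).1 (hsub s hs).2).continuousAt.continuousWithinAt)
    (fun s hs => (h.hasDerivAt_aux ht (hsub s (interior_subset hs)).1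
      (hsub s (interior_subset hs)).2).hasDerivWithinAt)
    (fun s hs => h.deriv_aux_nonpos ht (hsub s (interior_subset hs)).1
      (hsub s (interior_subset hs)).2)
    (Set.left_mem_Icc.2 hab.le) (Set.right_mem_Icc.2 hab.le) hab.le
  simp only at this
  linarith

lemma three_point_right (h : NegSchwarzianData g g1 g2 g3 α β) {a b t : ℝ} (ha : a ∈ Set.Ioo α β)
    (ht : t ∈ Set.Ioo α β) (hab : b < a) (hbt : t < b) :
    g1 t / (g a - g t) - g1 t / (g b - g t) ≥ 1 / (a - t) - 1 / (b - t) := by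
  have hsub : ∀ s ∈ Set.Icc b a, s ∈ Set.Ioo α β ∧ s ≠ t := fun s hs =>
    ⟨⟨ht.1.trans (hbt.trans_le hs.1), hs.2.trans_lt ha.2⟩, (hbt.trans_le hs.1).ne'⟩
  have := antitoneOn_of_hasDerivWithinAt_nonpos (convex_Icc b a)
    (fun s hs => (h.hasDerivAt_aux ht (hsub s hs).1 (hsub s hs).2).continuousAt.continuousWithinAt)
    (fun s hs => (h.hasDerivAt_aux ht (hsub s (interior_subset hs)).1
      (hsub s (interior_subset hs)).2).hasDerivWithinAt)
    (fun s hs => h.deriv_aux_nonpos ht (hsub s (interior_subset hs)).1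
      (hsub s (interior_subset hs)).2)
    (Set.left_mem_Icc.2 hab.le) (Set.right_mem_Icc.2 hab.le) hab.le
  simp only at this
  rw [← neg_sub (g t) (g a), ← neg_sub (g t) (g b), ← neg_sub t a, ← neg_sub t b]
  simp only [div_neg]
  linarith

/-- This is `three_point_left` or `three_point_right` with denominators cleared. The product form
with absolute values is insensitive to orientation and survives limits and composition. -/
lemma three_point (h : NegSchwarzianData g g1 g2 g3 α β) {a b t : ℝ} (ha : a ∈ Set.Ioo α β)
    (ht : t ∈ Set.Ioo α β) (hb : (a < b ∧ b < t) ∨ (t < b ∧ b < a)) :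
    |g1 t| * |g b - g a| * |t - a| * |t - b| ≤ |b - a| * |g t - g a| * |g t - g b| := by
  rcases hb with ⟨h1, h2⟩ | ⟨h1, h2⟩
  · have hb : b ∈ Set.Ioo α β := ⟨ha.1.trans h1, h2.trans ht.2⟩
    have i1 := h.strictMonoOn ha hb h1
    have i2 := h.strictMonoOn hb ht h2
    have key := h.three_point_left ha ht h1 h2
    rw [abs_of_pos (h.pos t ht), abs_of_pos (sub_pos.2 i1), abs_of_pos (sub_pos.2 h1),
      abs_of_pos (sub_pos.2 h2), abs_of_pos (sub_pos.2 (h1.trans h2)), abs_of_pos (sub_pos.2 i2),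
      abs_of_pos (sub_pos.2 (i1.trans i2))]
    have p1 := sub_pos.2 i2
    have p2 := sub_pos.2 (i1.trans i2)
    have p3 := sub_pos.2 h2
    have p4 := sub_pos.2 (h1.trans h2)
    rw [div_sub_div _ _ p1.ne' p2.ne', div_sub_div _ _ p3.ne' p4.ne',
      div_le_div_iff₀ (mul_pos p1 p2) (mul_pos p3 p4)] at key
    nlinarith
  · have hb : b ∈ Set.Ioo α β := ⟨ht.1.trans h1, h2.trans ha.2⟩
    have i1 := h.strictMonoOn ht hb h1
    have i2 := h.strictMonoOn hb ha h2
    have key := h.three_point_right ha ht h2 h1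
    rw [abs_of_pos (h.pos t ht), abs_sub_comm (g b), abs_sub_comm t, abs_sub_comm t,
      abs_sub_comm b a, abs_sub_comm (g t), abs_sub_comm (g t), abs_of_pos (sub_pos.2 i1),
      abs_of_pos (sub_pos.2 h1),
      abs_of_pos (sub_pos.2 h2), abs_of_pos (sub_pos.2 (h1.trans h2)), abs_of_pos (sub_pos.2 i2),
      abs_of_pos (sub_pos.2 (i1.trans i2))]
    have p1 := sub_pos.2 i1
    have p2 := sub_pos.2 (i1.trans i2)
    have p3 := sub_pos.2 h1
    have p4 := sub_pos.2 (h1.trans h2)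
    rw [ge_iff_le, div_sub_div _ _ p2.ne' p1.ne', div_sub_div _ _ p4.ne' p3.ne',
      div_le_div_iff₀ (mul_pos p4 p3) (mul_pos p2 p1)] at key
    nlinarith

/-- The cross-ratio of four points is expanded. -/
lemma four_point (h : NegSchwarzianData g g1 g2 g3 α β) {a b c d : ℝ} (ha : a ∈ Set.Ioo α β)
    (hd : d ∈ Set.Ioo α β) (hab : a < b) (hbc : b < c) (hcd : c < d) :
    |d - a| * |c - b| * |g b - g a| * |g d - g c| ≤
      |g d - g a| * |g c - g b| * |b - a| * |d - c| := by
  have hb : b ∈ Set.Ioo α β := ⟨ha.1.trans hab, (hbc.trans hcd).trans hd.2⟩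
  have hc : c ∈ Set.Ioo α β := ⟨hb.1.trans hbc, hcd.trans hd.2⟩
  have m := h.strictMonoOn
  have iab := m ha hb hab
  have ibc := m hb hc hbc
  have icd := m hc hd hcd
  have hsub : ∀ t ∈ Set.Icc c d, t ∈ Set.Ioo α β ∧ b < t := fun t ht =>
    ⟨⟨hc.1.trans_le ht.1, ht.2.trans_lt hd.2⟩, hbc.trans_le ht.1⟩
  have hder : ∀ t ∈ Set.Icc c d, HasDerivAt
      (fun t => Real.log (g t - g a) - Real.log (g t - g b) - Real.log (t - a) + Real.log (t - b))
      (g1 t / (g t - g a) - g1 t / (g t - g b) - 1 / (t - a) + 1 / (t - b)) t := by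
    intro t ht
    obtain ⟨h1, h2⟩ := hsub t ht
    have i2 := m hb h1 h2
    exact (((((h.hasDeriv t h1).sub_const (g a)).log (sub_pos.2 (iab.trans i2)).ne').sub
      (((h.hasDeriv t h1).sub_const (g b)).log (sub_pos.2 i2).ne')).sub
      (((hasDerivAt_id t).sub_const a).log (sub_pos.2 (hab.trans h2)).ne')).add
      (((hasDerivAt_id t).sub_const b).log (sub_pos.2 h2).ne')
  -- Integration of the three-point inequality in `t` from `c` to `d`: the logarithm of the ratio
  -- `(g t - g a) / (g t - g b)`, relative to that of `(t - a) / (t - b)`, is increasing.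
  have key := monotoneOn_of_hasDerivWithinAt_nonneg (convex_Icc c d)
    (fun s hs => (hder s hs).continuousAt.continuousWithinAt)
    (fun s hs => (hder s (interior_subset hs)).hasDerivWithinAt)
    (fun s hs => by
      obtain ⟨h1, h2⟩ := hsub s (interior_subset hs)
      have := h.three_point_left ha h1 hab h2
      linarith) (Set.left_mem_Icc.2 hcd.le) (Set.right_mem_Icc.2 hcd.le) hcd.le
  simp only at key
  have q1 : 0 < g c - g a := by linarith
  have q2 : 0 < g c - g b := by linarith
  have q3 : 0 < g d - g a := by linarith
  have q4 : 0 < g d - g b := by linarith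
  have r1 : 0 < c - a := by linarith
  have r2 : 0 < c - b := by linarith
  have r3 : 0 < d - a := by linarith
  have r4 : 0 < d - b := by linarith
  have key2 : Real.log ((g c - g a) * (c - b) * ((g d - g b) * (d - a))) ≤
      Real.log ((g d - g a) * (d - b) * ((g c - g b) * (c - a))) := by
    rw [Real.log_mul (by positivity) (by positivity), Real.log_mul (by positivity) (by positivity),
      Real.log_mul (by positivity) (by positivity), Real.log_mul (by positivity) (by positivity),
      Real.log_mul (by positivity) (by positivity), Real.log_mul (by positivity) (by positivity)]
    linarith
  rw [Real.log_le_log_iff (by positivity) (by positivity)] at key2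
  rw [abs_of_pos r3, abs_of_pos r2, abs_of_pos (sub_pos.2 iab), abs_of_pos (sub_pos.2 icd),
    abs_of_pos q3, abs_of_pos q2, abs_of_pos (sub_pos.2 hab), abs_of_pos (sub_pos.2 hcd)]
  -- The two cross-ratios are exchanged through `(b-a)(d-c) = (c-a)(d-b) - (d-a)(c-b)` and the same
  -- identity for the images.
  linear_combination key2

end NegSchwarzianData

/-! ### Extension of the inequalities to closed intervals -/

namespace NegSchwarzianData
variable {g g1 g2 g3 : ℝ → ℝ} {α β : ℝ}

lemma tendsto_shrink {φ : ℝ → ℝ} (hαβ : α < β) (hφ : ContinuousOn φ (Set.Icc α β)) {x : ℝ}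
    (hx : x ∈ Set.Icc α β) :
    Tendsto (fun ε : ℝ => φ (x + ε * ((α + β) / 2 - x))) (𝓝[>] 0) (𝓝 (φ x)) := by
  have h1 : Tendsto (fun ε : ℝ => x + ε * ((α + β) / 2 - x)) (𝓝[>] 0) (𝓝[Set.Icc α β] x) := by
    rw [tendsto_nhdsWithin_iff]
    constructor
    · have : Continuous (fun ε : ℝ => x + ε * ((α + β) / 2 - x)) := by fun_prop
      have := this.tendsto 0
      simp only [zero_mul, add_zero] at this
      exact this.mono_left nhdsWithin_le_nhds
    · have : Set.Ioo (0 : ℝ) 1 ∈ 𝓝[>] (0 : ℝ) := Ioo_mem_nhdsGT one_pos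
      filter_upwards [this] with ε hε
      obtain ⟨h1, h2⟩ := hx
      obtain ⟨h3, h4⟩ := hε
      constructor <;> nlinarith
  exact (hφ x hx).tendsto.comp h1

lemma shrink_mem (hαβ : α < β) {x ε : ℝ} (hx : x ∈ Set.Icc α β) (hε : ε ∈ Set.Ioo (0 : ℝ) 1) :
    x + ε * ((α + β) / 2 - x) ∈ Set.Ioo α β := by
  obtain ⟨h1, h2⟩ := hx
  obtain ⟨h3, h4⟩ := hε
  constructor <;> nlinarith

lemma shrink_lt {x y m ε : ℝ} (hxy : x < y) (hε : ε ∈ Set.Ioo (0 : ℝ) 1) :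
    x + ε * (m - x) < y + ε * (m - y) := by
  obtain ⟨h3, h4⟩ := hε
  nlinarith

/-- The derivative may vanish at an end point, as it does at the critical point. The points are
moved towards the midpoint by a factor `ε`, which keeps their strict order, and `ε` tends to `0`. -/
lemma three_point_closed (h : NegSchwarzianData g g1 g2 g3 α β) (hαβ : α < β)
    (hg : ContinuousOn g (Set.Icc α β)) (hg1 : ContinuousOn g1 (Set.Icc α β)) {a b t : ℝ}
    (ha : a ∈ Set.Icc α β) (ht : t ∈ Set.Icc α β) (hb : (a ≤ b ∧ b ≤ t) ∨ (t ≤ b ∧ b ≤ a)) :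
    |g1 t| * |g b - g a| * |t - a| * |t - b| ≤ |b - a| * |g t - g a| * |g t - g b| := by
  by_cases hab : a = b
  · simp [hab]
  by_cases hbt : b = t
  · simp [hbt]
  have hb' : b ∈ Set.Icc α β := by
    obtain ⟨h1, h2⟩ := ha
    obtain ⟨h3, h4⟩ := ht
    rcases hb with ⟨h5, h6⟩ | ⟨h5, h6⟩ <;> constructor <;> linarith
  have hid : ContinuousOn (fun x : ℝ => x) (Set.Icc α β) := continuousOn_id
  have Ta := tendsto_shrink hαβ hg ha
  have Tb := tendsto_shrink hαβ hg hb'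
  have Tt := tendsto_shrink hαβ hg ht
  have T1 := tendsto_shrink hαβ hg1 ht
  have Ia := tendsto_shrink hαβ hid ha
  have Ib := tendsto_shrink hαβ hid hb'
  have It := tendsto_shrink hαβ hid ht
  refine le_of_tendsto_of_tendsto
    (((T1.abs.mul (Tb.sub Ta).abs).mul (It.sub Ia).abs).mul (It.sub Ib).abs)
    (((Ib.sub Ia).abs.mul (Tt.sub Ta).abs).mul (Tt.sub Tb).abs) ?_
  have : Set.Ioo (0 : ℝ) 1 ∈ 𝓝[>] (0 : ℝ) := Ioo_mem_nhdsGT one_pos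
  filter_upwards [this] with ε hε
  refine h.three_point (shrink_mem hαβ ha hε) (shrink_mem hαβ ht hε) ?_
  rcases hb with ⟨h1, h2⟩ | ⟨h1, h2⟩
  · exact Or.inl ⟨shrink_lt (lt_of_le_of_ne h1 hab) hε, shrink_lt (lt_of_le_of_ne h2 hbt) hε⟩
  · exact Or.inr ⟨shrink_lt (lt_of_le_of_ne h1 (Ne.symm hbt)) hε,
      shrink_lt (lt_of_le_of_ne h2 (Ne.symm hab)) hε⟩

lemma four_point_closed (h : NegSchwarzianData g g1 g2 g3 α β) (hαβ : α < β)
    (hg : ContinuousOn g (Set.Icc α β)) {a b c d : ℝ}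
    (ha : a ∈ Set.Icc α β) (hd : d ∈ Set.Icc α β) (hab : a ≤ b) (hbc : b ≤ c) (hcd : c ≤ d) :
    |d - a| * |c - b| * |g b - g a| * |g d - g c| ≤
      |g d - g a| * |g c - g b| * |b - a| * |d - c| := by
  rcases hab.eq_or_lt with rfl | hab
  · simp
  rcases hbc.eq_or_lt with rfl | hbc
  · simp
  rcases hcd.eq_or_lt with rfl | hcd
  · simp
  have hb : b ∈ Set.Icc α β := ⟨ha.1.trans hab.le, (hbc.trans hcd).le.trans hd.2⟩
  have hc : c ∈ Set.Icc α β := ⟨hb.1.trans hbc.le, hcd.le.trans hd.2⟩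
  have hid : ContinuousOn (fun x : ℝ => x) (Set.Icc α β) := continuousOn_id
  have Ta := tendsto_shrink hαβ hg ha
  have Tb := tendsto_shrink hαβ hg hb
  have Tc := tendsto_shrink hαβ hg hc
  have Td := tendsto_shrink hαβ hg hd
  have Ia := tendsto_shrink hαβ hid ha
  have Ib := tendsto_shrink hαβ hid hb
  have Ic := tendsto_shrink hαβ hid hc
  have Id := tendsto_shrink hαβ hid hd
  refine le_of_tendsto_of_tendsto
    ((((Id.sub Ia).abs.mul (Ic.sub Ib).abs).mul (Tb.sub Ta).abs).mul (Td.sub Tc).abs)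
    ((((Td.sub Ta).abs.mul (Tc.sub Tb).abs).mul (Ib.sub Ia).abs).mul (Id.sub Ic).abs) ?_
  have : Set.Ioo (0 : ℝ) 1 ∈ 𝓝[>] (0 : ℝ) := Ioo_mem_nhdsGT one_pos
  filter_upwards [this] with ε hε
  exact h.four_point (shrink_mem hαβ ha hε) (shrink_mem hαβ hd hε) (shrink_lt hab hε)
    (shrink_lt hbc hε) (shrink_lt hcd hε)

end NegSchwarzianData

/-! ### The two laps of an S-unimodal map and its nondegenerate critical point -/

namespace IsSUnimodal
variable {f : ℝ → ℝ}

lemma derivI_one (g : ℝ → ℝ) (x : ℝ) : derivI 1 g x = derivWithin g phaseI x :=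
  congrFun iteratedDerivWithin_one x

lemma continuousOn (hf : IsSUnimodal f) : ContinuousOn f phaseI := hf.contDiffOn.continuousOn

lemma uniqueDiffOn : UniqueDiffOn ℝ phaseI := uniqueDiffOn_Icc (by norm_num)

lemma continuousOn_derivI (hf : IsSUnimodal f) {k : ℕ} (hk : k ≤ 3) :
    ContinuousOn (derivI k f) phaseI :=
  hf.contDiffOn.continuousOn_iteratedDerivWithin (by exact_mod_cast hk) uniqueDiffOn

lemma hasDerivAt_derivI (hf : IsSUnimodal f) {k : ℕ} (hk : k < 3) {x : ℝ}
    (hx : x ∈ Set.Ioo (-1 : ℝ) 1) : HasDerivAt (derivI k f) (derivI (k + 1) f x) x := by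
  have hn : phaseI ∈ 𝓝 x := Icc_mem_nhds hx.1 hx.2
  have h1 := hf.contDiffOn.differentiableOn_iteratedDerivWithin (m := k)
    (by exact_mod_cast hk) uniqueDiffOn x (Set.Ioo_subset_Icc_self hx)
  have h2 := h1.hasDerivWithinAt.hasDerivAt hn
  have h3 : derivI (k + 1) f x = derivWithin (iteratedDerivWithin k f phaseI) phaseI x :=
    congrFun iteratedDerivWithin_succ x
  rw [h3]
  exact h2

lemma hasDerivAt_self (hf : IsSUnimodal f) {x : ℝ}
    (hx : x ∈ Set.Ioo (-1 : ℝ) 1) : HasDerivAt f (derivI 1 f x) x := by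
  have := hf.hasDerivAt_derivI (k := 0) (by norm_num) hx
  have h0 : derivI 0 f = f := by
    funext y; simp [derivI]
  rwa [h0] at this

lemma negSchwarzianData_left (hf : IsSUnimodal f) :
    NegSchwarzianData f (derivI 1 f) (derivI 2 f) (derivI 3 f) (-1) 0 where
  hasDeriv x hx := hf.hasDerivAt_self ⟨hx.1, hx.2.trans one_pos⟩
  hasDeriv1 x hx := hf.hasDerivAt_derivI (by norm_num) ⟨hx.1, hx.2.trans one_pos⟩
  hasDeriv2 x hx := hf.hasDerivAt_derivI (by norm_num) ⟨hx.1, hx.2.trans one_pos⟩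
  pos x hx := hf.deriv_pos x ⟨hx.1.le, hx.2⟩
  schw x hx := hf.schwarzian_neg x ⟨hx.1.le, by linarith [hx.2]⟩ hx.2.ne

/-- Passing to `-f` makes the decreasing lap increasing and leaves the Schwarzian derivative
unchanged, since it involves only quotients of derivatives. -/
lemma negSchwarzianData_right (hf : IsSUnimodal f) :
    NegSchwarzianData (fun x => -f x) (fun x => -derivI 1 f x) (fun x => -derivI 2 f x)
      (fun x => -derivI 3 f x) 0 1 where
  hasDeriv x hx := (hf.hasDerivAt_self ⟨by linarith [hx.1], hx.2⟩).neg
  hasDeriv1 x hx := (hf.hasDerivAt_derivI (by norm_num) ⟨by linarith [hx.1], hx.2⟩).neg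
  hasDeriv2 x hx := (hf.hasDerivAt_derivI (by norm_num) ⟨by linarith [hx.1], hx.2⟩).neg
  pos x hx := neg_pos.2 (hf.deriv_neg x ⟨hx.1, hx.2.le⟩)
  schw x hx := by
    simp only [neg_div_neg_eq]
    exact hf.schwarzian_neg x ⟨by linarith [hx.1], hx.2.le⟩ hx.1.ne'

lemma Icc_left_subset : Set.Icc (-1 : ℝ) 0 ⊆ phaseI := Set.Icc_subset_Icc_right zero_le_one
lemma Icc_right_subset : Set.Icc (0 : ℝ) 1 ⊆ phaseI := Set.Icc_subset_Icc_left (by norm_num)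

/-- `S` is one of the two closed laps of a unimodal map. -/
def IsLap (S : Set ℝ) : Prop := S = Set.Icc (-1 : ℝ) 0 ∨ S = Set.Icc (0 : ℝ) 1

lemma three_point_lap (hf : IsSUnimodal f) {S : Set ℝ} (hS : IsLap S) {a b t : ℝ}
    (ha : a ∈ S) (ht : t ∈ S) (hb : (a ≤ b ∧ b ≤ t) ∨ (t ≤ b ∧ b ≤ a)) :
    |derivWithin f phaseI t| * |f b - f a| * |t - a| * |t - b| ≤
      |b - a| * |f t - f a| * |f t - f b| := by
  rw [← derivI_one]
  rcases hS with rfl | rfl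
  · exact hf.negSchwarzianData_left.three_point_closed (by norm_num)
      (hf.continuousOn.mono Icc_left_subset)
      ((hf.continuousOn_derivI (by norm_num)).mono Icc_left_subset) ha ht hb
  · have := hf.negSchwarzianData_right.three_point_closed (by norm_num)
      (hf.continuousOn.mono Icc_right_subset).neg
      ((hf.continuousOn_derivI (by norm_num)).mono Icc_right_subset).neg ha ht hb
    rw [abs_sub_comm (f b) (f a), abs_sub_comm (f t) (f a), abs_sub_comm (f t) (f b)]
    simpa only [neg_sub_neg, abs_neg] using this

lemma four_point_lap (hf : IsSUnimodal f) {S : Set ℝ} (hS : IsLap S) {a b c d : ℝ}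
    (ha : a ∈ S) (hd : d ∈ S) (hab : a ≤ b) (hbc : b ≤ c) (hcd : c ≤ d) :
    |d - a| * |c - b| * |f b - f a| * |f d - f c| ≤
      |f d - f a| * |f c - f b| * |b - a| * |d - c| := by
  rcases hS with rfl | rfl
  · exact hf.negSchwarzianData_left.four_point_closed (by norm_num)
      (hf.continuousOn.mono Icc_left_subset) ha hd hab hbc hcd
  · have := hf.negSchwarzianData_right.four_point_closed (by norm_num)
      (hf.continuousOn.mono Icc_right_subset).neg ha hd hab hbc hcd
    rw [abs_sub_comm (f b) (f a), abs_sub_comm (f d) (f c), abs_sub_comm (f d) (f a),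
      abs_sub_comm (f c) (f b)]
    simpa only [neg_sub_neg] using this

lemma strictMonoOn_left (hf : IsSUnimodal f) : StrictMonoOn f (Set.Icc (-1) 0) := by
  refine strictMonoOn_of_deriv_pos (convex_Icc _ _) (hf.continuousOn.mono Icc_left_subset) ?_
  intro x hx
  rw [interior_Icc] at hx
  rw [(hf.negSchwarzianData_left.hasDeriv x hx).deriv]
  exact hf.negSchwarzianData_left.pos x hx

lemma strictAntiOn_right (hf : IsSUnimodal f) : StrictAntiOn f (Set.Icc 0 1) := by
  refine strictAntiOn_of_deriv_neg (convex_Icc _ _) (hf.continuousOn.mono Icc_right_subset) ?_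
  intro x hx
  rw [interior_Icc] at hx
  rw [(hf.hasDerivAt_self ⟨by linarith [hx.1], hx.2⟩).deriv]
  exact hf.deriv_neg x ⟨hx.1, hx.2.le⟩

lemma derivI_zero (hf : IsSUnimodal f) : derivI 1 f 0 = 0 := by
  have hc : ContinuousAt (derivI 1 f) 0 :=
    (hf.continuousOn_derivI (by norm_num)).continuousAt (Icc_mem_nhds (by norm_num) (by norm_num))
  apply le_antisymm
  · refine le_of_tendsto (hc.tendsto.mono_left (nhdsWithin_le_nhds (s := Set.Ioi 0))) ?_
    filter_upwards [Ioo_mem_nhdsGT (one_pos (α := ℝ))] with x hx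
    exact (hf.deriv_neg x ⟨hx.1, hx.2.le⟩).le
  · refine ge_of_tendsto (hc.tendsto.mono_left (nhdsWithin_le_nhds (s := Set.Iio 0))) ?_
    filter_upwards [Ioo_mem_nhdsLT (show (-1 : ℝ) < 0 by norm_num)] with x hx
    exact (hf.deriv_pos x ⟨hx.1.le, hx.2⟩).le

/-- The critical point is nondegenerate: `|f' x|` is comparable with `|x|`. -/
lemma exists_deriv_bounds (hf : IsSUnimodal f) : ∃ c₁ c₂ : ℝ, 0 < c₁ ∧ 0 < c₂ ∧
    ∀ x ∈ phaseI, c₁ * |x| ≤ |derivI 1 f x| ∧ |derivI 1 f x| ≤ c₂ * |x| := by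
  have hn : phaseI ∈ 𝓝 (0 : ℝ) := Icc_mem_nhds (by norm_num) (by norm_num)
  have hd := hf.hasDerivAt_derivI (k := 1) (by norm_num) (x := 0) (by norm_num)
  -- The quotient `f'(x) / x`, completed by `f''(0)` at `0`, is continuous and never zero on the
  -- compact interval, so its modulus lies between positive constants.
  have hcont : ContinuousOn (fun x => |dslope (derivI 1 f) 0 x|) phaseI :=
    ((continuousOn_dslope hn).2 ⟨hf.continuousOn_derivI (by norm_num), hd.differentiableAt⟩).abs
  have hpos : ∀ x ∈ phaseI, 0 < |dslope (derivI 1 f) 0 x| := by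
    intro x hx
    rw [abs_pos]
    by_cases h0 : x = 0
    · subst h0
      rw [dslope_same, hd.deriv]
      exact hf.deriv_two_neg.ne
    · rw [dslope_of_ne _ h0, slope_def_field, hf.derivI_zero, sub_zero, sub_zero]
      refine div_ne_zero ?_ h0
      rcases lt_or_gt_of_ne h0 with h | h
      · exact (hf.deriv_pos x ⟨hx.1, h⟩).ne'
      · exact (hf.deriv_neg x ⟨h, hx.2⟩).ne
  have hK : IsCompact phaseI := isCompact_Icc
  have hne : phaseI.Nonempty := ⟨0, by norm_num, by norm_num⟩
  obtain ⟨x1, hx1, hmin⟩ := hK.exists_isMinOn hne hcont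
  obtain ⟨x2, hx2, hmax⟩ := hK.exists_isMaxOn hne hcont
  refine ⟨_, _, hpos x1 hx1, hpos x2 hx2, fun x hx => ?_⟩
  have h1 : |dslope (derivI 1 f) 0 x1| ≤ |dslope (derivI 1 f) 0 x| := hmin hx
  have h2 : |dslope (derivI 1 f) 0 x| ≤ |dslope (derivI 1 f) 0 x2| := hmax hx
  have h3 : |derivI 1 f x| = |dslope (derivI 1 f) 0 x| * |x| := by
    have := sub_smul_dslope (derivI 1 f) 0 x
    rw [hf.derivI_zero, sub_zero, sub_zero, smul_eq_mul] at this
    rw [← this, abs_mul, mul_comm]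
  rw [h3]
  exact ⟨mul_le_mul_of_nonneg_right h1 (abs_nonneg _),
    mul_le_mul_of_nonneg_right h2 (abs_nonneg _)⟩

end IsSUnimodal

/-! ### Strictly monotone maps and monotone iterates -/

/-- Strictly monotone or strictly antitone on a set. -/
def StrictOn (g : ℝ → ℝ) (s : Set ℝ) : Prop := StrictMonoOn g s ∨ StrictAntiOn g s

namespace StrictOn
variable {g h : ℝ → ℝ} {s t : Set ℝ} {x y : ℝ}

lemma mono (hg : StrictOn g s) (hts : t ⊆ s) : StrictOn g t :=
  hg.imp (fun h => h.mono hts) (fun h => h.mono hts)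

lemma injOn (hg : StrictOn g s) : Set.InjOn g s := hg.elim (fun h => h.injOn) (fun h => h.injOn)

lemma comp (hg : StrictOn g t) (hh : StrictOn h s) (hm : Set.MapsTo h s t) :
    StrictOn (g ∘ h) s := by
  rcases hg with hg | hg <;> rcases hh with hh | hh
  · exact Or.inl (hg.comp hh hm)
  · exact Or.inr (hg.comp_strictAntiOn hh hm)
  · exact Or.inr (hg.comp_strictMonoOn hh hm)
  · exact Or.inl (hg.comp hh hm)

lemma mem_uIcc (hg : StrictOn g (Set.uIcc x y)) {z : ℝ} (hz : z ∈ Set.uIcc x y) :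
    g z ∈ Set.uIcc (g x) (g y) := by
  have hx : x ∈ Set.uIcc x y := Set.left_mem_uIcc
  have hy : y ∈ Set.uIcc x y := Set.right_mem_uIcc
  rw [Set.mem_uIcc] at hz ⊢
  rcases hg with hg | hg
  · rcases hz with ⟨h1, h2⟩ | ⟨h1, h2⟩
    · exact Or.inl ⟨hg.monotoneOn hx (Set.mem_uIcc.2 (Or.inl ⟨h1, h2⟩)) h1,
        hg.monotoneOn (Set.mem_uIcc.2 (Or.inl ⟨h1, h2⟩)) hy h2⟩
    · exact Or.inr ⟨hg.monotoneOn hy (Set.mem_uIcc.2 (Or.inr ⟨h1, h2⟩)) h1,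
        hg.monotoneOn (Set.mem_uIcc.2 (Or.inr ⟨h1, h2⟩)) hx h2⟩
  · rcases hz with ⟨h1, h2⟩ | ⟨h1, h2⟩
    · exact Or.inr ⟨hg.antitoneOn (Set.mem_uIcc.2 (Or.inl ⟨h1, h2⟩)) hy h2,
        hg.antitoneOn hx (Set.mem_uIcc.2 (Or.inl ⟨h1, h2⟩)) h1⟩
    · exact Or.inl ⟨hg.antitoneOn (Set.mem_uIcc.2 (Or.inr ⟨h1, h2⟩)) hx h2,
        hg.antitoneOn hy (Set.mem_uIcc.2 (Or.inr ⟨h1, h2⟩)) h1⟩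

lemma mem_uIoo_iff {x y z : ℝ} : z ∈ Set.uIoo x y ↔ z ∈ Set.uIcc x y ∧ z ≠ x ∧ z ≠ y := by
  rcases le_total x y with h | h
  · rw [Set.uIoo_of_le h, Set.uIcc_of_le h]
    constructor
    · rintro ⟨h1, h2⟩
      exact ⟨⟨h1.le, h2.le⟩, h1.ne', h2.ne⟩
    · rintro ⟨⟨h1, h2⟩, h3, h4⟩
      exact ⟨lt_of_le_of_ne h1 h3.symm, lt_of_le_of_ne h2 h4⟩
  · rw [Set.uIoo_of_ge h, Set.uIcc_of_ge h]
    constructor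
    · rintro ⟨h1, h2⟩
      exact ⟨⟨h1.le, h2.le⟩, h2.ne, h1.ne'⟩
    · rintro ⟨⟨h1, h2⟩, h3, h4⟩
      exact ⟨lt_of_le_of_ne h1 h4.symm, lt_of_le_of_ne h2 h3⟩

lemma mem_uIoo (hg : StrictOn g (Set.uIcc x y)) {z : ℝ} (hz : z ∈ Set.uIoo x y) :
    g z ∈ Set.uIoo (g x) (g y) := by
  rw [mem_uIoo_iff] at hz ⊢
  exact ⟨hg.mem_uIcc hz.1, fun h => hz.2.1 (hg.injOn hz.1 Set.left_mem_uIcc h),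
    fun h => hz.2.2 (hg.injOn hz.1 Set.right_mem_uIcc h)⟩

lemma image_uIoo (hg : StrictOn g (Set.uIcc x y)) (hc : ContinuousOn g (Set.uIcc x y)) :
    g '' Set.uIoo x y = Set.uIoo (g x) (g y) := by
  refine Set.Subset.antisymm (Set.image_subset_iff.2 fun _ hz => hg.mem_uIoo hz) fun w hw => ?_
  rw [mem_uIoo_iff] at hw
  obtain ⟨z, hz, rfl⟩ := intermediate_value_uIcc hc hw.1
  exact ⟨z, mem_uIoo_iff.2 ⟨hz, fun h => hw.2.1 (h ▸ rfl), fun h => hw.2.2 (h ▸ rfl)⟩, rfl⟩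

end StrictOn

/-- No point strictly between `x` and `y` meets the critical point before time `n`. -/
def MonoIter (f : ℝ → ℝ) (n : ℕ) (x y : ℝ) : Prop :=
  ∀ k < n, ∀ z ∈ Set.uIoo x y, f^[k] z ≠ 0

lemma MonoIter.symm {f : ℝ → ℝ} {n : ℕ} {x y : ℝ} (h : MonoIter f n x y) : MonoIter f n y x :=
  fun k hk z hz => h k hk z (by rwa [Set.uIoo_comm])

lemma MonoIter.le {f : ℝ → ℝ} {n m : ℕ} {x y : ℝ} (h : MonoIter f n x y) (hm : m ≤ n) :
    MonoIter f m x y := fun k hk => h k (hk.trans_le hm)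

lemma uIoo_subset_uIoo_of_mem {x y x' y' : ℝ} (hx : x' ∈ Set.uIcc x y) (hy : y' ∈ Set.uIcc x y) :
    Set.uIoo x' y' ⊆ Set.uIoo x y :=
  Set.Ioo_subset_Ioo (le_min hx.1 hy.1) (max_le hx.2 hy.2)

lemma MonoIter.sub {f : ℝ → ℝ} {n : ℕ} {x y x' y' : ℝ} (h : MonoIter f n x y)
    (hx : x' ∈ Set.uIcc x y) (hy : y' ∈ Set.uIcc x y) : MonoIter f n x' y' :=
  fun k hk z hz => h k hk z (uIoo_subset_uIoo_of_mem hx hy hz)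

/-! ### Inequalities for iterates, and disjointness of the iterates of an interval -/

namespace IsSUnimodal
variable {f : ℝ → ℝ}

lemma uIcc_subset {x y : ℝ} (hx : x ∈ phaseI) (hy : y ∈ phaseI) : Set.uIcc x y ⊆ phaseI :=
  Set.uIcc_subset_Icc hx hy

lemma IsLap.subset {S : Set ℝ} (hS : IsLap S) : S ⊆ phaseI := by
  rcases hS with rfl | rfl
  exacts [Icc_left_subset, Icc_right_subset]

lemma IsLap.uIcc_subset {S : Set ℝ} (hS : IsLap S) {x y : ℝ} (hx : x ∈ S) (hy : y ∈ S) :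
    Set.uIcc x y ⊆ S := by
  rcases hS with rfl | rfl <;> exact Set.uIcc_subset_Icc hx hy

lemma strictOn_lap (hf : IsSUnimodal f) {S : Set ℝ} (hS : IsLap S) : StrictOn f S := by
  rcases hS with rfl | rfl
  exacts [Or.inl hf.strictMonoOn_left, Or.inr hf.strictAntiOn_right]

lemma iterate_mem (hf : IsSUnimodal f) (n : ℕ) {x : ℝ} (hx : x ∈ phaseI) : f^[n] x ∈ phaseI :=
  hf.mapsTo.iterate n hx

lemma contDiffOn_iterate (hf : IsSUnimodal f) (n : ℕ) : ContDiffOn ℝ 3 (f^[n]) phaseI := by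
  induction n with
  | zero => exact contDiffOn_id
  | succ n ih => exact ih.comp hf.contDiffOn hf.mapsTo

lemma continuousOn_iterate (hf : IsSUnimodal f) (n : ℕ) : ContinuousOn (f^[n]) phaseI :=
  (hf.contDiffOn_iterate n).continuousOn

lemma hasDerivWithinAt_iterate (hf : IsSUnimodal f) (n : ℕ) {x : ℝ} (hx : x ∈ phaseI) :
    HasDerivWithinAt (f^[n]) (derivI 1 (f^[n]) x) phaseI x := by
  rw [derivI_one]
  exact ((hf.contDiffOn_iterate n).differentiableOn (by norm_num) x hx).hasDerivWithinAt

lemma derivI_iterate_add (hf : IsSUnimodal f) (m n : ℕ) {x : ℝ} (hx : x ∈ phaseI) :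
    derivI 1 (f^[m + n]) x = derivI 1 (f^[m]) (f^[n] x) * derivI 1 (f^[n]) x := by
  have := (hf.hasDerivWithinAt_iterate m (hf.iterate_mem n hx)).comp x
    (hf.hasDerivWithinAt_iterate n hx) (fun y hy => hf.iterate_mem n hy)
  rw [← Function.iterate_add] at this
  rw [derivI_one (f^[m + n])]
  exact this.derivWithin (uniqueDiffOn x hx)

lemma derivI_iterate_succ (hf : IsSUnimodal f) (m : ℕ) {x : ℝ} (hx : x ∈ phaseI) :
    derivI 1 (f^[m + 1]) x = derivI 1 (f^[m]) (f x) * derivI 1 f x := by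
  simpa using hf.derivI_iterate_add m 1 hx

lemma derivI_ne_zero (hf : IsSUnimodal f) {x : ℝ} (hx : x ∈ phaseI) (h0 : x ≠ 0) :
    derivI 1 f x ≠ 0 := by
  rcases lt_or_gt_of_ne h0 with h | h
  · exact (hf.deriv_pos x ⟨hx.1, h⟩).ne'
  · exact (hf.deriv_neg x ⟨h, hx.2⟩).ne

lemma derivI_iterate_ne_zero (hf : IsSUnimodal f) (n : ℕ) {x : ℝ} (hx : x ∈ phaseI)
    (h : ∀ k < n, f^[k] x ≠ 0) : derivI 1 (f^[n]) x ≠ 0 := by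
  induction n generalizing x with
  | zero =>
    rw [derivI_one]
    have : derivWithin (f^[0]) phaseI x = 1 := derivWithin_id x phaseI (uniqueDiffOn x hx)
    rw [this]; exact one_ne_zero
  | succ n ih =>
    rw [hf.derivI_iterate_succ n hx]
    refine mul_ne_zero (ih (hf.mapsTo hx) fun k hk => ?_) (hf.derivI_ne_zero hx (h 0 (by omega)))
    have := h (k + 1) (by omega)
    rwa [Function.iterate_succ_apply] at this

/-- A periodic critical point would have multiplier `0`. -/
lemma iterate_zero_ne (hf : IsSUnimodal f) (hrep : AllPeriodicRepelling f) {p : ℕ} (hp : 0 < p) :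
    f^[p] 0 ≠ 0 := by
  intro h
  have h0 : (0 : ℝ) ∈ phaseI := ⟨by norm_num, by norm_num⟩
  have := hrep 0 h0 p hp h
  obtain ⟨q, rfl⟩ := Nat.exists_eq_succ_of_ne_zero hp.ne'
  rw [hf.derivI_iterate_succ q h0, hf.derivI_zero] at this
  norm_num at this

lemma exists_lap {n : ℕ} {x y : ℝ} (hx : x ∈ phaseI) (hy : y ∈ phaseI)
    (h : MonoIter f (n + 1) x y) : ∃ S, IsLap S ∧ x ∈ S ∧ y ∈ S := by
  have h0 : (0 : ℝ) ∉ Set.uIoo x y := fun hz => h 0 (by omega) 0 hz rfl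
  obtain ⟨hx1, hx2⟩ := hx
  obtain ⟨hy1, hy2⟩ := hy
  by_cases h1 : x ≤ 0 ∧ y ≤ 0
  · exact ⟨_, Or.inl rfl, ⟨hx1, h1.1⟩, ⟨hy1, h1.2⟩⟩
  by_cases h2 : 0 ≤ x ∧ 0 ≤ y
  · exact ⟨_, Or.inr rfl, ⟨h2.1, hx2⟩, ⟨h2.2, hy2⟩⟩
  exfalso
  apply h0
  constructor
  · rw [inf_lt_iff]
    by_contra hc
    push Not at hc
    exact h2 hc
  · rw [lt_sup_iff]
    by_contra hc
    push Not at hc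
    exact h1 hc

lemma MonoIter.map (hf : IsSUnimodal f) {n : ℕ} {x y : ℝ} (hx : x ∈ phaseI) (hy : y ∈ phaseI)
    (h : MonoIter f (n + 1) x y) : StrictOn f (Set.uIcc x y) ∧ MonoIter f n (f x) (f y) := by
  obtain ⟨S, hS, hxS, hyS⟩ := exists_lap hx hy h
  have hs := (hf.strictOn_lap hS).mono (hS.uIcc_subset hxS hyS)
  refine ⟨hs, fun k hk z hz => ?_⟩
  rw [← hs.image_uIoo (hf.continuousOn.mono (uIcc_subset hx hy))] at hz
  obtain ⟨w, hw, rfl⟩ := hz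
  exact h (k + 1) (by omega) w hw

lemma strictOn_iterate (hf : IsSUnimodal f) {n : ℕ} {x y : ℝ} (hx : x ∈ phaseI) (hy : y ∈ phaseI)
    (h : MonoIter f n x y) : StrictOn (f^[n]) (Set.uIcc x y) := by
  induction n generalizing x y with
  | zero => exact Or.inl strictMonoOn_id
  | succ n ih =>
    obtain ⟨h1, h2⟩ := MonoIter.map hf hx hy h
    exact (ih (hf.mapsTo hx) (hf.mapsTo hy) h2).comp h1 fun z hz => h1.mem_uIcc hz

lemma image_uIoo (hf : IsSUnimodal f) {n : ℕ} {x y : ℝ} (hx : x ∈ phaseI) (hy : y ∈ phaseI)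
    (h : MonoIter f n x y) : f^[n] '' Set.uIoo x y = Set.uIoo (f^[n] x) (f^[n] y) :=
  (hf.strictOn_iterate hx hy h).image_uIoo ((hf.continuousOn_iterate n).mono (uIcc_subset hx hy))

/-- Splitting of monotone iterates. -/
lemma monoIter_add_iff (hf : IsSUnimodal f) {m n : ℕ} {x y : ℝ} (hx : x ∈ phaseI)
    (hy : y ∈ phaseI) :
    MonoIter f (n + m) x y ↔ MonoIter f n x y ∧ MonoIter f m (f^[n] x) (f^[n] y) := by
  constructor
  · intro h
    have h1 : MonoIter f n x y := h.le (by omega)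
    refine ⟨h1, fun k hk z hz => ?_⟩
    rw [← hf.image_uIoo hx hy h1] at hz
    obtain ⟨w, hw, rfl⟩ := hz
    rw [← Function.iterate_add_apply]
    exact h _ (by omega) w hw
  · rintro ⟨h1, h2⟩ k hk z hz
    by_cases hkn : k < n
    · exact h1 k hkn z hz
    · have h3 : f^[n] z ∈ Set.uIoo (f^[n] x) (f^[n] y) := by
        rw [← hf.image_uIoo hx hy h1]
        exact ⟨z, hz, rfl⟩
      have := h2 (k - n) (by omega) _ h3
      rwa [← Function.iterate_add_apply, Nat.sub_add_cancel (by omega)] at this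

/-- The inequality is stable under composition: by the chain rule, those for `f` and for the
remaining iterate multiply, and the intermediate distances cancel. These are nonzero once the
degenerate cases are removed. -/
lemma three_point_iterate (hf : IsSUnimodal f) {n : ℕ} {a b t : ℝ} (ha : a ∈ phaseI)
    (ht : t ∈ phaseI) (hb : b ∈ Set.uIcc a t) (h : MonoIter f n a t) :
    |derivI 1 (f^[n]) t| * |f^[n] b - f^[n] a| * |t - a| * |t - b| ≤
      |b - a| * |f^[n] t - f^[n] a| * |f^[n] t - f^[n] b| := by
  by_cases hat : a = t
  · subst hat
    simp
  by_cases hbt : b = t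
  · simp [hbt]
  induction n generalizing a b t with
  | zero =>
    have : derivI 1 (f^[0]) t = 1 := by
      rw [derivI_one]; exact derivWithin_id t phaseI (uniqueDiffOn t ht)
    rw [this]
    simp
  | succ n ih =>
    obtain ⟨S, hS, haS, htS⟩ := exists_lap ha ht h
    obtain ⟨hs, hM⟩ := MonoIter.map hf ha ht h
    have e1 := hf.three_point_lap hS haS htS (Set.mem_uIcc.1 hb)
    have hfat : f a ≠ f t := fun e => hat (hs.injOn Set.left_mem_uIcc Set.right_mem_uIcc e)
    have hfbt : f b ≠ f t := fun e => hbt (hs.injOn hb Set.right_mem_uIcc e)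
    have e2 := ih (hf.mapsTo ha) (hf.mapsTo ht) (hs.mem_uIcc hb) hM hfat hfbt
    rw [hf.derivI_iterate_succ n ht, abs_mul]
    rw [← derivI_one] at e1
    simp only [Function.iterate_succ_apply]
    have p1 : 0 < |f t - f a| := abs_pos.2 (sub_ne_zero.2 hfat.symm)
    have p2 : 0 < |f t - f b| := abs_pos.2 (sub_ne_zero.2 hfbt.symm)
    refine le_of_mul_le_mul_right ?_ (mul_pos p1 p2)
    calc |derivI 1 (f^[n]) (f t)| * |derivI 1 f t| * |f^[n] (f b) - f^[n] (f a)| * |t - a| *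
          |t - b| * (|f t - f a| * |f t - f b|)
        = (|derivI 1 (f^[n]) (f t)| * |f^[n] (f b) - f^[n] (f a)| * |f t - f a| * |f t - f b|) *
          (|derivI 1 f t| * |t - a| * |t - b|) := by ring
      _ ≤ (|f b - f a| * |f^[n] (f t) - f^[n] (f a)| * |f^[n] (f t) - f^[n] (f b)|) *
          (|derivI 1 f t| * |t - a| * |t - b|) := by gcongr
      _ = (|derivI 1 f t| * |f b - f a| * |t - a| * |t - b|) *
          (|f^[n] (f t) - f^[n] (f a)| * |f^[n] (f t) - f^[n] (f b)|) := by ring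
      _ ≤ (|b - a| * |f t - f a| * |f t - f b|) *
          (|f^[n] (f t) - f^[n] (f a)| * |f^[n] (f t) - f^[n] (f b)|) := by gcongr
      _ = _ := by ring

/-- Expansion factors of the cross-ratio multiply along the orbit. Both orderings must be carried,
since each step on the right lap reverses the order. -/
lemma four_point_iterate (hf : IsSUnimodal f) {n : ℕ} {a b c d : ℝ} (ha : a ∈ phaseI)
    (hd : d ∈ phaseI) (ho : (a ≤ b ∧ b ≤ c ∧ c ≤ d) ∨ (d ≤ c ∧ c ≤ b ∧ b ≤ a))
    (h : MonoIter f n a d) :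
    |d - a| * |c - b| * |f^[n] b - f^[n] a| * |f^[n] d - f^[n] c| ≤
      |f^[n] d - f^[n] a| * |f^[n] c - f^[n] b| * |b - a| * |d - c| := by
  wlog hw : a ≤ b ∧ b ≤ c ∧ c ≤ d generalizing a b c d
  · have := this hd ha (Or.inl (ho.resolve_left hw)) h.symm (ho.resolve_left hw)
    rw [abs_sub_comm d a, abs_sub_comm c b, abs_sub_comm (f^[n] b) (f^[n] a),
      abs_sub_comm (f^[n] d) (f^[n] c), abs_sub_comm (f^[n] d) (f^[n] a),
      abs_sub_comm (f^[n] c) (f^[n] b), abs_sub_comm b a, abs_sub_comm d c]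
    linarith
  clear ho
  obtain ⟨hab, hbc, hcd⟩ := hw
  rcases hab.eq_or_lt with rfl | hab
  · simp
  rcases hbc.eq_or_lt with rfl | hbc
  · simp
  rcases hcd.eq_or_lt with rfl | hcd
  · simp
  have key : ∀ n, ∀ a b c d : ℝ, a ∈ phaseI → d ∈ phaseI →
      ((a < b ∧ b < c ∧ c < d) ∨ (d < c ∧ c < b ∧ b < a)) → MonoIter f n a d →
      |d - a| * |c - b| * |f^[n] b - f^[n] a| * |f^[n] d - f^[n] c| ≤
      |f^[n] d - f^[n] a| * |f^[n] c - f^[n] b| * |b - a| * |d - c| := by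
    clear * - hf
    intro n
    induction n with
    | zero =>
      intro a b c d _ _ _ _
      simp
    | succ n ih =>
      intro a b c d ha hd ho h
      obtain ⟨S, hS, haS, hdS⟩ := exists_lap ha hd h
      obtain ⟨hs, hM⟩ := MonoIter.map hf ha hd h
      have e1 : |d - a| * |c - b| * |f b - f a| * |f d - f c| ≤
          |f d - f a| * |f c - f b| * |b - a| * |d - c| := by
        rcases ho with ⟨h1, h2, h3⟩ | ⟨h1, h2, h3⟩
        · exact hf.four_point_lap hS haS hdS h1.le h2.le h3.le
        · have := hf.four_point_lap hS hdS haS h1.le h2.le h3.le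
          rw [abs_sub_comm d a, abs_sub_comm c b, abs_sub_comm (f b) (f a),
            abs_sub_comm (f d) (f c), abs_sub_comm (f d) (f a), abs_sub_comm (f c) (f b),
            abs_sub_comm b a, abs_sub_comm d c]
          linarith
      have hbm : b ∈ Set.uIcc a d := by
        rw [Set.mem_uIcc]
        rcases ho with ⟨h1, h2, h3⟩ | ⟨h1, h2, h3⟩
        · exact Or.inl ⟨h1.le, (h2.trans h3).le⟩
        · exact Or.inr ⟨(h1.trans h2).le, h3.le⟩
      have hcm : c ∈ Set.uIcc a d := by
        rw [Set.mem_uIcc]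
        rcases ho with ⟨h1, h2, h3⟩ | ⟨h1, h2, h3⟩
        · exact Or.inl ⟨(h1.trans h2).le, h3.le⟩
        · exact Or.inr ⟨h1.le, (h2.trans h3).le⟩
      have ho' : (f a < f b ∧ f b < f c ∧ f c < f d) ∨ (f d < f c ∧ f c < f b ∧ f b < f a) := by
        have ham : a ∈ Set.uIcc a d := Set.left_mem_uIcc
        have hdm : d ∈ Set.uIcc a d := Set.right_mem_uIcc
        rcases hs with hs | hs <;> rcases ho with ⟨h1, h2, h3⟩ | ⟨h1, h2, h3⟩
        · exact Or.inl ⟨hs ham hbm h1, hs hbm hcm h2, hs hcm hdm h3⟩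
        · exact Or.inr ⟨hs hdm hcm h1, hs hcm hbm h2, hs hbm ham h3⟩
        · exact Or.inr ⟨hs hcm hdm h3, hs hbm hcm h2, hs ham hbm h1⟩
        · exact Or.inl ⟨hs hbm ham h3, hs hcm hbm h2, hs hdm hcm h1⟩
      have e2 := ih (f a) (f b) (f c) (f d) (hf.mapsTo ha) (hf.mapsTo hd) ho' hM
      have hne : f a ≠ f b ∧ f b ≠ f c ∧ f c ≠ f d ∧ f a ≠ f d := by
        rcases ho' with ⟨h1, h2, h3⟩ | ⟨h1, h2, h3⟩
        · exact ⟨h1.ne, h2.ne, h3.ne, (h1.trans (h2.trans h3)).ne⟩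
        · exact ⟨h3.ne', h2.ne', h1.ne', (h1.trans (h2.trans h3)).ne'⟩
      simp only [Function.iterate_succ_apply]
      have p1 : 0 < |f d - f a| := abs_pos.2 (sub_ne_zero.2 hne.2.2.2.symm)
      have p2 : 0 < |f c - f b| := abs_pos.2 (sub_ne_zero.2 hne.2.1.symm)
      have p3 : 0 < |f b - f a| := abs_pos.2 (sub_ne_zero.2 hne.1.symm)
      have p4 : 0 < |f d - f c| := abs_pos.2 (sub_ne_zero.2 hne.2.2.1.symm)
      have p : 0 < (|f d - f a| * |f c - f b|) * (|f b - f a| * |f d - f c|) := by positivity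
      refine le_of_mul_le_mul_right ?_ p
      have := mul_le_mul e1 e2 (by positivity) (by positivity)
      linarith
  exact key n a b c d ha hd (Or.inl ⟨hab, hbc, hcd⟩) h

/-- A monotone iterate pointing inwards at both ends of an interval has a non-repelling fixed
point. -/
lemma not_monotone_inward (hf : IsSUnimodal f) (hrep : AllPeriodicRepelling f) {p : ℕ}
    (hp : 0 < p) {l₀ l₁ : ℝ} (h0 : l₀ ∈ phaseI) (h1 : l₁ ∈ phaseI) (hl : l₀ < l₁)
    (hm : MonotoneOn (f^[p]) (Set.Icc l₀ l₁)) (hl0 : l₀ ≤ f^[p] l₀) (hl1 : f^[p] l₁ ≤ l₁) :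
    False := by
  have hsub : Set.Icc l₀ l₁ ⊆ phaseI := Set.Icc_subset_Icc h0.1 h1.2
  have hcont : ContinuousOn (f^[p]) (Set.Icc l₀ l₁) := (hf.continuousOn_iterate p).mono hsub
  -- If `l₀` itself is fixed, repulsion pushes nearby points to the right of themselves.
  have hx0 : ∃ x₀ ∈ Set.Ico l₀ l₁, x₀ < f^[p] x₀ := by
    rcases hl0.lt_or_eq with h | h
    · exact ⟨l₀, ⟨le_rfl, hl⟩, h⟩
    · have hd := hrep l₀ h0 p hp h.symm
      have ht := (hasDerivWithinAt_iff_tendsto_slope.1 (hf.hasDerivWithinAt_iterate p h0)).mono_left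
        (nhdsWithin_mono l₀ (s := Set.Ioo l₀ l₁) fun x hx =>
          ⟨hsub (Set.Ioo_subset_Icc_self hx), hx.1.ne'⟩)
      have hne : (𝓝[Set.Ioo l₀ l₁] l₀).NeBot := left_nhdsWithin_Ioo_neBot hl
      have hnn : 0 ≤ derivI 1 (f^[p]) l₀ := by
        refine ge_of_tendsto ht ?_
        filter_upwards [self_mem_nhdsWithin] with x hx
        rw [slope_def_field]
        exact div_nonneg (sub_nonneg.2 (hm (Set.left_mem_Icc.2 hl.le)
          (Set.Ioo_subset_Icc_self hx) hx.1.le)) (sub_nonneg.2 hx.1.le)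
      rw [abs_of_nonneg hnn] at hd
      obtain ⟨x, hx, hx'⟩ := ((ht.eventually (lt_mem_nhds hd)).and self_mem_nhdsWithin).exists
      rw [slope_def_field, ← h, lt_div_iff₀ (sub_pos.2 hx'.1)] at hx
      exact ⟨x, ⟨hx'.1.le, hx'.2⟩, by linarith⟩
  obtain ⟨x₀, ⟨hx0l, hx0r⟩, hx0⟩ := hx0
  have hsub2 : Set.Icc x₀ l₁ ⊆ Set.Icc l₀ l₁ := Set.Icc_subset_Icc_left hx0l
  have hcl : IsClosed {x ∈ Set.Icc x₀ l₁ | f^[p] x ≤ x} :=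
    isClosed_Icc.isClosed_le (hcont.mono hsub2) continuousOn_id
  have hK : IsCompact {x ∈ Set.Icc x₀ l₁ | f^[p] x ≤ x} :=
    isCompact_Icc.of_isClosed_subset hcl fun x hx => hx.1
  -- At the first point where the graph comes down to the diagonal, difference quotients from the
  -- left lie between `0` and `1`, so this fixed point is not repelling.
  obtain ⟨z, ⟨hzm, hz⟩, hzl⟩ := hK.exists_isLeast ⟨l₁, ⟨hx0r.le, le_rfl⟩, hl1⟩
  have hx0z : x₀ < z := lt_of_le_of_ne hzm.1 (by rintro rfl; linarith)
  have hlt : ∀ x ∈ Set.Ioo x₀ z, x < f^[p] x := by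
    intro x hx
    by_contra hc
    exact absurd (hzl ⟨⟨hx.1.le, hx.2.le.trans hzm.2⟩, not_lt.1 hc⟩) (not_le.2 hx.2)
  have hzI : z ∈ phaseI := hsub (hsub2 hzm)
  have hne : (𝓝[Set.Ioo x₀ z] z).NeBot := right_nhdsWithin_Ioo_neBot hx0z
  have hIoo : Set.Ioo x₀ z ⊆ Set.Icc l₀ l₁ := fun x hx =>
    ⟨hx0l.trans hx.1.le, hx.2.le.trans hzm.2⟩
  have hge : z ≤ f^[p] z := by
    refine le_of_tendsto_of_tendsto (tendsto_id.mono_left nhdsWithin_le_nhds)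
      ((hcont z (hsub2 hzm)).mono hIoo) ?_
    filter_upwards [self_mem_nhdsWithin] with x hx
    exact (hlt x hx).le
  have hfix : f^[p] z = z := le_antisymm hz hge
  have hd := hrep z hzI p hp hfix
  have ht := (hasDerivWithinAt_iff_tendsto_slope.1 (hf.hasDerivWithinAt_iterate p hzI)).mono_left
    (nhdsWithin_mono z (s := Set.Ioo x₀ z) fun x hx => ⟨hsub (hIoo hx), hx.2.ne⟩)
  have hnn : 0 ≤ derivI 1 (f^[p]) z := by
    refine ge_of_tendsto ht ?_
    filter_upwards [self_mem_nhdsWithin] with x hx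
    rw [slope_def_field]
    exact div_nonneg_of_nonpos (sub_nonpos.2 (hm (hIoo hx) (hsub2 hzm) hx.2.le))
      (sub_nonpos.2 hx.2.le)
  have hle : derivI 1 (f^[p]) z ≤ 1 := by
    refine le_of_tendsto ht ?_
    filter_upwards [self_mem_nhdsWithin] with x hx
    rw [slope_def_field, div_le_one_of_neg (sub_neg.2 hx.2), hfix]
    linarith [hlt x hx]
  rw [abs_of_nonneg hnn] at hd
  linarith

/-- An increasing self-map is covered by `not_monotone_inward`; a decreasing one becomes increasing
when iterated twice. -/
lemma not_strictOn_selfmap (hf : IsSUnimodal f) (hrep : AllPeriodicRepelling f) {p : ℕ}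
    (hp : 0 < p) {x y : ℝ} (hx : x ∈ phaseI) (hy : y ∈ phaseI) (hxy : x ≠ y)
    (hs : StrictOn (f^[p]) (Set.uIcc x y)) (hfx : f^[p] x ∈ Set.uIcc x y)
    (hfy : f^[p] y ∈ Set.uIcc x y) : False := by
  wlog hw : x < y generalizing x y
  · rw [Set.uIcc_comm] at hs hfx hfy
    exact this hy hx hxy.symm hs hfy hfx (lt_of_le_of_ne (not_lt.1 hw) hxy.symm)
  rw [Set.uIcc_of_le hw.le] at *
  rcases hs with hs | hs
  · exact hf.not_monotone_inward hrep hp hx hy hw hs.monotoneOn hfx.1 hfy.2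
  · have hmaps : Set.MapsTo (f^[p]) (Set.Icc x y) (Set.Icc x y) := by
      intro z hz
      exact ⟨hfy.1.trans (hs.antitoneOn hz (Set.right_mem_Icc.2 hw.le) hz.2),
        (hs.antitoneOn (Set.left_mem_Icc.2 hw.le) hz hz.1).trans hfx.2⟩
    have h2 : MonotoneOn (f^[p + p]) (Set.Icc x y) := by
      rw [Function.iterate_add]
      exact (hs.comp hs hmaps).monotoneOn
    refine hf.not_monotone_inward hrep (p := p + p) (by omega) hx hy hw h2 ?_ ?_
    · rw [Function.iterate_add_apply]; exact (hmaps hfx).1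
    · rw [Function.iterate_add_apply]; exact (hmaps hfy).2

/-- The iterates of an interval never meeting the critical point are pairwise disjoint. -/
lemma disjoint_iterates (hf : IsSUnimodal f) (hrep : AllPeriodicRepelling f) {a b : ℝ}
    (ha : a ∈ phaseI) (hb : b ∈ phaseI) (hab : a ≠ b) (hom : ∀ n, MonoIter f n a b) {n m : ℕ}
    (hnm : n < m) : Disjoint (f^[n] '' Set.uIoo a b) (f^[m] '' Set.uIoo a b) := by
  by_contra hdis
  rw [Set.not_disjoint_iff_nonempty_inter] at hdis
  obtain ⟨p, rfl⟩ := Nat.exists_eq_add_of_lt hnm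
  set q := p + 1 with hq
  have hpq : n + p + 1 = n + q := by omega
  rw [hpq] at hdis
  obtain ⟨w, ⟨u, hu, huw⟩, ⟨u', hu', huw'⟩⟩ := hdis
  set K : ℕ → Set ℝ := fun k => f^[n + k * q] '' Set.uIoo a b with hK
  -- If the iterates of times `n` and `n + q` meet, the sets `K k` form a chain. Their union is an
  -- interval mapped into itself by `f^[q]` and free of preimages of `0`, so `f^[q]` is a monotone
  -- self-map of its closure.
  set L := ⋃ k, K k with hL
  have hJI : Set.uIoo a b ⊆ phaseI := Set.uIoo_subset_uIcc_self.trans (uIcc_subset ha hb)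
  have hLI : L ⊆ phaseI := by
    refine Set.iUnion_subset fun k => ?_
    rintro _ ⟨z, hz, rfl⟩
    exact hf.iterate_mem _ (hJI hz)
  have hLconn : IsPreconnected L := by
    refine IsPreconnected.iUnion_of_chain (fun k => ?_) (fun k => ?_)
    · exact isPreconnected_uIoo.image _ ((hf.continuousOn_iterate _).mono hJI)
    · refine ⟨f^[k * q] w, ⟨u, hu, ?_⟩, ⟨u', hu', ?_⟩⟩
      · rw [← huw, ← Function.iterate_add_apply, Nat.add_comm]
      · rw [← huw', ← Function.iterate_add_apply]
        exact congrArg (fun j => f^[j] u') (show n + (k + 1) * q = k * q + (n + q) by ring)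
  have hL0 : ∀ z ∈ L, ∀ k, f^[k] z ≠ 0 := by
    intro z hz k
    obtain ⟨i, hi⟩ := Set.mem_iUnion.1 hz
    obtain ⟨y, hy, rfl⟩ := hi
    rw [← Function.iterate_add_apply]
    exact hom _ _ (Nat.lt_succ_self _) y hy
  have hLmap : ∀ z ∈ L, f^[q] z ∈ L := by
    intro z hz
    obtain ⟨i, hi⟩ := Set.mem_iUnion.1 hz
    obtain ⟨y, hy, rfl⟩ := hi
    refine Set.mem_iUnion.2 ⟨i + 1, y, hy, ?_⟩
    rw [← Function.iterate_add_apply]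
    exact congrArg (fun j => f^[j] y) (show n + (i + 1) * q = q + (n + i * q) by ring)
  have hbb : BddBelow L := ⟨-1, fun z hz => (hLI hz).1⟩
  have hba : BddAbove L := ⟨1, fun z hz => (hLI hz).2⟩
  have hK0 : Set.uIoo (f^[n] a) (f^[n] b) ⊆ L := by
    rw [← hf.image_uIoo ha hb (hom n)]
    refine Set.Subset.trans ?_ (Set.subset_iUnion K 0)
    simp [hK]
  have hne : f^[n] a ≠ f^[n] b := fun e =>
    hab ((hf.strictOn_iterate ha hb (hom n)).injOn Set.left_mem_uIcc Set.right_mem_uIcc e)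
  have hLne : L.Nonempty := (Set.nonempty_uIoo.2 hne).mono hK0
  obtain ⟨s, hs1, hs2⟩ := exists_between (inf_lt_sup.2 hne)
  obtain ⟨t, ht1, ht2⟩ := exists_between hs2
  have hlt : sInf L < sSup L :=
    (csInf_le hbb (hK0 ⟨hs1, hs2⟩)).trans_lt (ht1.trans_le (le_csSup hba (hK0 ⟨hs1.trans ht1, ht2⟩)))
  have hcl : closure L ⊆ phaseI := closure_minimal hLI isClosed_Icc
  have hcl2 : closure L ⊆ Set.Icc (sInf L) (sSup L) :=
    closure_minimal (fun z hz => ⟨csInf_le hbb hz, le_csSup hba hz⟩) isClosed_Icc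
  have h0 := csInf_mem_closure hLne hbb
  have h1 := csSup_mem_closure hLne hba
  have hmap : ∀ z ∈ closure L, f^[q] z ∈ closure L := fun z hz =>
    closure_mono (show f^[q] '' L ⊆ L from Set.image_subset_iff.2 hLmap)
      ((((hf.continuousOn_iterate q) z (hcl hz)).mono hLI).mem_closure_image hz)
  have hmono : ∀ k, MonoIter f k (sInf L) (sSup L) := by
    intro k j _ z hz
    rw [Set.uIoo_of_lt hlt] at hz
    exact hL0 z (IsConnected.Ioo_csInf_csSup_subset ⟨hLne, hLconn⟩ hbb hba hz) j
  refine hf.not_strictOn_selfmap hrep (p := q) (by omega) (hcl h0) (hcl h1) hlt.ne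
    (hf.strictOn_iterate (hcl h0) (hcl h1) (hmono q)) ?_ ?_
  · rw [Set.uIcc_of_le hlt.le]; exact hcl2 (hmap _ h0)
  · rw [Set.uIcc_of_le hlt.le]; exact hcl2 (hmap _ h1)

end IsSUnimodal

/-! ### Folding at the critical point: comparison constants and mirror points -/

lemma abs_sub_eq_of_mem_uIcc {a b c : ℝ} (h : b ∈ Set.uIcc a c) :
    |c - a| = |c - b| + |b - a| := by
  rcases Set.mem_uIcc.1 h with ⟨h1, h2⟩ | ⟨h1, h2⟩
  · rw [abs_of_nonneg (by linarith), abs_of_nonneg (by linarith), abs_of_nonneg (by linarith)]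
    ring
  · rw [abs_of_nonpos (by linarith), abs_of_nonpos (by linarith), abs_of_nonpos (by linarith)]
    ring

lemma uIcc_subset_of_mem {a b c d : ℝ} (ha : a ∈ Set.uIcc c d) (hb : b ∈ Set.uIcc c d) :
    Set.uIcc a b ⊆ Set.uIcc c d := Set.uIcc_subset_uIcc ha hb

namespace IsSUnimodal
variable {f : ℝ → ℝ}

lemma zero_mem : (0 : ℝ) ∈ phaseI := ⟨by norm_num, by norm_num⟩

lemma apply_le_zero (hf : IsSUnimodal f) {x : ℝ} (hx : x ∈ phaseI) : f x ≤ f 0 := by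
  rcases le_total x 0 with h | h
  · exact hf.strictMonoOn_left.monotoneOn ⟨hx.1, h⟩ (Set.right_mem_Icc.2 (by norm_num)) h
  · exact hf.strictAntiOn_right.antitoneOn (Set.left_mem_Icc.2 zero_le_one) ⟨h, hx.2⟩ h

/-- Integrated form of the bounds on `f'`: on a lap, adding `c₁ z² / 2` or `c₂ z² / 2` to `f` yields
functions monotone in opposite directions. -/
lemma quadratic_bounds (hf : IsSUnimodal f) {c₁ c₂ : ℝ}
    (hc : ∀ x ∈ phaseI, c₁ * |x| ≤ |derivI 1 f x| ∧ |derivI 1 f x| ≤ c₂ * |x|)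
    {S : Set ℝ} (hS : IsLap S) {x y : ℝ} (hx : x ∈ S) (hy : y ∈ S) :
    c₁ * |y ^ 2 - x ^ 2| ≤ 2 * |f x - f y| ∧ 2 * |f x - f y| ≤ c₂ * |y ^ 2 - x ^ 2| := by
  wlog hxy : x ≤ y generalizing x y
  · have := this hy hx (not_le.1 hxy).le
    rwa [abs_sub_comm (f y), abs_sub_comm (x ^ 2)] at this
  have hq : ∀ (c s : ℝ), HasDerivAt (fun z : ℝ => c / 2 * z ^ 2) (c * s) s := fun c s => by
    refine ((hasDerivAt_pow 2 s).const_mul (c / 2)).congr_deriv ?_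
    simp; ring
  have hqc : ∀ (c : ℝ) (T : Set ℝ), ContinuousOn (fun z : ℝ => c / 2 * z ^ 2) T := fun c T => by
    fun_prop
  rcases hS with rfl | rfl
  · have hd : ∀ s ∈ Set.Ioo (-1 : ℝ) 0, HasDerivAt f (derivI 1 f s) s ∧
        c₁ * (-s) ≤ derivI 1 f s ∧ derivI 1 f s ≤ c₂ * (-s) := by
      intro s hs
      have hsI : s ∈ phaseI := ⟨hs.1.le, by linarith [hs.2]⟩
      have := hc s hsI
      rw [abs_of_neg hs.2, abs_of_pos (hf.deriv_pos s ⟨hs.1.le, hs.2⟩)] at this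
      exact ⟨hf.hasDerivAt_self ⟨hs.1, by linarith [hs.2]⟩, this⟩
    have m1 : MonotoneOn (fun z => f z + c₁ / 2 * z ^ 2) (Set.Icc (-1) 0) :=
      monotoneOn_of_hasDerivWithinAt_nonneg (convex_Icc _ _)
        ((hf.continuousOn.mono Icc_left_subset).add (hqc _ _))
        (f' := fun s => derivI 1 f s + c₁ * s)
        (fun s hs => by
          rw [interior_Icc] at hs
          exact ((hd s hs).1.add (hq c₁ s)).hasDerivWithinAt)
        (fun s hs => by
          rw [interior_Icc] at hs
          linarith [(hd s hs).2.1])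
    have m2 : AntitoneOn (fun z => f z + c₂ / 2 * z ^ 2) (Set.Icc (-1) 0) :=
      antitoneOn_of_hasDerivWithinAt_nonpos (convex_Icc _ _)
        ((hf.continuousOn.mono Icc_left_subset).add (hqc _ _))
        (f' := fun s => derivI 1 f s + c₂ * s)
        (fun s hs => by
          rw [interior_Icc] at hs
          exact ((hd s hs).1.add (hq c₂ s)).hasDerivWithinAt)
        (fun s hs => by
          rw [interior_Icc] at hs
          linarith [(hd s hs).2.2])
    have i1 := m1 hx hy hxy
    have i2 := m2 hx hy hxy
    have i3 := hf.strictMonoOn_left.monotoneOn hx hy hxy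
    simp only at i1 i2
    have i4 : y ^ 2 ≤ x ^ 2 := by nlinarith [hx.2, hy.2]
    rw [abs_of_nonpos (by linarith), abs_of_nonpos (by linarith)]
    constructor <;> linarith
  · have hd : ∀ s ∈ Set.Ioo (0 : ℝ) 1, HasDerivAt f (derivI 1 f s) s ∧
        c₁ * s ≤ -derivI 1 f s ∧ -derivI 1 f s ≤ c₂ * s := by
      intro s hs
      have hsI : s ∈ phaseI := ⟨by linarith [hs.1], hs.2.le⟩
      have := hc s hsI
      rw [abs_of_pos hs.1, abs_of_neg (hf.deriv_neg s ⟨hs.1, hs.2.le⟩)] at this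
      exact ⟨hf.hasDerivAt_self ⟨by linarith [hs.1], hs.2⟩, this⟩
    have m1 : AntitoneOn (fun z => f z + c₁ / 2 * z ^ 2) (Set.Icc 0 1) :=
      antitoneOn_of_hasDerivWithinAt_nonpos (convex_Icc _ _)
        ((hf.continuousOn.mono Icc_right_subset).add (hqc _ _))
        (f' := fun s => derivI 1 f s + c₁ * s)
        (fun s hs => by
          rw [interior_Icc] at hs
          exact ((hd s hs).1.add (hq c₁ s)).hasDerivWithinAt)
        (fun s hs => by
          rw [interior_Icc] at hs
          linarith [(hd s hs).2.1])
    have m2 : MonotoneOn (fun z => f z + c₂ / 2 * z ^ 2) (Set.Icc 0 1) :=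
      monotoneOn_of_hasDerivWithinAt_nonneg (convex_Icc _ _)
        ((hf.continuousOn.mono Icc_right_subset).add (hqc _ _))
        (f' := fun s => derivI 1 f s + c₂ * s)
        (fun s hs => by
          rw [interior_Icc] at hs
          exact ((hd s hs).1.add (hq c₂ s)).hasDerivWithinAt)
        (fun s hs => by
          rw [interior_Icc] at hs
          linarith [(hd s hs).2.2])
    have i1 := m1 hx hy hxy
    have i2 := m2 hx hy hxy
    have i3 := hf.strictAntiOn_right.antitoneOn hx hy hxy
    simp only at i1 i2
    have i4 : x ^ 2 ≤ y ^ 2 := by nlinarith [hx.1, hy.1]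
    rw [abs_of_nonneg (by linarith), abs_of_nonneg (by linarith)]
    constructor <;> linarith

lemma exists_isLap {x : ℝ} (hx : x ∈ phaseI) : ∃ S, IsLap S ∧ x ∈ S ∧ (0 : ℝ) ∈ S := by
  rcases le_total x 0 with h | h
  · exact ⟨_, Or.inl rfl, ⟨hx.1, h⟩, by norm_num, by norm_num⟩
  · exact ⟨_, Or.inr rfl, ⟨h, hx.2⟩, by norm_num, by norm_num⟩

/-- Comparison of points with ordered images, of derivatives at points with equal images, and of
intervals with equal images. -/
structure FoldConst (f : ℝ → ℝ) (C : ℝ) : Prop where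
  one_le : 1 ≤ C
  abs_le : ∀ x ∈ phaseI, ∀ y ∈ phaseI, f y ≤ f x → |x| ≤ C * |y|
  deriv_le : ∀ x ∈ phaseI, ∀ y ∈ phaseI, f x = f y → |derivI 1 f x| ≤ C * |derivI 1 f y|
  length_le : ∀ S T, IsLap S → IsLap T → ∀ x ∈ S, ∀ y ∈ S, ∀ x' ∈ T, ∀ y' ∈ T,
    f x' = f x → f y' = f y → |y' - x'| ≤ C * |y - x|

lemma exists_foldConst (hf : IsSUnimodal f) : ∃ C, FoldConst f C := by
  obtain ⟨c₁, c₂, h1, h2, hc⟩ := hf.exists_deriv_bounds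
  have h12 : c₁ ≤ c₂ := by
    have := hc 1 ⟨by norm_num, le_rfl⟩
    simp only [abs_one, mul_one] at this
    exact this.1.trans this.2
  set r := c₂ / c₁ with hr
  have hr1 : 1 ≤ r := (one_le_div h1).2 h12
  have hrr : r ≤ r ^ 2 := by nlinarith
  have hc2 : c₂ = r * c₁ := by rw [hr]; field_simp
  have habs : ∀ x ∈ phaseI, ∀ y ∈ phaseI, f y ≤ f x → |x| ≤ r * |y| := by
    intro x hx y hy hxy
    obtain ⟨S, hS, hxS, h0S⟩ := exists_isLap hx
    obtain ⟨T, hT, hyT, h0T⟩ := exists_isLap hy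
    have b1 := (hf.quadratic_bounds hc hS h0S hxS).1
    have b2 := (hf.quadratic_bounds hc hT h0T hyT).2
    rw [abs_of_nonneg (sub_nonneg.2 (hf.apply_le_zero hx))] at b1
    rw [abs_of_nonneg (sub_nonneg.2 (hf.apply_le_zero hy))] at b2
    have e : ∀ z : ℝ, |z ^ 2 - 0 ^ 2| = z ^ 2 := fun z => by
      rw [abs_of_nonneg] <;> nlinarith [sq_nonneg z]
    rw [e] at b1 b2
    have b3 : c₁ * x ^ 2 ≤ c₁ * (r * y ^ 2) := by
      rw [hc2] at b2
      nlinarith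
    have b4 : x ^ 2 ≤ r * y ^ 2 := le_of_mul_le_mul_left b3 h1
    apply abs_le_of_sq_le_sq' _ (by positivity) |> abs_le.2
    rw [mul_pow, sq_abs]
    nlinarith [sq_nonneg y]
  -- One factor `r` comes from replacing `c₂` by `c₁`, the other from comparing the distances to `0`
  -- of points with equal images.
  refine ⟨r ^ 2, ⟨by nlinarith, ?_, ?_, ?_⟩⟩
  · intro x hx y hy hxy
    exact (habs x hx y hy hxy).trans (mul_le_mul_of_nonneg_right hrr (abs_nonneg _))
  · intro x hx y hy hxy
    have b1 := (hc x hx).2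
    have b2 := (hc y hy).1
    have b3 := habs x hx y hy hxy.ge
    calc |derivI 1 f x| ≤ c₂ * |x| := b1
      _ ≤ c₂ * (r * |y|) := by gcongr
      _ = r ^ 2 * (c₁ * |y|) := by rw [hc2]; ring
      _ ≤ r ^ 2 * |derivI 1 f y| := by gcongr
  · intro S T hS hT x hx y hy x' hx' y' hy' hxx hyy
    have b1 := (hf.quadratic_bounds hc hT hx' hy').1
    have b2 := (hf.quadratic_bounds hc hS hx hy).2
    rw [hxx, hyy] at b1
    have b3 := habs x (hS.subset hx) x' (hT.subset hx') hxx.le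
    have b4 := habs y (hS.subset hy) y' (hT.subset hy') hyy.le
    have e : ∀ U, IsLap U → ∀ u ∈ U, ∀ w ∈ U, |w ^ 2 - u ^ 2| = |w - u| * (|w| + |u|) := by
      intro U hU u hu w hw
      rw [sq_sub_sq, abs_mul, mul_comm]
      congr 1
      rcases hU with rfl | rfl
      · rw [abs_of_nonpos hw.2, abs_of_nonpos hu.2, abs_of_nonpos (by linarith [hw.2, hu.2])]
        ring
      · rw [abs_of_nonneg hw.1, abs_of_nonneg hu.1, abs_of_nonneg (by linarith [hw.1, hu.1])]
    rw [e T hT x' hx' y' hy'] at b1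
    rw [e S hS x hx y hy] at b2
    rcases (add_nonneg (abs_nonneg y') (abs_nonneg x')).eq_or_lt with h0 | h0
    · have hx0 : x' = 0 := abs_eq_zero.1 (by linarith [abs_nonneg y', abs_nonneg x'])
      have hy0 : y' = 0 := abs_eq_zero.1 (by linarith [abs_nonneg y', abs_nonneg x'])
      rw [hx0, hy0, sub_self, abs_zero]
      positivity
    · refine le_of_mul_le_mul_right (le_of_mul_le_mul_left ?_ h1) h0
      calc c₁ * (|y' - x'| * (|y'| + |x'|)) ≤ c₂ * (|y - x| * (|y| + |x|)) := b1.trans b2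
        _ ≤ c₂ * (|y - x| * (r * |y'| + r * |x'|)) := by gcongr
        _ = c₁ * (r ^ 2 * |y - x| * (|y'| + |x'|)) := by rw [hc2]; ring

/-- Every point has a mirror image on the other lap. -/
lemma exists_mirror (hf : IsSUnimodal f) {x : ℝ} (hx : x ∈ phaseI) :
    ∃ y ∈ phaseI, f y = f x ∧ x * y ≤ 0 ∧ (x ≠ 0 → x * y < 0) := by
  have hge : -1 ≤ f x := (hf.mapsTo hx).1
  have hle := hf.apply_le_zero hx
  have key : ∃ y ∈ phaseI, f y = f x ∧ x * y ≤ 0 := by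
    rcases le_total x 0 with h | h
    · obtain ⟨y, hy, hfy⟩ := intermediate_value_Icc' (zero_le_one (α := ℝ))
        (hf.continuousOn.mono Icc_right_subset) (show f x ∈ Set.Icc (f 1) (f 0) from
          ⟨by rw [hf.map_one]; exact hge, hle⟩)
      exact ⟨y, Icc_right_subset hy, hfy, mul_nonpos_of_nonpos_of_nonneg h hy.1⟩
    · obtain ⟨y, hy, hfy⟩ := intermediate_value_Icc (show (-1 : ℝ) ≤ 0 by norm_num)
        (hf.continuousOn.mono Icc_left_subset) (show f x ∈ Set.Icc (f (-1)) (f 0) from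
          ⟨by rw [hf.map_neg_one]; exact hge, hle⟩)
      exact ⟨y, Icc_left_subset hy, hfy, mul_nonpos_of_nonneg_of_nonpos h hy.2⟩
  obtain ⟨y, hy, hfy, hxy⟩ := key
  refine ⟨y, hy, hfy, hxy, fun hx0 => lt_of_le_of_ne hxy fun h0 => ?_⟩
  rcases mul_eq_zero.1 h0 with h | h
  · exact hx0 h
  · subst h
    obtain ⟨S, hS, hxS, h0S⟩ := exists_isLap hx
    exact hx0 ((hf.strictOn_lap hS).injOn hxS h0S hfy.symm)

lemma monoIter_one_zero {e : ℝ} : MonoIter f 1 0 e := by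
  intro k hk z hz
  obtain rfl : k = 0 := by omega
  rw [StrictOn.mem_uIoo_iff] at hz
  exact hz.2.1

lemma monoIter_congr (hf : IsSUnimodal f) {m : ℕ} {e e' : ℝ} (he : e ∈ phaseI)
    (he' : e' ∈ phaseI) (hee : f e = f e') (h : MonoIter f m 0 e) : MonoIter f m 0 e' := by
  rcases m with _ | m
  · intro k hk; omega
  · rw [add_comm, hf.monoIter_add_iff zero_mem he'] at *
    rw [hf.monoIter_add_iff zero_mem he] at h
    refine ⟨monoIter_one_zero, ?_⟩
    have := h.2
    simp only [Function.iterate_one] at this ⊢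
    rwa [← hee]

lemma iterate_congr {m : ℕ} (hm : 0 < m) {e e' : ℝ} (hee : f e = f e') : f^[m] e = f^[m] e' := by
  obtain ⟨q, rfl⟩ := Nat.exists_eq_succ_of_ne_zero hm.ne'
  rw [Function.iterate_succ_apply, Function.iterate_succ_apply, hee]

end IsSUnimodal

/-! ### Restrictive intervals around the critical point -/

lemma same_or_opp {e e' z : ℝ} (hee : e * e' < 0) (hz : z ≠ 0) : 0 < e * z ∨ 0 < e' * z := by
  rcases lt_or_gt_of_ne hz with h | h <;> rcases mul_neg_iff.1 hee with ⟨h1, h2⟩ | ⟨h1, h2⟩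
  · exact Or.inr (mul_pos_of_neg_of_neg h2 h)
  · exact Or.inl (mul_pos_of_neg_of_neg h1 h)
  · exact Or.inl (mul_pos h1 h)
  · exact Or.inr (mul_pos h2 h)

lemma zero_mem_uIoo_iff {a b : ℝ} : (0 : ℝ) ∈ Set.uIoo a b ↔ a * b < 0 := by
  rw [StrictOn.mem_uIoo_iff, Set.mem_uIcc, mul_neg_iff]
  constructor
  · rintro ⟨⟨h1, h2⟩ | ⟨h1, h2⟩, h3, h4⟩
    · exact Or.inr ⟨lt_of_le_of_ne h1 h3.symm, lt_of_le_of_ne h2 h4⟩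
    · exact Or.inl ⟨lt_of_le_of_ne h2 h3, lt_of_le_of_ne h1 h4.symm⟩
  · rintro (⟨h1, h2⟩ | ⟨h1, h2⟩)
    · exact ⟨Or.inr ⟨h2.le, h1.le⟩, h1.ne, h2.ne'⟩
    · exact ⟨Or.inl ⟨h1.le, h2.le⟩, h1.ne', h2.ne⟩

/-- A point of the hull of two points of opposite signs lies between `0` and the end point of the
same sign. -/
lemma mem_uIcc_zero_of_mul_nonneg {e e' z : ℝ} (hee : e * e' < 0) (hz : z ∈ Set.uIcc e e')
    (hez : 0 ≤ e * z) : z ∈ Set.uIcc 0 e := by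
  rw [Set.mem_uIcc] at *
  rcases mul_neg_iff.1 hee with ⟨h1, h2⟩ | ⟨h1, h2⟩
  · have := nonneg_of_mul_nonneg_right hez h1
    rcases hz with ⟨h3, h4⟩ | ⟨h3, h4⟩
    · exact Or.inl ⟨this, by linarith⟩
    · exact Or.inl ⟨this, h4⟩
  · have : z ≤ 0 := by
      by_contra hc
      nlinarith [mul_neg_of_neg_of_pos h1 (not_le.1 hc)]
    rcases hz with ⟨h3, h4⟩ | ⟨h3, h4⟩
    · exact Or.inr ⟨h3, this⟩
    · exact Or.inr ⟨by linarith, this⟩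

namespace IsSUnimodal
variable {f : ℝ → ℝ}

/-- A restrictive interval around the critical point contains it in the interior of its image. -/
lemma zero_mem_of_restrictive (hf : IsSUnimodal f) (hrep : AllPeriodicRepelling f) {m : ℕ}
    (hm : 0 < m) {e e' : ℝ} (he : e ∈ phaseI) (he' : e' ∈ phaseI) (hee : e * e' < 0)
    (hfe : f e = f e') (hmono : MonoIter f m 0 e) (h0 : f^[m] 0 ∈ Set.uIcc e e')
    (h1 : f^[m] e ∈ Set.uIcc e e') : f^[m] 0 * f^[m] e < 0 := by
  by_contra hc
  have hF0 := hf.iterate_zero_ne hrep hm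
  -- Let `u` be the end on the same side as `f^[m] 0`. If the images of `0` and `e` did not have
  -- opposite signs, `f^[m]` would map the half `[0, u]` monotonically into itself.
  have key : ∀ u u' : ℝ, u ∈ phaseI → u * u' < 0 → MonoIter f m 0 u → f^[m] u = f^[m] e →
      f^[m] 0 ∈ Set.uIcc u u' → f^[m] e ∈ Set.uIcc u u' → 0 < u * f^[m] 0 → False := by
    intro u u' hu huu hmu hfu hu0 hu1 hpos
    refine hf.not_strictOn_selfmap hrep hm zero_mem hu (fun h => by simp [← h] at hpos)
      (hf.strictOn_iterate zero_mem hu hmu) (mem_uIcc_zero_of_mul_nonneg huu hu0 hpos.le) ?_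
    rw [hfu]
    refine mem_uIcc_zero_of_mul_nonneg huu hu1 ?_
    have h2 : 0 ≤ (u * f^[m] 0) * (f^[m] 0 * f^[m] e) := mul_nonneg hpos.le (not_lt.1 hc)
    have h3 : (u * f^[m] 0) * (f^[m] 0 * f^[m] e) = (f^[m] 0) ^ 2 * (u * f^[m] e) := by ring
    rw [h3] at h2
    exact nonneg_of_mul_nonneg_right h2 (by positivity)
  rcases same_or_opp hee hF0 with h | h
  · exact key e e' he hee hmono rfl h0 h1 h
  · rw [Set.uIcc_comm] at h0 h1
    exact key e' e he' (by linarith) (hf.monoIter_congr he he' hfe hmono)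
      (iterate_congr hm hfe.symm) h0 h1 h

/-- Let `u` be the end on the side of `f^[j] 0`. If `f^[j] 0` lies in `[0, u]`, then `f^[j]` maps
`[0, u]` monotonically into itself. Otherwise `[u, u']` is already restrictive for `f^[m - j]`, and
`zero_mem_of_restrictive` produces a zero of `f^[m - j]` inside `(0, u)`, against the monotonicity
of `f^[m]`. -/
lemma not_restrictive_of_zero_end (hf : IsSUnimodal f) (hrep : AllPeriodicRepelling f) {m : ℕ}
    {e e' : ℝ} (he : e ∈ phaseI) (he' : e' ∈ phaseI) (hee : e * e' < 0)
    (hfe : f e = f e') (hmono : MonoIter f m 0 e) (h0 : f^[m] 0 ∈ Set.uIcc e e')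
    (h1 : f^[m] e ∈ Set.uIcc e e') {j : ℕ} (hj : j < m) (hje : f^[j] e = 0) : False := by
  have hj0 : 0 < j := by
    rcases Nat.eq_zero_or_pos j with rfl | h
    · simp only [Function.iterate_zero, id] at hje
      simp [hje] at hee
    · exact h
  have hF0 := hf.iterate_zero_ne hrep hj0
  have key : ∀ u u' : ℝ, u ∈ phaseI → u' ∈ phaseI → u * u' < 0 → f u = f u' → MonoIter f m 0 u →
      f^[m] 0 ∈ Set.uIcc u u' → f^[m] u ∈ Set.uIcc u u' → f^[j] u = 0 → 0 < u * f^[j] 0 →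
      False := by
    intro u u' hu hu' huu hfu hmu hu0 hu1 hju hpos
    have hune : u ≠ 0 := fun h => by simp [h] at hpos
    by_cases hin : f^[j] 0 ∈ Set.uIcc 0 u
    · refine hf.not_strictOn_selfmap hrep hj0 zero_mem hu hune.symm
        (hf.strictOn_iterate zero_mem hu (hmu.le hj.le)) hin ?_
      rw [hju]; exact Set.left_mem_uIcc
    · have hout : u ∈ Set.uIcc 0 (f^[j] 0) := by
        rw [Set.mem_uIcc] at hin ⊢
        push Not at hin
        rcases mul_pos_iff.1 hpos with ⟨a1, a2⟩ | ⟨a1, a2⟩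
        · exact Or.inl ⟨a1.le, (hin.1 a2.le).le⟩
        · refine Or.inr ⟨?_, a1.le⟩
          by_contra hc
          linarith [hin.2 (not_le.1 hc).le]
      have hmj : j + (m - j) = m := by omega
      have hmm := hmu
      rw [← hmj, hf.monoIter_add_iff zero_mem hu, hju] at hmm
      have hM : MonoIter f (m - j) 0 (f^[j] 0) := hmm.2.symm
      have hMu : MonoIter f (m - j) 0 u := hM.sub Set.left_mem_uIcc hout
      have e0 : f^[m - j] 0 = f^[m] u := by
        rw [← hju, ← Function.iterate_add_apply, Nat.sub_add_cancel hj.le]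
      have e1 : f^[m - j] (f^[j] 0) = f^[m] 0 := by
        rw [← Function.iterate_add_apply, Nat.sub_add_cancel hj.le]
      have e2 : f^[m - j] u ∈ Set.uIcc u u' := by
        have := (hf.strictOn_iterate zero_mem (hf.iterate_mem j zero_mem) hM).mem_uIcc hout
        rw [e0, e1] at this
        exact uIcc_subset_of_mem hu1 hu0 this
      have hneg := hf.zero_mem_of_restrictive hrep (m := m - j) (by omega) hu hu' huu hfu hMu
        (by rw [e0]; exact hu1) e2
      rw [← zero_mem_uIoo_iff, ← hf.image_uIoo zero_mem hu hMu] at hneg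
      obtain ⟨w, hw, hw0⟩ := hneg
      exact hmu (m - j) (by omega) w hw hw0
  rcases same_or_opp hee hF0 with h | h
  · exact key e e' he he' hee hfe hmono h0 h1 hje h
  · rw [Set.uIcc_comm] at h0 h1
    rw [iterate_congr (by omega) hfe] at h1
    exact key e' e he' he (by linarith) hfe.symm (hf.monoIter_congr he he' hfe hmono) h0 h1
      (by rw [← hje]; exact iterate_congr hj0 hfe.symm) h

/-- A monotone interval extends until it meets the boundary or a preimage of the critical point. -/
lemma exists_maximal_extension (hf : IsSUnimodal f) {n : ℕ} {x y : ℝ} (hx : x ∈ phaseI)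
    (hy : y ∈ phaseI) (hxy : x ≠ y) (h : MonoIter f n x y) :
    ∃ z ∈ phaseI, y ∈ Set.uIcc x z ∧ MonoIter f n x z ∧
      (z = 1 ∨ z = -1 ∨ ∃ j < n, f^[j] z = 0) := by
  -- The points obstructing an extension beyond `y` form a compact set; the extension ends at the
  -- one nearest to `x`, or at the boundary if there is none.
  set Z : Set ℝ := {w ∈ phaseI | y ∈ Set.uIcc x w ∧ ∃ j < n, f^[j] w = 0} with hZ
  have hZc : IsCompact Z := by
    have e : Z = ({w | y ∈ Set.uIcc x w} ∩ ⋃ j ∈ Finset.range n, phaseI ∩ f^[j] ⁻¹' {0}) := by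
      ext w
      simp only [hZ, Set.mem_ofPred_eq, Set.mem_inter_iff, Set.mem_iUnion, Finset.mem_range,
        Set.mem_preimage, Set.mem_singleton_iff, exists_prop]
      constructor
      · rintro ⟨h1, h2, j, h3, h4⟩
        exact ⟨h2, j, h3, h1, h4⟩
      · rintro ⟨h2, j, h3, h1, h4⟩
        exact ⟨h1, h2, j, h3, h4⟩
    rw [e]
    refine IsCompact.inter_left ?_ ?_
    · refine (Finset.range n).isCompact_biUnion fun j _ => ?_
      exact isCompact_Icc.of_isClosed_subset
        ((hf.continuousOn_iterate j).preimage_isClosed_of_isClosed isClosed_Icc isClosed_singleton)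
        Set.inter_subset_left
    · have : {w : ℝ | y ∈ Set.uIcc x w} = {w | min x w ≤ y} ∩ {w | y ≤ max x w} := rfl
      rw [this]
      exact (isClosed_le (by fun_prop) (by fun_prop)).inter
        (isClosed_le (by fun_prop) (by fun_prop))
  have hcase : ∀ z, y ∈ Set.uIcc x z → ∀ w ∈ Set.uIoo x z, w ∉ Set.uIoo x y →
      y ∈ Set.uIcc x w ∧ |w - x| < |z - x| := by
    intro z hz w hw hw'
    rw [StrictOn.mem_uIoo_iff] at hw hw'
    have hyw : y ∈ Set.uIcc x w := by
      by_contra hc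
      rw [Set.mem_uIcc] at hz hw hw' hc
      apply hw'
      push Not at hc
      refine ⟨?_, hw.2.1, ?_⟩
      · rcases lt_or_gt_of_ne hxy with h1 | h1
        · left
          have : w < y := hc.1 h1.le
          rcases hw.1 with h2 | h2
          · exact ⟨h2.1, this.le⟩
          · rcases hz with h3 | h3
            · exact ⟨by linarith [h3.1, h3.2], this.le⟩
            · linarith [h3.1, h3.2]
        · right
          have : y < w := by
            by_contra hcc
            linarith [hc.2 (not_lt.1 hcc)]
          rcases hw.1 with h2 | h2
          · rcases hz with h3 | h3
            · linarith [h3.1, h3.2]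
            · exact ⟨this.le, by linarith [h3.1, h3.2]⟩
          · exact ⟨this.le, h2.2⟩
      · rintro rfl
        rcases lt_or_gt_of_ne hxy with h1 | h1
        · linarith [hc.1 h1.le]
        · linarith [hc.2 le_rfl]
    refine ⟨hyw, ?_⟩
    have := abs_sub_eq_of_mem_uIcc hw.1
    have h2 : 0 < |z - w| := abs_pos.2 (sub_ne_zero.2 hw.2.2.symm)
    linarith
  by_cases hne : Z.Nonempty
  · obtain ⟨z, hzZ, hzmin⟩ := hZc.exists_isMinOn hne
      (f := fun w => |w - x|) (by fun_prop)
    refine ⟨z, hzZ.1, hzZ.2.1, fun k hk w hw hkw => ?_, Or.inr (Or.inr hzZ.2.2)⟩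
    by_cases hwy : w ∈ Set.uIoo x y
    · exact h k hk w hwy hkw
    · obtain ⟨h1, h2⟩ := hcase z hzZ.2.1 w hw hwy
      have hwZ : w ∈ Z := ⟨uIcc_subset hx hzZ.1 (Set.uIoo_subset_uIcc_self hw), h1, k, hk, hkw⟩
      have : |z - x| ≤ |w - x| := hzmin hwZ
      linarith
  · have hex : ∃ z ∈ phaseI, y ∈ Set.uIcc x z ∧ (z = 1 ∨ z = -1) := by
      rcases lt_or_gt_of_ne hxy with h1 | h1
      · exact ⟨1, ⟨by norm_num, le_rfl⟩, Set.mem_uIcc.2 (Or.inl ⟨h1.le, hy.2⟩), Or.inl rfl⟩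
      · exact ⟨-1, ⟨le_rfl, by norm_num⟩, Set.mem_uIcc.2 (Or.inr ⟨hy.1, h1.le⟩), Or.inr rfl⟩
    obtain ⟨z, hz, hyz, hz1⟩ := hex
    refine ⟨z, hz, hyz, fun k hk w hw hkw => ?_, by tauto⟩
    by_cases hwy : w ∈ Set.uIoo x y
    · exact h k hk w hwy hkw
    · obtain ⟨h1, _⟩ := hcase z hyz w hw hwy
      exact hne ⟨w, uIcc_subset hx hz (Set.uIoo_subset_uIcc_self hw), h1, k, hk, hkw⟩

end IsSUnimodal

/-- Numerical consequence of the two three-point inequalities at the ends of `[p, t] = [p, e] ∪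
[e, t]`. -/
lemma expansion_of_three_point {A B X Y C d₁ d₂ : ℝ} (hA : 0 ≤ A) (hB : 0 < B) (hX : 0 < X)
    (hY : 0 < Y) (hC : 1 ≤ C) (hd₁ : 1 < d₁) (hd₂ : 1 ≤ C * d₂)
    (h1 : d₁ * B * (X + Y) * X ≤ Y * (A + B) * A)
    (h2 : d₂ * A * (X + Y) * Y ≤ X * (A + B) * B) : X ≤ C * A := by
  by_contra hc
  push Not at hc
  have hAX : A < X := by nlinarith
  have hA0 : 0 < A := by
    rcases hA.eq_or_lt with h | h
    · subst h
      have : 0 < d₁ * B * (X + Y) * X := by positivity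
      nlinarith
    · exact h
  -- Under the assumption `A < X`, expansion at the first end shows that the first piece is
  -- contracted relative to the second; `i5` then bounds the total length from the second end.
  have i1 : B * X < A * Y := by
    have a1 : B * (X + Y) * X < d₁ * B * (X + Y) * X := by
      have : 0 < B * (X + Y) * X := by positivity
      nlinarith
    have a2 : B * X * X < Y * A * A := by
      have : Y * B * A < Y * B * X := by
        have : 0 < Y * B := by positivity
        nlinarith
      nlinarith
    have a3 : Y * A * A ≤ A * Y * X := by
      have : 0 < Y * A := by positivity
      nlinarith
    have : B * X * X < A * Y * X := a2.trans_le a3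
    exact lt_of_mul_lt_mul_right this hX.le
  have i2 : A * (X + Y) * Y ≤ C * (X * (A + B) * B) := by
    have h3 : C * (d₂ * A * (X + Y) * Y) ≤ C * (X * (A + B) * B) := by gcongr
    have h4 : 0 ≤ A * (X + Y) * Y := by positivity
    nlinarith
  have i3 : C * (X * (A + B) * B) < C * (A * Y * (A + B)) := by
    have : 0 < C * (A + B) := by positivity
    nlinarith
  have i4 : A * Y * (X + Y) < A * Y * (C * (A + B)) := by nlinarith
  have i5 : X + Y < C * (A + B) := lt_of_mul_lt_mul_left i4 (by positivity)
  have i6 : (X + Y) * X < (C * A) * (X + Y) := by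
    have : (X + Y) * X < C * (A + B) * X := by nlinarith
    have : C * (B * X) < C * (A * Y) := by nlinarith
    nlinarith
  nlinarith

namespace IsSUnimodal
variable {f : ℝ → ℝ}

lemma iterate_neg_one (hf : IsSUnimodal f) (m : ℕ) : f^[m] (-1) = -1 :=
  Function.iterate_fixed hf.map_neg_one m

lemma iterate_one_eq (hf : IsSUnimodal f) {m : ℕ} (hm : 0 < m) : f^[m] 1 = -1 := by
  rw [iterate_congr hm (show f 1 = f (-1) by rw [hf.map_one, hf.map_neg_one]), hf.iterate_neg_one]

lemma exists_fixed (hf : IsSUnimodal f) {m : ℕ} {x y : ℝ} (hx : x ∈ phaseI) (hy : y ∈ phaseI)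
    (h : (0 : ℝ) ∈ Set.uIcc (f^[m] x - x) (f^[m] y - y)) : ∃ z ∈ Set.uIcc x y, f^[m] z = z := by
  have hc : ContinuousOn (fun z => f^[m] z - z) (Set.uIcc x y) :=
    ((hf.continuousOn_iterate m).mono (uIcc_subset hx hy)).sub continuousOn_id
  obtain ⟨z, hz, hz0⟩ := intermediate_value_uIcc hc h
  exact ⟨z, hz, sub_eq_zero.1 hz0⟩

lemma mirror_mem_uIcc (hf : IsSUnimodal f) {u w u' w' : ℝ} (hw : w ∈ phaseI)
    (hu' : u' ∈ phaseI) (hw' : w' ∈ phaseI) (huw : u ∈ Set.uIcc 0 w) (hfu : f u = f u')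
    (hfw : f w = f w') (hsame : 0 ≤ u' * w') (hw0 : w' ≠ 0) : u' ∈ Set.uIcc 0 w' := by
  obtain ⟨S, hS, hwS, h0S⟩ := exists_isLap hw
  have h1 := ((hf.strictOn_lap hS).mono (hS.uIcc_subset h0S hwS)).mem_uIcc huw
  have hu : u ∈ phaseI := uIcc_subset zero_mem hw huw
  have hle : f w' ≤ f u' := by
    rw [← hfu, ← hfw]
    have h2 := hf.apply_le_zero hw
    rw [Set.uIcc_of_ge h2] at h1
    exact h1.1
  rw [Set.mem_uIcc]
  rcases lt_or_gt_of_ne hw0 with h | h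
  · have hu0 : u' ≤ 0 := by
      by_contra hc
      nlinarith [mul_neg_of_pos_of_neg (not_le.1 hc) h]
    exact Or.inr ⟨(hf.strictMonoOn_left.le_iff_le ⟨hw'.1, h.le⟩ ⟨hu'.1, hu0⟩).1 hle, hu0⟩
  · have hu0 : 0 ≤ u' := by
      by_contra hc
      nlinarith [mul_neg_of_neg_of_pos (not_le.1 hc) h]
    exact Or.inl ⟨hu0, (hf.strictAntiOn_right.le_iff_ge ⟨h.le, hw'.2⟩ ⟨hu0, hu'.2⟩).1 hle⟩

/-- A restrictive interval extends to one bounded by a periodic point; `β` is that point and `t`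
its mirror image. -/
lemma exists_periodic_end (hf : IsSUnimodal f) (hrep : AllPeriodicRepelling f) {m : ℕ}
    (hm : 0 < m) {e e' : ℝ} (he : e ∈ phaseI) (he' : e' ∈ phaseI) (hee : e * e' < 0)
    (hfe : f e = f e') (hmono : MonoIter f m 0 e) (h0 : f^[m] 0 ∈ Set.uIcc e e')
    (h1 : f^[m] e ∈ Set.uIcc e e') (hpos : 0 < e * f^[m] 0) :
    ∃ t ∈ phaseI, ∃ β ∈ phaseI, e ∈ Set.uIcc 0 t ∧ e' ∈ Set.uIcc 0 β ∧ f t = f β ∧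
      f^[m] β = β ∧ MonoIter f m 0 t := by
  have hne : e ≠ 0 := fun h => by simp [h] at hpos
  have hneg := hf.zero_mem_of_restrictive hrep hm he he' hee hfe hmono h0 h1
  obtain ⟨s, hs, hes, hmono_s, hend⟩ := hf.exists_maximal_extension zero_mem he hne.symm hmono
  have hs0 : s ≠ 0 := by
    rintro rfl
    simp at hes
    exact hne hes
  obtain ⟨s', hs', hfs', _, hss'⟩ := hf.exists_mirror hs
  have hss := hss' hs0
  have hess : 0 < e * s := by
    rcases Set.mem_uIcc.1 hes with ⟨a, b⟩ | ⟨a, b⟩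
    · have := lt_of_le_of_ne a hne.symm; nlinarith
    · have := lt_of_le_of_ne b hne; nlinarith
  have hsame : 0 < e' * s' := by
    have : 0 < (e * e') * (s * s') := mul_pos_of_neg_of_neg hee hss
    have h3 : (e * e') * (s * s') = (e * s) * (e' * s') := by ring
    rw [h3] at this
    exact pos_of_mul_pos_right this hess.le
  have hs'0 : s' ≠ 0 := fun h => by simp [h] at hsame
  have hes' : e' ∈ Set.uIcc 0 s' :=
    hf.mirror_mem_uIcc hs he' hs' hes hfe hfs'.symm hsame.le hs'0
  have hFes := (hf.strictOn_iterate zero_mem hs hmono_s).mem_uIcc hes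
  have hFs_neg : s * f^[m] s < 0 ∧ 0 ≤ e' * f^[m] e := by
    rw [Set.mem_uIcc] at hFes
    rcases lt_or_gt_of_ne hne with h | h
    · have a1 : f^[m] 0 < 0 := by nlinarith
      have a2 : 0 < f^[m] e := by nlinarith
      have a3 : s < 0 := by nlinarith
      have a4 : 0 < e' := by nlinarith
      have a5 : 0 < f^[m] s := by
        rcases hFes with h | h <;> linarith [h.1, h.2]
      exact ⟨by nlinarith, by positivity⟩
    · have a1 : 0 < f^[m] 0 := by
        by_contra hc
        nlinarith
      have a2 : f^[m] e < 0 := by nlinarith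
      have a3 : 0 < s := by
        by_contra hc
        nlinarith
      have a4 : e' < 0 := by nlinarith
      have a5 : f^[m] s < 0 := by
        rcases hFes with h | h <;> linarith [h.1, h.2]
      exact ⟨by nlinarith, by nlinarith⟩
  obtain ⟨hFs_neg, hFe_pos⟩ := hFs_neg
  have hFs_pos : 0 < s' * f^[m] s := by
    have : 0 < (s * f^[m] s) * (s * s') := mul_pos_of_neg_of_neg hFs_neg hss
    have h3 : (s * f^[m] s) * (s * s') = s ^ 2 * (s' * f^[m] s) := by ring
    rw [h3] at this
    exact pos_of_mul_pos_right this (by positivity)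
  -- Were `f^[m] s` inside `[s, s']`, that interval would be restrictive with an end stopped by the
  -- boundary or by a preimage of `0`. The values of `f^[m]` at `±1` and
  -- `not_restrictive_of_zero_end` exclude both.
  have hbeyond : s' ∈ Set.uIcc 0 (f^[m] s) := by
    by_contra hc
    have hin : f^[m] s ∈ Set.uIcc 0 s' := by
      rw [Set.mem_uIcc] at hc ⊢
      push Not at hc
      rcases mul_pos_iff.1 hFs_pos with ⟨a, b⟩ | ⟨a, b⟩
      · exact Or.inl ⟨b.le, (hc.1 a.le).le⟩
      · refine Or.inr ⟨?_, b.le⟩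
        by_contra h3
        linarith [hc.2 (not_le.1 h3).le]
    have hz : (0 : ℝ) ∈ Set.uIcc s s' :=
      Set.uIoo_subset_uIcc_self (zero_mem_uIoo_iff.2 hss)
    have hes2 : Set.uIcc e e' ⊆ Set.uIcc s s' :=
      uIcc_subset_of_mem (uIcc_subset_of_mem hz Set.left_mem_uIcc hes)
        (uIcc_subset_of_mem hz Set.right_mem_uIcc hes')
    rcases hend with rfl | rfl | ⟨j, hj, hjs⟩
    · rw [hf.iterate_one_eq hm] at hc
      apply hc
      rw [Set.mem_uIcc]
      exact Or.inr ⟨hs'.1, by linarith⟩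
    · rw [hf.iterate_neg_one] at hFs_neg
      linarith
    · exact hf.not_restrictive_of_zero_end hrep hs hs' hss hfs'.symm hmono_s (hes2 h0)
        (uIcc_subset_of_mem hz Set.right_mem_uIcc hin) hj hjs
  have hFee : f^[m] e ∈ Set.uIcc 0 e' := by
    rw [Set.uIcc_comm] at h1
    exact mem_uIcc_zero_of_mul_nonneg (by linarith) h1 hFe_pos
  -- `f^[m]` moves `e'` weakly towards `0` and `s'` weakly away from `0`, so it has a fixed point
  -- between them.
  obtain ⟨β, hβ, hFβ⟩ : ∃ β ∈ Set.uIcc e' s', f^[m] β = β := by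
    refine hf.exists_fixed he' hs' ?_
    rw [iterate_congr hm hfe.symm, iterate_congr hm hfs', Set.mem_uIcc]
    rw [Set.mem_uIcc] at hFee hbeyond
    rcases mul_pos_iff.1 hsame with ⟨a, b⟩ | ⟨a, b⟩
    · left
      rcases hFee with h | h <;> rcases hbeyond with h' | h' <;> constructor <;>
        linarith [h.1, h.2, h'.1, h'.2]
    · right
      rcases hFee with h | h <;> rcases hbeyond with h' | h' <;> constructor <;>
        linarith [h.1, h.2, h'.1, h'.2]
  have hβI : β ∈ phaseI := uIcc_subset he' hs' hβ
  obtain ⟨S, hS, hsS, h0S⟩ := exists_isLap hs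
  obtain ⟨S', hS', hsS', h0S'⟩ := exists_isLap hs'
  have heS : e ∈ S := hS.uIcc_subset h0S hsS hes
  have heS' : e' ∈ S' := hS'.uIcc_subset h0S' hsS' hes'
  have hfβ : f β ∈ Set.uIcc (f e) (f s) := by
    rw [hfe, ← hfs']
    exact ((hf.strictOn_lap hS').mono (hS'.uIcc_subset heS' hsS')).mem_uIcc hβ
  obtain ⟨t, ht, hft⟩ := intermediate_value_uIcc
    (hf.continuousOn.mono (uIcc_subset he hs)) hfβ
  have htI : t ∈ phaseI := uIcc_subset he hs ht
  have hmem : ∀ a b c : ℝ, a ∈ Set.uIcc 0 c → b ∈ Set.uIcc a c → 0 < a * c → a ∈ Set.uIcc 0 b := by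
    intro a b c h1 h2 h3
    rw [Set.mem_uIcc] at *
    rcases mul_pos_iff.1 h3 with ⟨p, q⟩ | ⟨p, q⟩
    · left
      rcases h1 with h | h <;> rcases h2 with h' | h' <;> constructor <;>
        linarith [h.1, h.2, h'.1, h'.2]
    · right
      rcases h1 with h | h <;> rcases h2 with h' | h' <;> constructor <;>
        linarith [h.1, h.2, h'.1, h'.2]
  exact ⟨t, htI, β, hβI, hmem _ _ _ hes ht hess, hmem _ _ _ hes' hβ hsame, hft, hFβ,
    hmono_s.sub Set.left_mem_uIcc
      (uIcc_subset_of_mem hes Set.right_mem_uIcc ht)⟩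

/-- On `[p, t]`, with `p` a fixed point of `f^[m]` in `[0, e]` and `t` the mirror image of the
periodic point `β`, the derivative of `f^[m]` exceeds `1` in modulus at `p` and is at least `1 / C`
at `t`. By `expansion_of_three_point` the piece `[p, e]` shrinks at most by the factor `C`, while
`|p|` is bounded by `|f^[m] 0|`. -/
lemma restrictive_bound_aux (hf : IsSUnimodal f) (hrep : AllPeriodicRepelling f) {C : ℝ}
    (hC : FoldConst f C) {m : ℕ}
    (hm : 0 < m) {e e' : ℝ} (he : e ∈ phaseI) (he' : e' ∈ phaseI) (hee : e * e' < 0)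
    (hfe : f e = f e') (hmono : MonoIter f m 0 e) (h0 : f^[m] 0 ∈ Set.uIcc e e')
    (h1 : f^[m] e ∈ Set.uIcc e e') (hpos : 0 < e * f^[m] 0) :
    |e| ≤ (1 + C) * |f^[m] e - f^[m] 0| := by
  have hne : e ≠ 0 := fun h => by simp [h] at hpos
  have hC1 := hC.one_le
  have hneg := hf.zero_mem_of_restrictive hrep hm he he' hee hfe hmono h0 h1
  obtain ⟨t, ht, β, hβ, het, heβ, hft, hFβ, hmt⟩ :=
    hf.exists_periodic_end hrep hm he he' hee hfe hmono h0 h1 hpos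
  have hFt : f^[m] t = β := (iterate_congr hm hft).trans hFβ
  have heF : e * f^[m] e < 0 := by
    by_contra hc
    have h2 : 0 ≤ (e * f^[m] 0) * (e * f^[m] e) := mul_nonneg hpos.le (not_lt.1 hc)
    have h3 : (e * f^[m] 0) * (e * f^[m] e) = e ^ 2 * (f^[m] 0 * f^[m] e) := by ring
    have h4 : 0 < e ^ 2 := by positivity
    nlinarith
  have h0F : |f^[m] e - f^[m] 0| = |f^[m] e - 0| + |0 - f^[m] 0| :=
    abs_sub_eq_of_mem_uIcc (Set.uIoo_subset_uIcc_self (zero_mem_uIoo_iff.2 hneg))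
  rw [sub_zero, zero_sub, abs_neg] at h0F
  obtain ⟨p, hp, hFp⟩ : ∃ p ∈ Set.uIcc 0 e, f^[m] p = p := by
    refine hf.exists_fixed zero_mem he (Set.uIoo_subset_uIcc_self (zero_mem_uIoo_iff.2 ?_))
    nlinarith
  have hpI : p ∈ phaseI := uIcc_subset zero_mem he hp
  have hpt : p ∈ Set.uIcc 0 t := uIcc_subset_of_mem Set.left_mem_uIcc het hp
  have hpe : p ≠ e := by
    rintro rfl
    rw [hFp] at heF
    nlinarith [sq_nonneg p]
  have hept : e ∈ Set.uIcc p t := by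
    rw [Set.mem_uIcc] at *
    rcases lt_or_gt_of_ne hne with h | h
    · right
      rcases hp with a | a <;> rcases het with b | b <;> constructor <;>
        linarith [a.1, a.2, b.1, b.2]
    · left
      rcases hp with a | a <;> rcases het with b | b <;> constructor <;>
        linarith [a.1, a.2, b.1, b.2]
  have hMpt : MonoIter f m p t := hmt.sub hpt Set.right_mem_uIcc
  have hs := hf.strictOn_iterate zero_mem ht hmt
  have hFpe := hs.mono (uIcc_subset_of_mem hpt Set.right_mem_uIcc) |>.mem_uIcc hept
  have hF0p : f^[m] p ∈ Set.uIcc (f^[m] 0) (f^[m] e) :=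
    (hf.strictOn_iterate zero_mem he hmono).mem_uIcc hp
  have hsum := abs_sub_eq_of_mem_uIcc hF0p
  have hp0 : |p| ≤ |f^[m] e - f^[m] 0| := by
    rw [hFp] at hsum
    rw [Set.mem_uIcc] at hp
    rw [hFp, Set.mem_uIcc] at hF0p
    rw [h0F]
    have : |p| ≤ |f^[m] 0| := by
      rcases lt_or_gt_of_ne hne with h | h
      · have a1 : f^[m] 0 < 0 := by nlinarith
        have a2 : 0 < f^[m] e := by nlinarith
        have a3 : p ≤ 0 := by rcases hp with a | a <;> linarith [a.1, a.2]
        rw [abs_of_nonpos a3, abs_of_neg a1]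
        rcases hF0p with a | a <;> linarith [a.1, a.2]
      · have a1 : 0 < f^[m] 0 := by
          by_contra hc
          nlinarith
        have a2 : f^[m] e < 0 := by nlinarith
        have a3 : 0 ≤ p := by rcases hp with a | a <;> linarith [a.1, a.2]
        rw [abs_of_nonneg a3, abs_of_pos a1]
        rcases hF0p with a | a <;> linarith [a.1, a.2]
    linarith [abs_nonneg (f^[m] e)]
  by_cases hte : t = e
  · have h5 : |e| ≤ C * |e'| := hC.abs_le e he e' he' hfe.ge
    have h6 : |e'| ≤ |f^[m] e| := by
      rw [← hte, hFt]
      have := abs_sub_eq_of_mem_uIcc heβ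
      simp only [sub_zero] at this
      linarith [abs_nonneg (β - e')]
    have h7 : |f^[m] e| ≤ |f^[m] e - f^[m] 0| := by linarith [abs_nonneg (f^[m] 0)]
    calc |e| ≤ C * |e'| := h5
      _ ≤ C * |f^[m] e - f^[m] 0| := mul_le_mul_of_nonneg_left (h6.trans h7) (by linarith)
      _ ≤ (1 + C) * |f^[m] e - f^[m] 0| := by
        have := abs_nonneg (f^[m] e - f^[m] 0)
        nlinarith
  · have i1 := hf.three_point_iterate ht hpI (by rwa [Set.uIcc_comm]) hMpt.symm
    have i2 := hf.three_point_iterate hpI ht hept hMpt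
    have e1 := abs_sub_eq_of_mem_uIcc hept
    have e2 := abs_sub_eq_of_mem_uIcc hFpe
    have hdp := hrep p hpI m hm hFp
    have hdβ := hrep β hβ m hm hFβ
    -- By the chain rule the derivatives at `t` and `β` differ only in their first factor, because
    -- `f t = f β`.
    have hdt : 1 ≤ C * |derivI 1 (f^[m]) t| := by
      obtain ⟨q, rfl⟩ := Nat.exists_eq_succ_of_ne_zero hm.ne'
      rw [hf.derivI_iterate_succ q ht, abs_mul]
      rw [hf.derivI_iterate_succ q hβ, abs_mul, ← hft] at hdβ
      have := hC.deriv_le β hβ t ht hft.symm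
      have h8 := mul_le_mul_of_nonneg_left this (abs_nonneg (derivI 1 (f^[q]) (f t)))
      linarith
    have hB : 0 < |f^[m] t - f^[m] e| :=
      abs_pos.2 (sub_ne_zero.2 fun h => hte (hs.injOn Set.right_mem_uIcc het h))
    have key := expansion_of_three_point (A := |f^[m] e - f^[m] p|) (B := |f^[m] t - f^[m] e|)
      (X := |e - p|) (Y := |t - e|) (C := C) (d₁ := |derivI 1 (f^[m]) p|)
      (d₂ := |derivI 1 (f^[m]) t|) (abs_nonneg _) hB (abs_pos.2 (sub_ne_zero.2 hpe.symm))
      (abs_pos.2 (sub_ne_zero.2 hte)) hC1 hdp hdt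
      (by
        rw [abs_sub_comm (f^[m] e) (f^[m] t), abs_sub_comm p t, abs_sub_comm p e,
          abs_sub_comm e t, abs_sub_comm (f^[m] p) (f^[m] t), abs_sub_comm (f^[m] p) (f^[m] e),
          e1, e2] at i1
        linarith)
      (by
        rw [e1, e2] at i2
        linarith)
    have h9 : |e| ≤ |e - p| + |p| := by
      have := abs_add_le (e - p) p
      simpa using this
    have h10 : |f^[m] e - f^[m] p| ≤ |f^[m] e - f^[m] 0| := by
      rw [hsum]; linarith [abs_nonneg (f^[m] p - f^[m] 0)]
    calc |e| ≤ C * |f^[m] e - f^[m] p| + |f^[m] e - f^[m] 0| := by linarith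
      _ ≤ C * |f^[m] e - f^[m] 0| + |f^[m] e - f^[m] 0| := by gcongr
      _ = _ := by ring

/-- Iterates do not contract restrictive intervals around the critical point. -/
lemma restrictive_bound (hf : IsSUnimodal f) (hrep : AllPeriodicRepelling f) {C : ℝ}
    (hC : FoldConst f C) {m : ℕ}
    (hm : 0 < m) {e e' : ℝ} (he : e ∈ phaseI) (he' : e' ∈ phaseI) (hee : e * e' < 0)
    (hfe : f e = f e') (hmono : MonoIter f m 0 e) (h0 : f^[m] 0 ∈ Set.uIcc e e')
    (h1 : f^[m] e ∈ Set.uIcc e e') : |e - e'| ≤ (1 + C) ^ 2 * |f^[m] e - f^[m] 0| := by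
  have hC1 := hC.one_le
  have hsub : |e - e'| ≤ |e| + |e'| := abs_sub e e'
  have c1 : |e| ≤ C * |e'| := hC.abs_le e he e' he' hfe.ge
  have c2 : |e'| ≤ C * |e| := hC.abs_le e' he' e he hfe.le
  rcases same_or_opp hee (hf.iterate_zero_ne hrep hm) with h | h
  · have := hf.restrictive_bound_aux hrep hC hm he he' hee hfe hmono h0 h1 h
    nlinarith
  · rw [Set.uIcc_comm] at h0 h1
    have hFe := iterate_congr hm hfe
    have := hf.restrictive_bound_aux hrep hC hm he' he (by linarith) hfe.symm
      (hf.monoIter_congr he he' hfe hmono) h0 (by rw [← hFe]; exact h1) h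
    rw [← hFe] at this
    nlinarith

end IsSUnimodal

/-! ### Closest returns and the space around them -/

namespace IsSUnimodal
variable {f : ℝ → ℝ}

lemma min_le_of_mem_uIcc (hf : IsSUnimodal f) {x y z : ℝ} (hy : y ∈ phaseI) (hz : z ∈ phaseI)
    (hx : x ∈ Set.uIcc y z) : min (f y) (f z) ≤ f x := by
  have hxI := uIcc_subset hy hz hx
  wlog hyz : y ≤ z generalizing y z
  · rw [min_comm]
    exact this hz hy (by rwa [Set.uIcc_comm]) (le_of_not_ge hyz)
  rw [Set.uIcc_of_le hyz] at hx
  rcases le_total x 0 with h | h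
  · exact (min_le_left _ _).trans (hf.strictMonoOn_left.monotoneOn ⟨hy.1, hx.1.trans h⟩
      ⟨hxI.1, h⟩ hx.1)
  · exact (min_le_right _ _).trans (hf.strictAntiOn_right.antitoneOn ⟨h, hxI.2⟩
      ⟨h.trans hx.2, hz.2⟩ hx.2)

lemma exists_lap_preimage (hf : IsSUnimodal f) {S : Set ℝ} (hS : IsLap S) {c : ℝ}
    (hc : c ∈ Set.Icc (-1) (f 0)) : ∃ x ∈ S, f x = c := by
  rcases hS with rfl | rfl
  · obtain ⟨y, hy, hfy⟩ := intermediate_value_Icc (show (-1 : ℝ) ≤ 0 by norm_num)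
        (hf.continuousOn.mono Icc_left_subset) (show c ∈ Set.Icc (f (-1)) (f 0) from
          ⟨by rw [hf.map_neg_one]; exact hc.1, hc.2⟩)
    exact ⟨y, hy, hfy⟩
  · obtain ⟨y, hy, hfy⟩ := intermediate_value_Icc' (zero_le_one (α := ℝ))
        (hf.continuousOn.mono Icc_right_subset) (show c ∈ Set.Icc (f 1) (f 0) from
          ⟨by rw [hf.map_one]; exact hc.1, hc.2⟩)
    exact ⟨y, hy, hfy⟩

lemma apply_mem_range (hf : IsSUnimodal f) {x : ℝ} (hx : x ∈ phaseI) :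
    f x ∈ Set.Icc (-1) (f 0) := ⟨(hf.mapsTo hx).1, hf.apply_le_zero hx⟩

/-- A point of the lap of `e` with larger image is closer to the critical point. -/
lemma mem_uIcc_of_lap (hf : IsSUnimodal f) {S : Set ℝ} (hS : IsLap S) {x e : ℝ} (hx : x ∈ S)
    (he : e ∈ S) (h : f e ≤ f x) : x ∈ Set.uIcc 0 e := by
  rw [Set.mem_uIcc]
  rcases hS with rfl | rfl
  · exact Or.inr ⟨(hf.strictMonoOn_left.le_iff_le he hx).1 h, hx.2⟩
  · exact Or.inl ⟨hx.1, (hf.strictAntiOn_right.le_iff_ge he hx).1 h⟩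

/-- A point with larger image lies in the symmetric hull. -/
lemma mem_uIcc_mirror (hf : IsSUnimodal f) {x e e' : ℝ} (hx : x ∈ phaseI)
    (he : e ∈ phaseI) (he' : e' ∈ phaseI) (hee : e * e' < 0) (hfe : f e = f e') (h : f e ≤ f x) :
    x ∈ Set.uIcc e e' := by
  have hz : (0 : ℝ) ∈ Set.uIcc e e' := Set.uIoo_subset_uIcc_self (zero_mem_uIoo_iff.2 hee)
  have key : ∀ u ∈ phaseI, f u ≤ f x → 0 < u * x → x ∈ Set.uIcc 0 u := by
    intro u hu hux hpos
    rcases mul_pos_iff.1 hpos with ⟨a, b⟩ | ⟨a, b⟩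
    · exact hf.mem_uIcc_of_lap (Or.inr rfl) ⟨b.le, hx.2⟩ ⟨a.le, hu.2⟩ hux
    · exact hf.mem_uIcc_of_lap (Or.inl rfl) ⟨hx.1, b.le⟩ ⟨hu.1, a.le⟩ hux
  by_cases hx0 : x = 0
  · rwa [hx0]
  rcases same_or_opp hee hx0 with h1 | h1
  · exact uIcc_subset_of_mem hz Set.left_mem_uIcc (key e he h h1)
  · exact uIcc_subset_of_mem hz Set.right_mem_uIcc (key e' he' (hfe ▸ h) h1)

/-- A gap between points with far apart images is not much shorter than an interval with these
images. -/
lemma FoldConst.gap (hf : IsSUnimodal f) {C : ℝ} (hC : FoldConst f C) {S : Set ℝ} (hS : IsLap S)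
    {v w x z : ℝ} (hv : v ∈ S) (hw : w ∈ S) (hx : x ∈ phaseI) (hz : z ∈ phaseI)
    (hvx : f v ≤ f x) (hzw : f z ≤ f w) (hwv : f w ≤ f v) : |v - w| ≤ C * |z - x| := by
  obtain ⟨T, hT, hzT, h0T⟩ := exists_isLap hz
  obtain ⟨v', hv', hfv⟩ := hf.exists_lap_preimage hT (hf.apply_mem_range (hS.subset hv))
  obtain ⟨w', hw', hfw⟩ := hf.exists_lap_preimage hT (hf.apply_mem_range (hS.subset hw))
  have h1 := hC.length_le T S hT hS w' hw' v' hv' w hw v hv hfw.symm hfv.symm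
  refine h1.trans (mul_le_mul_of_nonneg_left ?_ (zero_le_one.trans hC.one_le))
  rw [← hfv] at hvx
  rw [← hfw] at hzw
  have hwv' : f w' ≤ f v' := by rw [hfv, hfw]; exact hwv
  rcases hT with rfl | rfl
  · have a1 := (hf.strictMonoOn_left.le_iff_le hzT hw').1 hzw
    have a2 := (hf.strictMonoOn_left.le_iff_le hw' hv').1 hwv'
    have a3 : v' ≤ x := by
      by_contra hc
      have hx0 : x ≤ 0 := (not_le.1 hc).le.trans hv'.2
      exact hc ((hf.strictMonoOn_left.le_iff_le hv' ⟨hx.1, hx0⟩).1 hvx)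
    rw [abs_of_nonneg (by linarith), abs_of_nonpos (by linarith)]
    linarith
  · have a1 := (hf.strictAntiOn_right.le_iff_ge hzT hw').1 hzw
    have a2 := (hf.strictAntiOn_right.le_iff_ge hw' hv').1 hwv'
    have a3 : x ≤ v' := by
      by_contra hc
      have hx0 : 0 ≤ x := hv'.1.trans (not_le.1 hc).le
      exact hc ((hf.strictAntiOn_right.le_iff_ge hv' ⟨hx0, hx.2⟩).1 hvx)
    rw [abs_of_nonpos (by linarith), abs_of_nonneg (by linarith)]
    linarith

/-- `f^[k] J` is mapped to the left of the image of `f^[q] J`, for `J` with end points `a`, `b`. -/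
def ImageLeft (f : ℝ → ℝ) (a b : ℝ) (k q : ℕ) : Prop :=
  max (f^[k + 1] a) (f^[k + 1] b) ≤ min (f^[q + 1] a) (f^[q + 1] b)

lemma ImageLeft.symm {a b : ℝ} {k q : ℕ} (h : ImageLeft f a b k q) : ImageLeft f b a k q := by
  unfold ImageLeft at *
  rwa [max_comm, min_comm]

lemma ImageLeft.trans {a b : ℝ} {k q r : ℕ} (h : ImageLeft f a b k q) (h' : ImageLeft f a b q r) :
    ImageLeft f a b k r := by
  unfold ImageLeft at *
  exact h.trans (min_le_max.trans h')

lemma iterate_ne (hf : IsSUnimodal f) {n : ℕ} {a b : ℝ} (ha : a ∈ phaseI) (hb : b ∈ phaseI)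
    (hab : a ≠ b) (h : MonoIter f n a b) : f^[n] a ≠ f^[n] b := fun e =>
  hab ((hf.strictOn_iterate ha hb h).injOn Set.left_mem_uIcc Set.right_mem_uIcc e)

lemma imageLeft_or (hf : IsSUnimodal f) (hrep : AllPeriodicRepelling f) {a b : ℝ}
    (ha : a ∈ phaseI) (hb : b ∈ phaseI) (hab : a ≠ b) (hom : ∀ n, MonoIter f n a b) {k q : ℕ}
    (hkq : k ≠ q) : ImageLeft f a b k q ∨ ImageLeft f a b q k := by
  wlog hlt : k < q generalizing k q
  · exact (this hkq.symm (by omega)).symm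
  have hd := hf.disjoint_iterates hrep ha hb hab hom (n := k + 1) (m := q + 1) (by omega)
  rw [hf.image_uIoo ha hb (hom _), hf.image_uIoo ha hb (hom _)] at hd
  have n1 := hf.iterate_ne ha hb hab (hom (k + 1))
  have n2 := hf.iterate_ne ha hb hab (hom (q + 1))
  unfold ImageLeft
  by_contra hc
  push Not at hc
  obtain ⟨h1, h2⟩ := hc
  have h3 := min_lt_max.2 n1
  have h4 := min_lt_max.2 n2
  have h5 : max (min (f^[k + 1] a) (f^[k + 1] b)) (min (f^[q + 1] a) (f^[q + 1] b)) <
      min (max (f^[k + 1] a) (f^[k + 1] b)) (max (f^[q + 1] a) (f^[q + 1] b)) :=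
    max_lt (lt_min h3 h2) (lt_min h1 h4)
  obtain ⟨z, hz1, hz2⟩ := exists_between h5
  have h6 : z ∈ Set.uIoo (f^[k + 1] a) (f^[k + 1] b) :=
    ⟨(le_max_left _ _).trans_lt hz1, hz2.trans_le (min_le_left _ _)⟩
  have h7 : z ∈ Set.uIoo (f^[q + 1] a) (f^[q + 1] b) :=
    ⟨(le_max_right _ _).trans_lt hz1, hz2.trans_le (min_le_right _ _)⟩
  exact Set.disjoint_left.1 hd h6 h7

/-- The situation at the time `i` when an extension `y` of `[a, b]` meets the critical point. -/
lemma side_data (hf : IsSUnimodal f) {a b y : ℝ} (ha : a ∈ phaseI) (hy : y ∈ phaseI)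
    (hab : a ≠ b) (hby : b ∈ Set.uIcc a y) {n i : ℕ} (hM : MonoIter f n a y) (hi : i < n)
    (hiy : f^[i] y = 0) :
    f^[i] b ∈ Set.uIcc 0 (f^[i] a) ∧ f^[i] a ≠ 0 ∧ MonoIter f (n - i) 0 (f^[i] a) ∧
    f^[n - i] (f^[i] a) = f^[n] a ∧ f^[n - i] (f^[i] b) = f^[n] b ∧ f^[n - i] 0 = f^[n] y ∧
    f^[n] b ∈ Set.uIcc (f^[n] a) (f^[n] y) := by
  have hsum : ∀ z, f^[n - i] (f^[i] z) = f^[n] z := fun z => by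
    rw [← Function.iterate_add_apply, Nat.sub_add_cancel hi.le]
  have hay : a ≠ y := by
    rintro rfl
    simp at hby
    exact hab hby.symm
  have hs := hf.strictOn_iterate ha hy (hM.le hi.le)
  have h1 := hs.mem_uIcc hby
  rw [hiy, Set.uIcc_comm] at h1
  have h2 : MonoIter f (i + (n - i)) a y := by rwa [Nat.add_sub_cancel' hi.le]
  rw [hf.monoIter_add_iff ha hy, hiy] at h2
  refine ⟨h1, ?_, h2.2.symm, hsum a, hsum b, by rw [← hiy, hsum],
    (hf.strictOn_iterate ha hy hM).mem_uIcc hby⟩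
  intro h
  exact hay (hs.injOn Set.left_mem_uIcc Set.right_mem_uIcc (by rw [h, hiy]))

/-- Space around `f^[n] J` on the side of `y`, when `f^[n] J` is a closest return to the critical
point and `f^[q] J` is the preceding one. -/
lemma space_of_closest_return (hf : IsSUnimodal f) (hrep : AllPeriodicRepelling f) {C : ℝ}
    (hC : FoldConst f C) {a b y : ℝ} (ha : a ∈ phaseI) (hb : b ∈ phaseI) (hy : y ∈ phaseI)
    (hab : a ≠ b) (hom : ∀ n, MonoIter f n a b) (hby : b ∈ Set.uIcc a y) {q n i : ℕ}
    (hM : MonoIter f n a y) (hi : i < n) (hiy : f^[i] y = 0) (hq : ImageLeft f a b q n)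
    (hk : ∀ k < n, k ≠ q → ImageLeft f a b k q) :
    |f^[q] a - f^[q] b| ≤ C * (1 + C) ^ 2 * |f^[n] y - f^[n] b| ∨
    (|f^[n] b| ≤ |f^[n] y - f^[n] b| ∧
      |f^[q] a - f^[q] b| ≤ C * (1 + C) ^ 2 * (|f^[n] a - f^[n] b| + |f^[n] y - f^[n] b|)) := by
  have hC1 := hC.one_le
  have hCC : C ≤ C * (1 + C) ^ 2 := by nlinarith
  obtain ⟨hd, he0, hMe, hFe, hFd, hF0, hbn⟩ := hf.side_data ha hy hab hby hM hi hiy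
  have heI := hf.iterate_mem i ha
  have hdI := hf.iterate_mem i hb
  -- the ends `v` (near) and `w` (far) of `f^[q] J`
  obtain ⟨S, hS, haS, hbS⟩ := exists_lap (hf.iterate_mem q ha) (hf.iterate_mem q hb)
    (((hf.monoIter_add_iff ha hb).1 (hom (q + 1))).2 : MonoIter f (0 + 1) (f^[q] a) (f^[q] b))
  have hqne := hf.iterate_ne ha hb hab (hom q)
  obtain ⟨v, w, hv, hw, hvw, hfw, hfv, hends⟩ : ∃ v w, v ∈ S ∧ w ∈ S ∧
      |v - w| = |f^[q] a - f^[q] b| ∧ f w = min (f^[q + 1] a) (f^[q + 1] b) ∧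
      f v = max (f^[q + 1] a) (f^[q + 1] b) ∧
      ((w = f^[q] a ∧ v = f^[q] b) ∨ (w = f^[q] b ∧ v = f^[q] a)) := by
    simp only [Function.iterate_succ_apply']
    rcases le_total (f (f^[q] a)) (f (f^[q] b)) with h | h
    · exact ⟨f^[q] b, f^[q] a, hbS, haS, abs_sub_comm _ _, (min_eq_left h).symm,
        (max_eq_right h).symm, Or.inl ⟨rfl, rfl⟩⟩
    · exact ⟨f^[q] a, f^[q] b, haS, hbS, rfl, (min_eq_right h).symm,
        (max_eq_left h).symm, Or.inr ⟨rfl, rfl⟩⟩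
  have hwv : f w ≤ f v := by rw [hfw, hfv]; exact min_le_max
  have hwv' : f w < f v := lt_of_le_of_ne hwv fun h => by
    have := (hf.strictOn_lap hS).injOn hw hv h
    rw [this, sub_self, abs_zero] at hvw
    exact hqne (sub_eq_zero.1 (abs_eq_zero.1 hvw.symm))
  rw [← hvw]
  have hFaI := hf.iterate_mem n ha
  have hFbI := hf.iterate_mem n hb
  have hFyI := hf.iterate_mem n hy
  have hva : f v ≤ f (f^[n] a) := by
    rw [hfv, ← Function.iterate_succ_apply' f n a]
    exact le_trans hq (min_le_left _ _)
  have hvb : f v ≤ f (f^[n] b) := by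
    rw [hfv, ← Function.iterate_succ_apply' f n b]
    exact le_trans hq (min_le_right _ _)
  -- The near end of `f^[q] J` is `v`, the far end `w`. If `f^[n] y` is at least as far out as `w`,
  -- the gap from `f^[n] b` to `f^[n] y` covers a copy of `f^[q] J` up to folding.
  by_cases hout : f (f^[n] y) ≤ f w
  · left
    refine (hC.gap hf hS hv hw hFbI hFyI hvb hout hwv).trans ?_
    exact mul_le_mul_of_nonneg_right hCC (abs_nonneg _)
  push Not at hout
  have hew : f (f^[i] a) ≤ f w := by
    by_cases hiq : i = q
    · subst hiq
      have : f (f^[i] a) ≤ f (f^[i] b) := by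
        have := hf.min_le_of_mem_uIcc zero_mem heI hd
        rwa [min_eq_right (hf.apply_le_zero heI)] at this
      rw [hfw, Function.iterate_succ_apply', Function.iterate_succ_apply', min_eq_left this]
    · have := hk i hi hiq
      rw [hfw, ← Function.iterate_succ_apply' f i a]
      exact (le_max_left _ _).trans this
  -- When `q < i`, a copy of `w` in `[0, f^[i] a]` is sent between `f^[n] y` and `f^[n] a`, hence
  -- nearer to `0` than `w`. But its image is also an end of the iterate of `J` at time `q + (n - i)
  -- < n`, which maps to the left of `f^[q] J`.
  by_cases hiq : q < i
  · exfalso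
    obtain ⟨T, hT, heT, h0T⟩ := exists_isLap heI
    obtain ⟨w', hw', hfw'⟩ := hf.exists_lap_preimage hT (hf.apply_mem_range (hS.subset hw))
    have hmem : w' ∈ Set.uIcc 0 (f^[i] a) := hf.mem_uIcc_of_lap hT hw' heT (by rw [hfw']; exact hew)
    have h1 := (hf.strictOn_iterate zero_mem heI hMe).mem_uIcc hmem
    rw [hF0, hFe] at h1
    have h2 := hf.min_le_of_mem_uIcc hFyI hFaI h1
    have h3 : f w < f (f^[n - i] w') := lt_of_lt_of_le (lt_min hout (hwv'.trans_le hva)) h2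
    rw [iterate_congr (by omega) hfw'] at h3
    have h4 := hk (q + (n - i)) (by omega) (by omega)
    have h5 : f (f^[n - i] w) ≤ f w := by
      conv_rhs => rw [hfw]
      refine le_trans ?_ h4
      rcases hends with ⟨h, _⟩ | ⟨h, _⟩
      · rw [h, ← Function.iterate_add_apply, ← Function.iterate_succ_apply' f,
          show (n - i + q).succ = q + (n - i) + 1 by omega]
        exact le_max_left _ _
      · rw [h, ← Function.iterate_add_apply, ← Function.iterate_succ_apply' f,
          show (n - i + q).succ = q + (n - i) + 1 by omega]
        exact le_max_right _ _
    linarith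
  -- The symmetric interval with end `f^[i] a` is restrictive for `f^[n - i]`: both `f^[n] y` and
  -- `f^[n] a` have images to the right of that of `f^[i] a`.
  · obtain ⟨e', he', hfe', _, hee⟩ := hf.exists_mirror heI
    have hee := hee he0
    have hm : 0 < n - i := by omega
    have h0 : f^[n - i] 0 ∈ Set.uIcc (f^[i] a) e' := by
      rw [hF0]
      exact hf.mem_uIcc_mirror hFyI heI he' hee hfe'.symm (hew.trans hout.le)
    have h1 : f^[n - i] (f^[i] a) ∈ Set.uIcc (f^[i] a) e' := by
      rw [hFe]
      exact hf.mem_uIcc_mirror hFaI heI he' hee hfe'.symm (hew.trans (hwv.trans hva))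
    have hneg := hf.zero_mem_of_restrictive hrep hm heI he' hee hfe'.symm hMe h0 h1
    have hbd := hf.restrictive_bound hrep hC hm heI he' hee hfe'.symm hMe h0 h1
    rw [hF0, hFe] at hneg hbd
    have hsum := abs_sub_eq_of_mem_uIcc hbn
    right
    constructor
    -- Zero lies between `f^[n] y` and `f^[n] a` but not in `f^[n] J`, so it lies in the gap.
    · have h2 : (0 : ℝ) ∈ Set.uIcc (f^[n] y) (f^[n] b) := by
        by_contra hc
        have h4 : (0 : ℝ) ∈ Set.uIoo (f^[n] a) (f^[n] b) := by
          rw [zero_mem_uIoo_iff]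
          rw [Set.mem_uIcc] at hc
          push Not at hc
          rcases mul_neg_iff.1 hneg with ⟨h3, h5⟩ | ⟨h3, h5⟩
          · refine mul_neg_of_neg_of_pos h5 ?_
            by_contra h6
            linarith [hc.2 (not_lt.1 h6)]
          · exact mul_neg_of_pos_of_neg h5 (hc.1 h3.le)
        rw [← hf.image_uIoo ha hb (hom n)] at h4
        obtain ⟨z, hz, hz0⟩ := h4
        exact hom (n + 1) n (by omega) z hz hz0
      have h3 := abs_sub_eq_of_mem_uIcc h2
      rw [sub_zero, zero_sub, abs_neg] at h3
      rw [abs_sub_comm]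
      linarith [abs_nonneg (f^[n] y)]
    · have hgap := hC.gap hf hS hv hw zero_mem heI (hf.apply_le_zero (hS.subset hv)) hew hwv
      rw [sub_zero] at hgap
      have h2 : |f^[i] a| ≤ |f^[i] a - e'| := by
        have := abs_sub_eq_of_mem_uIcc
          (Set.uIoo_subset_uIcc_self (zero_mem_uIoo_iff.2 hee) : (0 : ℝ) ∈ Set.uIcc (f^[i] a) e')
        rw [sub_zero, zero_sub, abs_neg, abs_sub_comm] at this
        linarith [abs_nonneg e']
      rw [abs_sub_comm (f^[n] a) (f^[n] y), hsum, abs_sub_comm (f^[n] b) (f^[n] a)] at hbd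
      calc |v - w| ≤ C * |f^[i] a| := hgap
        _ ≤ C * ((1 + C) ^ 2 * (|f^[n] y - f^[n] b| + |f^[n] a - f^[n] b|)) := by
          gcongr
          exact h2.trans hbd
        _ = _ := by ring

end IsSUnimodal

/-! ### Exclusion of intervals on which all iterates are monotone -/

namespace IsSUnimodal
variable {f : ℝ → ℝ}

/-- Otherwise the first two images would both have `-1` as left end point, and so would overlap. -/
lemma exists_not_monoIter_end (hf : IsSUnimodal f) (hrep : AllPeriodicRepelling f) {a σ : ℝ}
    (ha : a ∈ phaseI) (hσ : σ = 1 ∨ σ = -1) (haσ : a ≠ σ) : ∃ n, ¬ MonoIter f n a σ := by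
  by_contra hc
  push Not at hc
  have hσI : σ ∈ phaseI := by rcases hσ with rfl | rfl <;> constructor <;> norm_num
  have hd := hf.disjoint_iterates hrep ha hσI haσ hc (n := 1) (m := 2) (by norm_num)
  rw [hf.image_uIoo ha hσI (hc _), hf.image_uIoo ha hσI (hc _)] at hd
  have n1 := hf.iterate_ne ha hσI haσ (hc 1)
  have n2 := hf.iterate_ne ha hσI haσ (hc 2)
  have e : ∀ k, 0 < k → f^[k] σ = -1 := by
    intro k hk
    rcases hσ with rfl | rfl
    · exact hf.iterate_one_eq hk
    · exact hf.iterate_neg_one k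
  rw [e 1 (by norm_num)] at n1 hd
  rw [e 2 (by norm_num)] at n2 hd
  have h1 : -1 < f^[1] a := lt_of_le_of_ne (hf.iterate_mem 1 ha).1 n1.symm
  have h2 : -1 < f^[2] a := lt_of_le_of_ne (hf.iterate_mem 2 ha).1 n2.symm
  rw [Set.uIoo_of_gt h1, Set.uIoo_of_gt h2] at hd
  obtain ⟨z, hz1, hz2⟩ := exists_between (lt_min h1 h2)
  have h3 : z ∈ Set.Ioo (-1) (f^[1] a) := ⟨hz1, hz2.trans_le (min_le_left _ _)⟩
  have h4 : z ∈ Set.Ioo (-1) (f^[2] a) := ⟨hz1, hz2.trans_le (min_le_right _ _)⟩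
  exact Set.disjoint_left.1 hd h3 h4

/-- For large `n` a maximal extension cannot reach the boundary of the phase interval, so it stops
at a preimage of `0`. -/
lemma exists_side (hf : IsSUnimodal f) (hrep : AllPeriodicRepelling f) {a b : ℝ}
    (ha : a ∈ phaseI) (hb : b ∈ phaseI) (hab : a ≠ b) (hom : ∀ n, MonoIter f n a b) :
    ∃ N, ∀ n ≥ N, ∃ y ∈ phaseI, b ∈ Set.uIcc a y ∧ MonoIter f n a y ∧
      ∃ i < n, f^[i] y = 0 := by
  have key : ∀ σ : ℝ, (σ = 1 ∨ σ = -1) → ∃ N, ∀ n ≥ N, a ≠ σ → ¬ MonoIter f n a σ := by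
    intro σ hσ
    by_cases haσ : a = σ
    · exact ⟨0, fun n _ h => absurd haσ h⟩
    · obtain ⟨N, hN⟩ := hf.exists_not_monoIter_end hrep ha hσ haσ
      exact ⟨N, fun n hn _ h => hN (h.le hn)⟩
  obtain ⟨N1, h1⟩ := key 1 (Or.inl rfl)
  obtain ⟨N2, h2⟩ := key (-1) (Or.inr rfl)
  refine ⟨max N1 N2, fun n hn => ?_⟩
  obtain ⟨y, hy, hby, hM, hend⟩ := hf.exists_maximal_extension ha hb hab (hom n)
  have hay : a ≠ y := by
    rintro rfl
    simp at hby
    exact hab hby.symm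
  refine ⟨y, hy, hby, hM, ?_⟩
  rcases hend with rfl | rfl | h
  · exact absurd hM (h1 n (le_of_max_le_left hn) hay)
  · exact absurd hM (h2 n (le_of_max_le_right hn) hay)
  · exact h

/-- The iterates are disjoint subintervals of a bounded interval, so their lengths are summable. -/
lemma tendsto_length (hf : IsSUnimodal f) (hrep : AllPeriodicRepelling f) {a b : ℝ}
    (ha : a ∈ phaseI) (hb : b ∈ phaseI) (hab : a ≠ b) (hom : ∀ n, MonoIter f n a b) :
    Tendsto (fun n => |f^[n] a - f^[n] b|) atTop (𝓝 0) := by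
  have hvol : ∀ n, MeasureTheory.volume (f^[n] '' Set.uIoo a b) =
      ENNReal.ofReal |f^[n] a - f^[n] b| := by
    intro n
    rw [hf.image_uIoo ha hb (hom n)]
    unfold Set.uIoo
    rw [Real.volume_Ioo, abs_sub_comm, ← max_sub_min_eq_abs']
    simp [max_comm, min_comm]
  have hdis : Pairwise (Function.onFun Disjoint fun n => f^[n] '' Set.uIoo a b) := by
    intro n m hnm
    rcases lt_or_gt_of_ne hnm with h | h
    · exact hf.disjoint_iterates hrep ha hb hab hom h
    · exact (hf.disjoint_iterates hrep ha hb hab hom h).symm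
  have hmeas : ∀ n, MeasurableSet (f^[n] '' Set.uIoo a b) := by
    intro n
    rw [hf.image_uIoo ha hb (hom n)]
    exact measurableSet_Ioo
  have hsum : ∑' n, MeasureTheory.volume (f^[n] '' Set.uIoo a b) ≠ ⊤ := by
    rw [← MeasureTheory.measure_iUnion hdis hmeas]
    have hsub : (⋃ n, f^[n] '' Set.uIoo a b) ⊆ phaseI := by
      refine Set.iUnion_subset fun n => ?_
      rintro _ ⟨z, hz, rfl⟩
      exact hf.iterate_mem n (uIcc_subset ha hb (Set.uIoo_subset_uIcc_self hz))
    refine ((MeasureTheory.measure_mono hsub).trans_lt ?_).ne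
    rw [Real.volume_Icc]
    exact ENNReal.ofReal_lt_top
  have h := ENNReal.tendsto_atTop_zero_of_tsum_ne_top hsum
  have h2 := (ENNReal.tendsto_toReal ENNReal.zero_ne_top).comp h
  simp only [ENNReal.toReal_zero] at h2
  refine h2.congr fun n => ?_
  simp [hvol, ENNReal.toReal_ofReal (abs_nonneg _)]

/-- A one-sided maximal interval of monotonicity of all iterates cannot have definite space on
both sides for infinitely many iterates. -/
lemma not_space (hf : IsSUnimodal f) {a b θ : ℝ} (hb : b ∈ phaseI) (hab : a < b)
    (hom : ∀ n, MonoIter f n a b) (hmax : ∀ x ∈ phaseI, x < a → ∃ n, ¬ MonoIter f n x b)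
    (hθ : 0 < θ)
    (hsp : ∀ N, ∃ n ≥ N, ∃ x ∈ phaseI, ∃ y ∈ phaseI, x ≤ a ∧ b ≤ y ∧ MonoIter f n x b ∧
      MonoIter f n a y ∧ θ * |f^[n] a - f^[n] b| ≤ |f^[n] x - f^[n] a| ∧
      θ * |f^[n] a - f^[n] b| ≤ |f^[n] y - f^[n] b|) : False := by
  -- The first factor bounds the cross-ratio of the images, the factor `2` bounds `y - b`; `δ` is
  -- chosen so that `K * δ` is half of `(b - a) ^ 2`.
  set K : ℝ := (1 / θ ^ 2 + 2 / θ) * 2 with hK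
  have hK0 : 0 < K := by positivity
  set δ : ℝ := (b - a) ^ 2 / (2 * K) with hδ
  have hba : 0 < b - a := sub_pos.2 hab
  have hδ0 : 0 < δ := by positivity
  -- Maximality on the left makes the monotone extensions to the left of `a` uniformly short for
  -- large `n`; no maximality on the right is needed.
  have hN : ∃ N, ∀ n ≥ N, ∀ x ∈ phaseI, x ≤ a → MonoIter f n x b → a - x < δ := by
    by_cases hx : a - δ ∈ phaseI
    · obtain ⟨N, hN⟩ := hmax (a - δ) hx (by linarith)
      refine ⟨N, fun n hn x _ hxa hM => ?_⟩
      by_contra hc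
      push Not at hc
      refine hN ((hM.le hn).sub ?_ Set.right_mem_uIcc)
      exact Set.mem_uIcc.2 (Or.inl ⟨by linarith, by linarith⟩)
    · refine ⟨0, fun n _ x hxI hxa _ => ?_⟩
      by_contra hc
      push Not at hc
      exact hx ⟨by linarith [hxI.1], by linarith [hb.2]⟩
  obtain ⟨N, hN⟩ := hN
  obtain ⟨n, hn, x, hx, y, hy, hxa, hby, hMx, hMy, hsx, hsy⟩ := hsp N
  have hM : MonoIter f n x y := by
    intro k hk z hz
    rw [Set.uIoo_of_lt (by linarith)] at hz
    by_cases hzb : z < b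
    · exact hMx k hk z (by rw [Set.uIoo_of_lt (by linarith)]; exact ⟨hz.1, hzb⟩)
    · exact hMy k hk z (by rw [Set.uIoo_of_lt (by linarith)]; exact ⟨by linarith, hz.2⟩)
  have haI : a ∈ phaseI := ⟨by linarith [hx.1], by linarith [hb.2]⟩
  have key := hf.four_point_iterate hx hy (Or.inl ⟨hxa, hab.le, hby⟩) hM
  have hs := hf.strictOn_iterate hx hy hM
  have hpos : 0 < |f^[n] a - f^[n] b| :=
    abs_pos.2 (sub_ne_zero.2 (hf.iterate_ne haI hb hab.ne (hom n)))
  have hax := hs.mem_uIcc (Set.mem_uIcc.2 (Or.inl ⟨hxa, by linarith⟩) : a ∈ Set.uIcc x y)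
  have hMay : f^[n] b ∈ Set.uIcc (f^[n] a) (f^[n] y) :=
    (hs.mono (uIcc_subset_of_mem (Set.mem_uIcc.2 (Or.inl ⟨hxa, by linarith⟩))
      Set.right_mem_uIcc)).mem_uIcc (Set.mem_uIcc.2 (Or.inl ⟨hab.le, hby⟩))
  have s1 := abs_sub_eq_of_mem_uIcc hax
  have s2 := abs_sub_eq_of_mem_uIcc hMay
  rw [s1, s2] at key
  rw [abs_sub_comm (f^[n] x) (f^[n] a)] at hsx
  rw [abs_sub_comm (f^[n] a) (f^[n] b)] at hpos hsx hsy
  set M := |f^[n] b - f^[n] a|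
  set L := |f^[n] a - f^[n] x|
  set R := |f^[n] y - f^[n] b|
  have hL : 0 < L := (mul_pos hθ hpos).trans_le hsx
  have hR : 0 < R := (mul_pos hθ hpos).trans_le hsy
  have hax' := hN n hn x hx hxa hMx
  rw [abs_of_nonneg (by linarith : 0 ≤ y - x), abs_of_pos hba,
    abs_of_nonneg (by linarith : 0 ≤ a - x), abs_of_nonneg (by linarith : 0 ≤ y - b)] at key
  have hML : M ≤ L / θ := by rw [le_div_iff₀ hθ]; linarith
  have hMR : M ≤ R / θ := by rw [le_div_iff₀ hθ]; linarith
  have hnum : (R + M + L) * M ≤ (1 / θ ^ 2 + 2 / θ) * (L * R) := by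
    calc (R + M + L) * M = R * M + M * M + L * M := by ring
      _ ≤ R * (L / θ) + (L / θ) * (R / θ) + L * (R / θ) := by gcongr
      _ = _ := by field_simp; ring
  have h1 : (y - x) * (b - a) * (L * R) ≤
      (1 / θ ^ 2 + 2 / θ) * ((a - x) * (y - b)) * (L * R) := by
    calc (y - x) * (b - a) * (L * R) = (y - x) * (b - a) * L * R := by ring
      _ ≤ (R + M + L) * M * (a - x) * (y - b) := key
      _ = ((R + M + L) * M) * ((a - x) * (y - b)) := by ring
      _ ≤ ((1 / θ ^ 2 + 2 / θ) * (L * R)) * ((a - x) * (y - b)) := by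
        have : 0 ≤ (a - x) * (y - b) := mul_nonneg (by linarith) (by linarith)
        gcongr
      _ = _ := by ring
  have h2 := le_of_mul_le_mul_right h1 (mul_pos hL hR)
  have h3 : (b - a) ^ 2 ≤ (y - x) * (b - a) := by nlinarith
  have h4 : (1 / θ ^ 2 + 2 / θ) * ((a - x) * (y - b)) ≤ K * (a - x) := by
    rw [hK]
    have h5 : (a - x) * (y - b) ≤ (a - x) * 2 :=
      mul_le_mul_of_nonneg_left (by linarith [hy.2, haI.1]) (by linarith)
    have h6 : 0 ≤ 1 / θ ^ 2 + 2 / θ := by positivity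
    nlinarith
  have h5 : (b - a) ^ 2 ≤ K * δ := by
    have : K * (a - x) ≤ K * δ := by gcongr
    linarith
  have h6 : K * δ = (b - a) ^ 2 / 2 := by rw [hδ]; field_simp
  nlinarith

lemma exists_left_maximal {a₀ b : ℝ} (ha : a₀ ∈ phaseI) (hab : a₀ < b)
    (hom : ∀ n, MonoIter f n a₀ b) : ∃ a ∈ phaseI, a ≤ a₀ ∧ (∀ n, MonoIter f n a b) ∧
      ∀ x ∈ phaseI, x < a → ∃ n, ¬ MonoIter f n x b := by
  set Z : Set ℝ := {x | x ∈ phaseI ∧ x ≤ a₀ ∧ ∀ n, MonoIter f n x b} with hZ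
  have hZne : Z.Nonempty := ⟨a₀, ha, le_rfl, hom⟩
  have hZb : BddBelow Z := ⟨-1, fun x hx => hx.1.1⟩
  have hle : sInf Z ≤ a₀ := csInf_le hZb ⟨ha, le_rfl, hom⟩
  have hI : sInf Z ∈ phaseI := ⟨le_csInf hZne fun x hx => hx.1.1, hle.trans ha.2⟩
  refine ⟨sInf Z, hI, hle, fun n k hk z hz => ?_, fun x hx hxa => ?_⟩
  · rw [Set.uIoo_of_lt (hle.trans_lt hab)] at hz
    obtain ⟨x, hxZ, hxz⟩ := exists_lt_of_csInf_lt hZne hz.1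
    refine hxZ.2.2 n k hk z ?_
    rw [Set.uIoo_of_lt (hxz.trans hz.2)]
    exact ⟨hxz, hz.2⟩
  · by_contra hc
    push Not at hc
    exact absurd (csInf_le hZb ⟨hx, hxa.le.trans hle, hc⟩) (not_le.2 hxa)

end IsSUnimodal

/-- A positive sequence tending to zero has arbitrarily late strict record minima. -/
lemma exists_record_min {u : ℕ → ℝ} (hpos : ∀ n, 0 < u n) (hu : Tendsto u atTop (𝓝 0)) (N : ℕ) :
    ∃ n ≥ N, ∀ k < n, u n ≤ u k := by
  have hε : ∃ ε > 0, ∀ k ≤ N, ε ≤ u k := by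
    obtain ⟨k, _, hk⟩ := (Finset.range (N + 1)).exists_min_image u ⟨0, by simp⟩
    exact ⟨u k, hpos k, fun j hj => hk j (by simpa [Nat.lt_succ_iff] using hj)⟩
  obtain ⟨ε, hε0, hε⟩ := hε
  have hex : ∃ n, u n < ε := (hu.eventually (gt_mem_nhds hε0)).exists
  classical
  refine ⟨Nat.find hex, ?_, fun k hk => ?_⟩
  · by_contra hc
    exact absurd (Nat.find_spec hex) (not_lt.2 (hε _ (by omega)))
  · exact (Nat.find_spec hex).le.trans (not_lt.1 (Nat.find_min hex hk))

namespace IsSUnimodal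
variable {f : ℝ → ℝ}

/-- It suffices for a contradiction to bound the spaces on both sides separately. -/
lemma not_space_of_sides (hf : IsSUnimodal f) (hrep : AllPeriodicRepelling f) {a b θ : ℝ}
    (ha : a ∈ phaseI) (hb : b ∈ phaseI) (hab : a < b)
    (hom : ∀ n, MonoIter f n a b) (hmax : ∀ x ∈ phaseI, x < a → ∃ n, ¬ MonoIter f n x b)
    (hθ : 0 < θ)
    (hsp : ∀ N, ∃ n ≥ N, ∀ α β y : ℝ, ((α = a ∧ β = b) ∨ (α = b ∧ β = a)) → y ∈ phaseI →
      β ∈ Set.uIcc α y → MonoIter f n α y → (∃ i < n, f^[i] y = 0) →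
      θ * |f^[n] a - f^[n] b| ≤ |f^[n] y - f^[n] β|) : False := by
  obtain ⟨N1, h1⟩ := hf.exists_side hrep ha hb hab.ne hom
  obtain ⟨N2, h2⟩ := hf.exists_side hrep hb ha hab.ne' (fun n => (hom n).symm)
  refine hf.not_space hb hab hom hmax hθ fun N => ?_
  obtain ⟨n, hn, h⟩ := hsp (max N (max N1 N2))
  obtain ⟨y, hy, hby, hMy, hiy⟩ := h1 n (by omega)
  obtain ⟨x, hx, hax, hMx, hix⟩ := h2 n (by omega)
  refine ⟨n, by omega, x, hx, y, hy, ?_, ?_, hMx.symm, hMy, h b a x (Or.inr ⟨rfl, rfl⟩) hx hax hMx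
    hix, h a b y (Or.inl ⟨rfl, rfl⟩) hy hby hMy hiy⟩
  · rcases Set.mem_uIcc.1 hax with h3 | h3
    · linarith [h3.1]
    · exact h3.1
  · rcases Set.mem_uIcc.1 hby with h3 | h3
    · exact h3.2
    · linarith [h3.2]

/-- The critical point is not an end point of an interval on which all iterates are monotone. -/
lemma exists_not_monoIter_zero (hf : IsSUnimodal f) (hrep : AllPeriodicRepelling f) {s : ℝ}
    (hs : s ∈ phaseI) (hs0 : s ≠ 0) : ∃ m, ¬ MonoIter f m 0 s := by
  by_contra hc
  push Not at hc
  have hlt : f s < f 0 := by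
    refine lt_of_le_of_ne (hf.apply_le_zero hs) fun h => hs0 ?_
    obtain ⟨S, hS, hsS, h0S⟩ := exists_isLap hs
    exact (hf.strictOn_lap hS).injOn hsS h0S h
  have hom₀ : ∀ n, MonoIter f n (f s) (f 0) := fun n =>
    ((hf.monoIter_add_iff zero_mem hs (n := 1) (m := n)).1 (hc _)).2.symm
  obtain ⟨a, ha, has, hom, hmax⟩ := exists_left_maximal (hf.mapsTo hs) hlt hom₀
  have hb := hf.mapsTo zero_mem
  have hab : a < f 0 := has.trans_lt hlt
  refine hf.not_space_of_sides hrep ha hb hab hom hmax one_pos fun N => ?_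
  obtain ⟨n, hn, hmin⟩ := exists_record_min
    (fun n => abs_pos.2 (sub_ne_zero.2 (hf.iterate_ne ha hb hab.ne (hom n))))
    (hf.tendsto_length hrep ha hb hab.ne hom) N
  refine ⟨n, hn, ?_⟩
  -- The interval `(a, f 0)` ends at the maximum of `f`, so iterates disjoint from it can only lie
  -- on its left.
  have hleft : ∀ i, f^[i + 1] a ≤ a ∧ f^[i + 1] (f 0) ≤ a := by
    intro i
    have hd := hf.disjoint_iterates hrep ha hb hab.ne hom (n := 0) (m := i + 1) (by omega)
    rw [hf.image_uIoo ha hb (hom _), hf.image_uIoo ha hb (hom _)] at hd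
    have hne := hf.iterate_ne ha hb hab.ne (hom (i + 1))
    have h1 : f^[i + 1] a ≤ f 0 := by
      rw [Function.iterate_succ_apply']; exact hf.apply_le_zero (hf.iterate_mem i ha)
    have h2 : f^[i + 1] (f 0) ≤ f 0 := by
      rw [Function.iterate_succ_apply']; exact hf.apply_le_zero (hf.iterate_mem i hb)
    by_contra hcon
    have h3 : a < max (f^[i + 1] a) (f^[i + 1] (f 0)) := by
      by_contra h
      exact hcon ⟨(le_max_left _ _).trans (not_lt.1 h), (le_max_right _ _).trans (not_lt.1 h)⟩
    obtain ⟨z, hz1, hz2⟩ := exists_between (max_lt h3 (min_lt_max.2 hne))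
    have h4 : z ∈ Set.uIoo (f^[0] a) (f^[0] (f 0)) := by
      rw [Function.iterate_zero_apply, Function.iterate_zero_apply, Set.uIoo_of_lt hab]
      exact ⟨(le_max_left _ _).trans_lt hz1, hz2.trans_le (max_le h1 h2)⟩
    have h5 : z ∈ Set.uIoo (f^[i + 1] a) (f^[i + 1] (f 0)) :=
      ⟨(le_max_right _ _).trans_lt hz1, hz2⟩
    exact Set.disjoint_left.1 hd h4 h5
  rintro α β y hαβ hy hβy hM ⟨i, hi, hiy⟩
  have hα : α ∈ phaseI := by rcases hαβ with ⟨rfl, rfl⟩ | ⟨rfl, rfl⟩ <;> assumption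
  have hne : α ≠ β := by
    rcases hαβ with ⟨rfl, rfl⟩ | ⟨rfl, rfl⟩
    exacts [hab.ne, hab.ne']
  have hβa : f (f^[i] β) ≤ a := by
    rw [← Function.iterate_succ_apply' f]
    rcases hαβ with ⟨_, rfl⟩ | ⟨_, rfl⟩
    exacts [(hleft i).2, (hleft i).1]
  obtain ⟨hd, he0, hMe, hFe, hFd, hF0, hbn⟩ := hf.side_data hα hy hne hβy hM hi hiy
  have heI := hf.iterate_mem i hα
  obtain ⟨T, hT, heT, h0T⟩ := exists_isLap heI
  have hdT := hT.uIcc_subset h0T heT hd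
  -- The segment `[0, t]` is folded onto the closure of `J = (a, f 0)`. The gap next to `f^[n] J`
  -- therefore contains a copy of `f^[n - i - 1] J`, which is no shorter because `n` is a record
  -- minimum of the lengths.
  obtain ⟨t, ht, hft⟩ := hf.exists_lap_preimage hT (show a ∈ Set.Icc (-1) (f 0) from ⟨ha.1, hab.le⟩)
  have htd : t ∈ Set.uIcc 0 (f^[i] β) := hf.mem_uIcc_of_lap hT ht hdT (by rw [hft]; exact hβa)
  have h1 := (hf.strictOn_iterate zero_mem (hT.subset hdT)
    (hMe.sub Set.left_mem_uIcc hd)).mem_uIcc htd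
  have h2 := abs_sub_eq_of_mem_uIcc h1
  rw [hFd, hF0] at h2
  obtain ⟨j, hj⟩ : ∃ j, n - i = j + 1 := ⟨n - i - 1, by omega⟩
  have h3 : |f^[n - i] t - f^[n] y| = |f^[j] a - f^[j] (f 0)| := by
    rw [← hF0, hj, Function.iterate_succ_apply, Function.iterate_succ_apply, hft]
  rw [h3, abs_sub_comm (f^[n] β)] at h2
  rw [one_mul, h2]
  have := hmin j (by omega)
  linarith [abs_nonneg (f^[n] β - f^[n - i] t)]

/-- If all other images lie to the left of the one of `f^[q] J`, the iterates of `J` avoid a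
neighbourhood of the critical point, and there is space around them. -/
lemma not_eventually_away (hf : IsSUnimodal f) (hrep : AllPeriodicRepelling f) {a b : ℝ}
    (ha : a ∈ phaseI) (hb : b ∈ phaseI) (hab : a < b)
    (hom : ∀ n, MonoIter f n a b) (hmax : ∀ x ∈ phaseI, x < a → ∃ n, ¬ MonoIter f n x b)
    {q : ℕ} (hq : ∀ k, k ≠ q → ImageLeft f a b k q) : False := by
  obtain ⟨w, hw, hw0, hfw⟩ : ∃ w ∈ phaseI, w ≠ 0 ∧ f w = min (f^[q + 1] a) (f^[q + 1] b) := by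
    have hlt := min_lt_max.2 (hf.iterate_ne ha hb hab.ne (hom (q + 1)))
    have hle : max (f^[q + 1] a) (f^[q + 1] b) ≤ f 0 := by
      rw [Function.iterate_succ_apply', Function.iterate_succ_apply']
      exact max_le (hf.apply_le_zero (hf.iterate_mem q ha)) (hf.apply_le_zero (hf.iterate_mem q hb))
    have hne : ∀ w, f w = min (f^[q + 1] a) (f^[q + 1] b) → w ≠ 0 := by
      rintro w hw rfl
      linarith
    rcases min_choice (f^[q + 1] a) (f^[q + 1] b) with h | h
    · have : f (f^[q] a) = min (f^[q + 1] a) (f^[q + 1] b) := by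
        rw [h, Function.iterate_succ_apply']
      exact ⟨_, hf.iterate_mem q ha, hne _ this, this⟩
    · have : f (f^[q] b) = min (f^[q + 1] a) (f^[q + 1] b) := by
        rw [h, Function.iterate_succ_apply']
      exact ⟨_, hf.iterate_mem q hb, hne _ this, this⟩
  obtain ⟨m₀, hm₀⟩ := hf.exists_not_monoIter_zero hrep hw hw0
  -- Only finitely many iterates are monotone on `[0, w]`, so their images of it have length bounded
  -- below.
  obtain ⟨η, hη, hηle⟩ : ∃ η > 0, ∀ m < m₀, MonoIter f m 0 w → η ≤ |f^[m] w - f^[m] 0| := by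
    clear hm₀
    induction m₀ with
    | zero => exact ⟨1, one_pos, fun m hm => by omega⟩
    | succ k ih =>
      obtain ⟨η, hη, h⟩ := ih
      by_cases hk : MonoIter f k 0 w
      · have hpos : 0 < |f^[k] w - f^[k] 0| :=
          abs_pos.2 (sub_ne_zero.2 (hf.iterate_ne zero_mem hw hw0.symm hk).symm)
        refine ⟨min η |f^[k] w - f^[k] 0|, lt_min hη hpos, fun m hm hM => ?_⟩
        rcases Nat.lt_succ_iff_lt_or_eq.1 hm with h1 | rfl
        · exact (min_le_left _ _).trans (h m h1 hM)
        · exact min_le_right _ _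
      · refine ⟨η, hη, fun m hm hM => ?_⟩
        rcases Nat.lt_succ_iff_lt_or_eq.1 hm with h1 | rfl
        · exact h m h1 hM
        · exact absurd hM hk
  refine hf.not_space_of_sides hrep ha hb hab hom hmax one_pos fun N => ?_
  obtain ⟨n, hlen, hn⟩ := (((hf.tendsto_length hrep ha hb hab.ne hom).eventually
    (gt_mem_nhds (half_pos hη))).and (eventually_ge_atTop N)).exists
  refine ⟨n, hn, ?_⟩
  rintro α β y hαβ hy hβy hM ⟨i, hi, hiy⟩
  have hα : α ∈ phaseI := by rcases hαβ with ⟨rfl, rfl⟩ | ⟨rfl, rfl⟩ <;> assumption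
  have hne : α ≠ β := by
    rcases hαβ with ⟨rfl, rfl⟩ | ⟨rfl, rfl⟩
    exacts [hab.ne, hab.ne']
  obtain ⟨hd, he0, hMe, hFe, hFd, hF0, hbn⟩ := hf.side_data hα hy hne hβy hM hi hiy
  have heI := hf.iterate_mem i hα
  have hew : f (f^[i] α) ≤ f w := by
    by_cases hiq : i = q
    · subst hiq
      have h1 : f (f^[i] α) ≤ f (f^[i] β) := by
        have := hf.min_le_of_mem_uIcc zero_mem heI hd
        rwa [min_eq_right (hf.apply_le_zero heI)] at this
      rw [hfw, Function.iterate_succ_apply', Function.iterate_succ_apply']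
      rcases hαβ with ⟨rfl, rfl⟩ | ⟨rfl, rfl⟩
      · rw [min_eq_left h1]
      · rw [min_eq_right h1]
    · have := hq i hiq
      rw [hfw, ← Function.iterate_succ_apply' f i]
      refine le_trans ?_ this
      rcases hαβ with ⟨rfl, rfl⟩ | ⟨rfl, rfl⟩
      exacts [le_max_left _ _, le_max_right _ _]
  obtain ⟨T, hT, heT, h0T⟩ := exists_isLap heI
  obtain ⟨t, ht, hft⟩ := hf.exists_lap_preimage hT (hf.apply_mem_range hw)
  have hte : t ∈ Set.uIcc 0 (f^[i] α) := hf.mem_uIcc_of_lap hT ht heT (by rw [hft]; exact hew)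
  have hMw : MonoIter f (n - i) 0 w :=
    hf.monoIter_congr (hT.subset ht) hw hft (hMe.sub Set.left_mem_uIcc hte)
  -- The iterate `f^[n - i]` is monotone on a copy of `[0, w]`, so the image of the extension has
  -- length at least `η`, while `f^[n] J` is shorter than `η / 2`.
  have hlt : n - i < m₀ := by
    by_contra hcon
    exact hm₀ (hMw.le (not_lt.1 hcon))
  have h1 := hηle _ hlt hMw
  have h2 := abs_sub_eq_of_mem_uIcc ((hf.strictOn_iterate zero_mem heI hMe).mem_uIcc hte)
  rw [← iterate_congr (by omega) hft, hF0] at h1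
  rw [hF0, hFe] at h2
  have h3 := abs_sub_eq_of_mem_uIcc hbn
  have h4 : |f^[n] b - f^[n] a| = |f^[n] β - f^[n] α| := by
    rcases hαβ with ⟨rfl, rfl⟩ | ⟨rfl, rfl⟩
    exacts [rfl, abs_sub_comm _ _]
  rw [abs_sub_comm] at hlen
  rw [one_mul, abs_sub_comm (f^[n] a), h4]
  rw [h4] at hlen
  rw [abs_sub_comm (f^[n] y) (f^[n] α)] at h3
  linarith [abs_nonneg (f^[n] α - f^[n - i] t)]

/-- Along consecutive closest returns there is space on both sides. -/
lemma exists_space_of_returns (hf : IsSUnimodal f) (hrep : AllPeriodicRepelling f) {a b C : ℝ}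
    (hC : FoldConst f C) (ha : a ∈ phaseI) (hb : b ∈ phaseI) (hab : a < b)
    (hom : ∀ n, MonoIter f n a b) {r : ℕ → ℕ} (hr : StrictMono r)
    (hrr : ∀ j, ImageLeft f a b (r j) (r (j + 1)))
    (hrk : ∀ j, ∀ k < r (j + 1), k ≠ r j → ImageLeft f a b k (r j)) (N : ℕ) :
    ∃ n ≥ N, ∀ α β y : ℝ, ((α = a ∧ β = b) ∨ (α = b ∧ β = a)) → y ∈ phaseI →
      β ∈ Set.uIcc α y → MonoIter f n α y → (∃ i < n, f^[i] y = 0) →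
      1 / (4 * C * (C * (1 + C) ^ 2)) * |f^[n] a - f^[n] b| ≤ |f^[n] y - f^[n] β| := by
  have hC1 := hC.one_le
  set K : ℝ := C * (1 + C) ^ 2 with hK
  have hK1 : 1 ≤ K := by nlinarith
  set θ : ℝ := 1 / (4 * C * K) with hθ
  have hθ0 : 0 < θ := by positivity
  have hθK : 4 * C * K * θ = 1 := by rw [hθ]; field_simp
  set ℓ : ℕ → ℝ := fun j => |f^[r j] a - f^[r j] b| with hℓ
  have hpos : ∀ j, 0 < ℓ j := fun j =>
    abs_pos.2 (sub_ne_zero.2 (hf.iterate_ne ha hb hab.ne (hom _)))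
  have hlim : Tendsto ℓ atTop (𝓝 0) :=
    (hf.tendsto_length hrep ha hb hab.ne hom).comp hr.tendsto_atTop
  have hsp : ∀ j, ∀ α β y : ℝ, ((α = a ∧ β = b) ∨ (α = b ∧ β = a)) → y ∈ phaseI →
      β ∈ Set.uIcc α y → MonoIter f (r (j + 1)) α y → (∃ i < r (j + 1), f^[i] y = 0) →
      ℓ j ≤ K * |f^[r (j + 1)] y - f^[r (j + 1)] β| ∨
      (|f^[r (j + 1)] β| ≤ |f^[r (j + 1)] y - f^[r (j + 1)] β| ∧
        ℓ j ≤ K * (ℓ (j + 1) + |f^[r (j + 1)] y - f^[r (j + 1)] β|)) := by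
    rintro j α β y hαβ hy hβy hM ⟨i, hi, hiy⟩
    rcases hαβ with ⟨rfl, rfl⟩ | ⟨rfl, rfl⟩
    · exact hf.space_of_closest_return hrep hC ha hb hy hab.ne hom hβy hM hi hiy (hrr j) (hrk j)
    · have := hf.space_of_closest_return hrep hC hb ha hy hab.ne' (fun n => (hom n).symm) hβy hM hi
        hiy (hrr j).symm (fun k hk hkq => (hrk j k hk hkq).symm)
      rwa [abs_sub_comm (f^[r j] α), abs_sub_comm (f^[r (j + 1)] α) (f^[r (j + 1)] β)] at this
  -- Lengths tending to `0` cannot increase forever. At such a `j`, either the return `r (j + 1)`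
  -- has enough space, or the next one does.
  obtain ⟨j, hjN, hj⟩ : ∃ j ≥ N, ℓ (j + 1) ≤ ℓ j := by
    by_contra hcon
    push Not at hcon
    have hge : ∀ i, ℓ N ≤ ℓ (N + i) := by
      intro i
      induction i with
      | zero => exact le_rfl
      | succ i ih => exact ih.trans (hcon (N + i) (by omega)).le
    obtain ⟨i, hi1, hi2⟩ := ((hlim.eventually (gt_mem_nhds (hpos N))).and
      (eventually_ge_atTop N)).exists
    obtain ⟨d, rfl⟩ := Nat.exists_eq_add_of_le hi2
    linarith [hge d]
  have hrj : ∀ i, i ≤ r i := fun i => hr.le_apply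
  by_cases hgood : ∀ α β y : ℝ, ((α = a ∧ β = b) ∨ (α = b ∧ β = a)) → y ∈ phaseI →
      β ∈ Set.uIcc α y → MonoIter f (r (j + 1)) α y → (∃ i < r (j + 1), f^[i] y = 0) →
      θ * ℓ (j + 1) ≤ |f^[r (j + 1)] y - f^[r (j + 1)] β|
  · exact ⟨r (j + 1), by have := hrj (j + 1); omega, hgood⟩
  push Not at hgood
  obtain ⟨α, β, y, hαβ, hy, hβy, hM, hi, hlt⟩ := hgood
  set s := |f^[r (j + 1)] y - f^[r (j + 1)] β| with hs
  have hβs : |f^[r (j + 1)] β| ≤ s := by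
    rcases hsp j α β y hαβ hy hβy hM hi with h | h
    · exfalso
      have h1 : K * s < K * (θ * ℓ (j + 1)) := by gcongr
      have h2 : 4 * C * (K * (θ * ℓ (j + 1))) = ℓ (j + 1) := by
        calc _ = (4 * C * K * θ) * ℓ (j + 1) := by ring
          _ = _ := by rw [hθK, one_mul]
      have h3 : 0 < K * (θ * ℓ (j + 1)) := by have := hpos (j + 1); positivity
      nlinarith
    · exact h.1
  -- Lack of space puts `f^[r (j + 1)] β` within `s` of the critical point; the next closest return
  -- lies within `C * s`. It is then so short compared with `ℓ (j + 1)` that either alternative for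
  -- it gives ample space.
  have hsmall : ℓ (j + 2) ≤ 2 * C * s := by
    have hI := hrr (j + 1)
    have hβI : β ∈ phaseI := by rcases hαβ with ⟨rfl, rfl⟩ | ⟨rfl, rfl⟩ <;> assumption
    have hfβ : f (f^[r (j + 1)] β) ≤ max (f^[r (j + 1) + 1] a) (f^[r (j + 1) + 1] b) := by
      rw [← Function.iterate_succ_apply' f]
      rcases hαβ with ⟨rfl, rfl⟩ | ⟨rfl, rfl⟩
      exacts [le_max_right _ _, le_max_left _ _]
    have h1 : f (f^[r (j + 1)] β) ≤ f (f^[r (j + 2)] a) := by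
      rw [← Function.iterate_succ_apply' f _ a]
      exact hfβ.trans (le_trans hI (min_le_left _ _))
    have h2 : f (f^[r (j + 1)] β) ≤ f (f^[r (j + 2)] b) := by
      rw [← Function.iterate_succ_apply' f _ b]
      exact hfβ.trans (le_trans hI (min_le_right _ _))
    have h3 := hC.abs_le _ (hf.iterate_mem _ ha) _ (hf.iterate_mem _ hβI) h1
    have h4 := hC.abs_le _ (hf.iterate_mem _ hb) _ (hf.iterate_mem _ hβI) h2
    have h5 : ℓ (j + 2) ≤ |f^[r (j + 2)] a| + |f^[r (j + 2)] b| := abs_sub _ _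
    have h6 : C * |f^[r (j + 1)] β| ≤ C * s := by gcongr
    linarith
  refine ⟨r (j + 2), by have := hrj (j + 2); omega, ?_⟩
  intro α' β' y' hαβ' hy' hβy' hM' hi'
  have key := hsp (j + 1) α' β' y' hαβ' hy' hβy' hM' hi'
  change θ * ℓ (j + 2) ≤ |f^[r (j + 2)] y' - f^[r (j + 2)] β'|
  rw [show j + 1 + 1 = j + 2 from rfl] at key
  set s' := |f^[r (j + 2)] y' - f^[r (j + 2)] β'| with hs'
  have h2 : ℓ (j + 2) ≤ 2 * C * (θ * ℓ (j + 1)) := hsmall.trans (by gcongr)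
  have h3 : K * ℓ (j + 2) ≤ ℓ (j + 1) / 2 := by
    calc K * ℓ (j + 2) ≤ K * (2 * C * (θ * ℓ (j + 1))) := by gcongr
      _ = (4 * C * K * θ) * ℓ (j + 1) / 2 := by ring
      _ = _ := by rw [hθK, one_mul]
  have h1 : ℓ (j + 1) ≤ 2 * (K * s') := by
    have : 0 ≤ K * s' := by positivity
    rcases key with h | ⟨_, h⟩
    · linarith
    · rw [mul_add] at h
      linarith
  have h4 : K * ℓ (j + 2) ≤ K * s' := by linarith
  have h5 : ℓ (j + 2) ≤ s' := le_of_mul_le_mul_left h4 (by linarith)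
  have h6 : θ ≤ 1 := by
    rw [hθ, div_le_one (by positivity)]
    nlinarith
  have h7 := hpos (j + 2)
  nlinarith

/-- There are no intervals on which all iterates are monotone: preimages of the critical point are
dense. -/
lemma exists_preimage (hf : IsSUnimodal f) (hrep : AllPeriodicRepelling f) {a₀ b : ℝ}
    (ha₀ : a₀ ∈ phaseI) (hb : b ∈ phaseI) (hab₀ : a₀ < b) :
    ∃ z ∈ Set.Ioo a₀ b, ∃ n, f^[n] z = 0 := by
  by_contra hcon
  push Not at hcon
  have hom₀ : ∀ n, MonoIter f n a₀ b := fun n k _ z hz => by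
    rw [Set.uIoo_of_lt hab₀] at hz
    exact hcon z hz k
  obtain ⟨a, ha, haa, hom, hmax⟩ := exists_left_maximal ha₀ hab₀ hom₀
  have hab : a < b := haa.trans_lt hab₀
  obtain ⟨C, hC⟩ := hf.exists_foldConst
  have hor : ∀ {k q : ℕ}, k ≠ q → ImageLeft f a b k q ∨ ImageLeft f a b q k := fun h =>
    hf.imageLeft_or hrep ha hb hab.ne hom h
  -- between consecutive records all images lie to the left of the last record
  have hbetween : ∀ q, (∀ k < q, ImageLeft f a b k q) → ∀ n,
      (∀ k, q < k → k < n → ¬ ∀ i < k, ImageLeft f a b i k) → ∀ k < n, k ≠ q →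
      ImageLeft f a b k q := by
    intro q hq n hn k
    induction k using Nat.strong_induction_on with
    | _ k ih =>
      intro hkn hkq
      rcases lt_or_gt_of_ne hkq with h | h
      · exact hq k h
      · by_contra hc
        have hqk := (hor hkq).resolve_left hc
        refine hn k h hkn fun i hi => ?_
        by_cases hiq : i = q
        · rwa [hiq]
        · exact (ih i hi (by omega) hiq).trans hqk
  -- A record is a time whose image lies to the right of all earlier ones. Infinitely many records
  -- give consecutive closest returns; a last record `q` leaves every other image to its left.
  by_cases hinf : ∀ q, (∀ k < q, ImageLeft f a b k q) →
      ∃ n > q, ∀ k < n, ImageLeft f a b k n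
  · have hnext : ∀ q : {q : ℕ // ∀ k < q, ImageLeft f a b k q},
        ∃ n : {q : ℕ // ∀ k < q, ImageLeft f a b k q}, q.1 < n.1 ∧
          ∀ k, q.1 < k → k < n.1 → ¬ ∀ i < k, ImageLeft f a b i k := by
      classical
      rintro ⟨q, hq⟩
      have hex := hinf q hq
      refine ⟨⟨Nat.find hex, (Nat.find_spec hex).2⟩, (Nat.find_spec hex).1, fun k hqk hk h => ?_⟩
      exact Nat.find_min hex hk ⟨hqk, h⟩
    choose g hg1 hg2 using hnext
    set R : ℕ → {q : ℕ // ∀ k < q, ImageLeft f a b k q} := fun j =>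
      g^[j] ⟨0, fun k hk => by omega⟩ with hR
    have hRs : ∀ j, R (j + 1) = g (R j) := fun j => Function.iterate_succ_apply' g j _
    have hr : StrictMono fun j => (R j).1 := strictMono_nat_of_lt_succ fun j => by
      rw [hRs]; exact hg1 _
    have hrr : ∀ j, ImageLeft f a b (R j).1 (R (j + 1)).1 := fun j =>
      (R (j + 1)).2 _ (hr (Nat.lt_succ_self j))
    refine hf.not_space_of_sides hrep ha hb hab hom hmax (θ := 1 / (4 * C * (C * (1 + C) ^ 2))) ?_
      fun N => hf.exists_space_of_returns hrep hC ha hb hab hom hr hrr (fun j => ?_) N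
    · have := hC.one_le
      positivity
    · refine hbetween _ (R j).2 _ ?_
      simp only [hRs]
      exact hg2 _
  · push Not at hinf
    obtain ⟨q, hq, hlast⟩ := hinf
    refine hf.not_eventually_away hrep ha hb hab hom hmax (q := q) fun k hkq => ?_
    refine hbetween q hq (k + 1) (fun i hi _ h => ?_) k (Nat.lt_succ_self k) hkq
    obtain ⟨j, hj, hj'⟩ := hlast i hi
    exact hj' (h j hj)

end IsSUnimodal

/-! ### Cantor sets in uncountable Borel sets, and a divergence criterion -/

lemma isCantorSet_range {F : (ℕ → Bool) → ℝ} (hF : Continuous F) (hFi : Function.Injective F) :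
    IsCantorSet (Set.range F) :=
  ⟨(hF.isClosedEmbedding hFi).isEmbedding.toHomeomorph.symm⟩

/-- An uncountable Borel subset of the line contains a Cantor set. -/
lemma exists_cantorSet_of_not_countable {G : Set ℝ} (hG : MeasurableSet G) (hc : ¬ G.Countable) :
    ∃ K ⊆ G, IsCantorSet K := by
  -- In a finer Polish topology `G` is closed and the perfect set theorem applies; the embedding
  -- obtained remains continuous for the usual topology.
  obtain ⟨t, ht, hpol, hcl, _⟩ := hG.isClopenable
  obtain ⟨F, hFr, hFc, hFi⟩ :=
    @IsClosed.exists_nat_bool_injection_of_not_countable ℝ t hpol G hcl hc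
  exact ⟨Set.range F, hFr, isCantorSet_range
    (@continuous_le_rng _ _ F _ t UniformSpace.toTopologicalSpace ht hFc) hFi⟩

lemma not_tendsto_alphaCandPartial {f : ℝ → ℝ} {v : ℝ → ℂ} {x : ℝ}
    (h : ∀ N, ∃ n ≥ N, 1 < ‖v (f^[n] x) / ((derivI 1 (f^[n + 1]) x : ℝ) : ℂ)‖) :
    ¬ ∃ l : ℂ, Tendsto (alphaCandPartial f v x) atTop (𝓝 l) := by
  rintro ⟨l, hl⟩
  have h1 := (hl.comp (tendsto_add_atTop_nat 1)).sub hl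
  rw [sub_self] at h1
  have h2 := h1.norm
  rw [norm_zero] at h2
  obtain ⟨N, hN⟩ := eventually_atTop.1 (h2.eventually (gt_mem_nhds one_pos))
  obtain ⟨n, hn, hlt⟩ := h N
  have h3 := hN n hn
  have e : alphaCandPartial f v x (n + 1) - alphaCandPartial f v x n =
      -(v (f^[n] x) / ((derivI 1 (f^[n + 1]) x : ℝ) : ℂ)) := by
    unfold alphaCandPartial
    rw [Finset.sum_range_succ]
    ring
  simp only [Function.comp_apply] at h3
  rw [e, norm_neg] at h3
  linarith

/-! ### Large terms near preimages of the critical point, and the Baire argument -/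

namespace IsSUnimodal
variable {f : ℝ → ℝ}

lemma phaseI_mem_nhds {x : ℝ} (hx : x ∈ Set.Ioo (-1 : ℝ) 1) : phaseI ∈ 𝓝 x :=
  Icc_mem_nhds hx.1 hx.2

lemma continuousAt_iterate (hf : IsSUnimodal f) (n : ℕ) {x : ℝ} (hx : x ∈ Set.Ioo (-1 : ℝ) 1) :
    ContinuousAt (f^[n]) x := (hf.continuousOn_iterate n).continuousAt (phaseI_mem_nhds hx)

lemma continuousAt_derivI_iterate (hf : IsSUnimodal f) (n : ℕ) {x : ℝ}
    (hx : x ∈ Set.Ioo (-1 : ℝ) 1) : ContinuousAt (derivI 1 (f^[n])) x :=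
  ((hf.contDiffOn_iterate n).continuousOn_iteratedDerivWithin (by norm_num)
    uniqueDiffOn).continuousAt (phaseI_mem_nhds hx)

lemma continuousAt_comp_iterate (hf : IsSUnimodal f) {v : ℝ → ℂ} (hv : ContinuousOn v phaseI)
    (n : ℕ) {x : ℝ} (hx : x ∈ Set.Ioo (-1 : ℝ) 1) : ContinuousAt (fun y => v (f^[n] y)) x :=
  (hv.comp (hf.continuousOn_iterate n) fun _ hy => hf.iterate_mem n hy).continuousAt
    (phaseI_mem_nhds hx)

/-- The points whose orbit avoids the critical point up to a time `n ≥ N` at which the term of the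
series is large. -/
def largeTermSet (f : ℝ → ℝ) (v : ℝ → ℂ) (N : ℕ) : Set ℝ :=
  {x | x ∈ Set.Ioo (-1 : ℝ) 1 ∧ ∃ n ≥ N, (∀ k ≤ n, f^[k] x ≠ 0) ∧
    1 < ‖v (f^[n] x) / ((derivI 1 (f^[n + 1]) x : ℝ) : ℂ)‖}

/-- For a fixed `n` membership involves finitely many iterates, and the term is continuous where its
denominator is nonzero. This is why avoidance of `0` is required only up to time `n`. -/
lemma isOpen_largeTermSet (hf : IsSUnimodal f) {v : ℝ → ℂ} (hv : ContinuousOn v phaseI) (N : ℕ) :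
    IsOpen (largeTermSet f v N) := by
  rw [isOpen_iff_mem_nhds]
  rintro x ⟨hx, n, hn, h0, hlt⟩
  have hD : derivI 1 (f^[n + 1]) x ≠ 0 :=
    hf.derivI_iterate_ne_zero (n + 1) (Set.Ioo_subset_Icc_self hx) fun k hk => h0 k (by omega)
  have hc : ContinuousAt (fun y => ‖v (f^[n] y) / ((derivI 1 (f^[n + 1]) y : ℝ) : ℂ)‖) x :=
    ((hf.continuousAt_comp_iterate hv n hx).div
      (Complex.continuous_ofReal.continuousAt.comp (hf.continuousAt_derivI_iterate (n + 1) hx))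
      (by simpa using hD)).norm
  have h1 : ∀ᶠ y in 𝓝 x, ∀ k ∈ Finset.range (n + 1), f^[k] y ≠ 0 := by
    rw [Finset.eventually_all]
    intro k hk
    exact (hf.continuousAt_iterate k hx).eventually_ne (h0 k (by simpa [Nat.lt_succ_iff] using hk))
  filter_upwards [Ioo_mem_nhds hx.1 hx.2, h1, hc.eventually (lt_mem_nhds hlt)] with y hy hy1 hy2
  exact ⟨hy, n, hn, fun k hk => hy1 k (by simpa [Nat.lt_succ_iff] using hk), hy2⟩

/-- Every interval contains a smaller one on which a given iterate is monotone. -/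
lemma exists_monoIter_subinterval (hf : IsSUnimodal f) (N : ℕ) {p q : ℝ} (hp : p ∈ phaseI)
    (hq : q ∈ phaseI) (hpq : p < q) :
    ∃ p' ∈ phaseI, ∃ q' ∈ phaseI, p' < q' ∧ p ≤ p' ∧ q' ≤ q ∧ MonoIter f N p' q' := by
  induction N with
  | zero => exact ⟨p, hp, q, hq, hpq, le_rfl, le_rfl, fun k hk => by omega⟩
  | succ N ih =>
    obtain ⟨a, ha, b, hb, hab, hpa, hbq, hM⟩ := ih
    have hs := hf.strictOn_iterate ha hb hM
    by_cases hz : ∃ z ∈ Set.Ioo a b, f^[N] z = 0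
    · obtain ⟨z, hz, hz0⟩ := hz
      have hzI : z ∈ phaseI := ⟨ha.1.trans hz.1.le, hz.2.le.trans hb.2⟩
      refine ⟨a, ha, z, hzI, hz.1, hpa, hz.2.le.trans hbq, fun k hk w hw hw0 => ?_⟩
      rw [Set.uIoo_of_lt hz.1] at hw
      rcases Nat.lt_succ_iff_lt_or_eq.1 hk with h | rfl
      · exact hM k h w (by rw [Set.uIoo_of_lt hab]; exact ⟨hw.1, hw.2.trans hz.2⟩) hw0
      · refine hw.2.ne (hs.injOn ?_ ?_ (hw0.trans hz0.symm))
        · exact Set.mem_uIcc.2 (Or.inl ⟨hw.1.le, (hw.2.trans hz.2).le⟩)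
        · exact Set.mem_uIcc.2 (Or.inl ⟨hz.1.le, hz.2.le⟩)
    · push Not at hz
      refine ⟨a, ha, b, hb, hab, hpa, hbq, fun k hk w hw hw0 => ?_⟩
      rcases Nat.lt_succ_iff_lt_or_eq.1 hk with h | rfl
      · exact hM k h w hw hw0
      · rw [Set.uIoo_of_lt hab] at hw
        exact hz w hw hw0

/-- Shrinking first to an interval where `f^[N]` is monotone forces its preimages of `0` to have
hitting time at least `N`. Near such a `z` the denominator of the term `n + i` tends to `0` and its
numerator does not. -/
lemma exists_mem_largeTermSet (hf : IsSUnimodal f) (hrep : AllPeriodicRepelling f) {v : ℝ → ℂ}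
    (hv : ContinuousOn v phaseI) (hv0 : ∃ i₀ : ℕ, v (f^[i₀] 0) ≠ 0) (N : ℕ) {p q : ℝ}
    (hp : p ∈ phaseI) (hq : q ∈ phaseI) (hpq : p < q) :
    ∃ x ∈ Set.Ioo p q, x ∈ largeTermSet f v N := by
  obtain ⟨i, hvi⟩ := hv0
  obtain ⟨p', hp', q', hq', hpq', hpp, hqq, hM⟩ := hf.exists_monoIter_subinterval N hp hq hpq
  obtain ⟨z, hz, hex⟩ := hf.exists_preimage hrep hp' hq' hpq'
  classical
  set n := Nat.find hex with hn
  have hnz : f^[n] z = 0 := Nat.find_spec hex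
  have hmin : ∀ k < n, f^[k] z ≠ 0 := fun k hk => Nat.find_min hex hk
  have hNn : N ≤ n := by
    by_contra hc
    exact hM n (by omega) z (by rwa [Set.uIoo_of_lt hpq']) hnz
  have hzI : z ∈ Set.Ioo (-1 : ℝ) 1 := ⟨hp'.1.trans_lt hz.1, hz.2.trans_le hq'.2⟩
  have hzI' := Set.Ioo_subset_Icc_self hzI
  have hD : derivI 1 (f^[n]) z ≠ 0 := hf.derivI_iterate_ne_zero n hzI' hmin
  have hD0 : derivI 1 (f^[n + i + 1]) z = 0 := by
    rw [show n + i + 1 = (i + 1) + n by omega, hf.derivI_iterate_add (i + 1) n hzI', hnz,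
      hf.derivI_iterate_succ i zero_mem, hf.derivI_zero]
    ring
  have hvz : v (f^[n + i] z) = v (f^[i] 0) := by
    rw [add_comm, Function.iterate_add_apply, hnz]
  have hpos : 0 < ‖v (f^[i] 0)‖ / 2 := half_pos (norm_pos_iff.2 hvi)
  have e1 : ∀ᶠ x in 𝓝 z, ‖v (f^[i] 0)‖ / 2 < ‖v (f^[n + i] x)‖ := by
    refine (hf.continuousAt_comp_iterate hv (n + i) hzI).norm.eventually (lt_mem_nhds ?_)
    show ‖v (f^[i] 0)‖ / 2 < ‖v (f^[n + i] z)‖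
    rw [hvz]
    linarith
  have e2 : ∀ᶠ x in 𝓝 z, |derivI 1 (f^[n + i + 1]) x| < ‖v (f^[i] 0)‖ / 2 := by
    refine (hf.continuousAt_derivI_iterate (n + i + 1) hzI).abs.eventually (gt_mem_nhds ?_)
    show |derivI 1 (f^[n + i + 1]) z| < ‖v (f^[i] 0)‖ / 2
    rwa [hD0, abs_zero]
  -- At time `n` the zero at `z` is isolated since `(f^[n])'(z) ≠ 0`; at the other times `f^[k] z ≠
  -- 0`, because `n` is the first hitting time and `0` is not periodic.
  have e3 : ∀ᶠ x in 𝓝[≠] z, ∀ k ∈ Finset.range (n + i + 1), f^[k] x ≠ 0 := by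
    rw [Finset.eventually_all]
    intro k hk
    by_cases hkn : k = n
    · subst hkn
      exact ((hf.hasDerivWithinAt_iterate _ hzI').hasDerivAt (phaseI_mem_nhds hzI)).eventually_ne hD
    · refine nhdsWithin_le_nhds ((hf.continuousAt_iterate k hzI).eventually_ne ?_)
      rcases lt_or_gt_of_ne hkn with h | h
      · exact hmin k h
      · obtain ⟨j, rfl⟩ := Nat.exists_eq_add_of_lt h
        rw [show n + j + 1 = (j + 1) + n by omega, Function.iterate_add_apply, hnz]
        exact hf.iterate_zero_ne hrep (Nat.succ_pos j)
  have e4 : ∀ᶠ x in 𝓝 z, x ∈ Set.Ioo p' q' := Ioo_mem_nhds hz.1 hz.2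
  obtain ⟨x, hx3, hx1, hx2, hx4⟩ := (e3.and (nhdsWithin_le_nhds (e1.and (e2.and e4)))).exists
  have hxI : x ∈ Set.Ioo (-1 : ℝ) 1 := ⟨hp'.1.trans_lt hx4.1, hx4.2.trans_le hq'.2⟩
  have hx0 : ∀ k ≤ n + i, f^[k] x ≠ 0 := fun k hk => hx3 k (by simpa [Nat.lt_succ_iff] using hk)
  have hDx : 0 < |derivI 1 (f^[n + i + 1]) x| := abs_pos.2
    (hf.derivI_iterate_ne_zero _ (Set.Ioo_subset_Icc_self hxI) fun k hk => hx0 k (by omega))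
  refine ⟨x, ⟨hpp.trans_lt hx4.1, hx4.2.trans_le hqq⟩, hxI, n + i, by omega, hx0, ?_⟩
  rw [norm_div, Complex.norm_real, Real.norm_eq_abs, one_lt_div hDx]
  linarith

end IsSUnimodal

theorem proposition2p3 (f : ℝ → ℝ) (hf : IsSUnimodal f) (hrep : AllPeriodicRepelling f)
    (hinf : (postcriticalOrbit f).Infinite)
    (v : ℝ → ℂ) (hv : ContDiffOn ℝ 1 v phaseI) (hvc : derivWithin v phaseI 0 = 0)
    (hv0 : ∃ i₀ : ℕ, v (f^[i₀] 0) ≠ 0)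
    (A : Set ℝ) (hA : ∃ U : Set ℝ, IsOpen U ∧ A = U ∩ phaseI)
    (hne : A.Nonempty) :
    ∃ K : Set ℝ, K ⊆ A ∩ divergenceSet f v ∧ IsCantorSet K := by
  obtain ⟨U, hU, rfl⟩ := hA
  have hvC : ContinuousOn v phaseI := hv.continuousOn
  set W : Set ℝ := U ∩ Set.Ioo (-1) 1 with hW
  have hWo : IsOpen W := hU.inter isOpen_Ioo
  have hWne : W.Nonempty := by
    obtain ⟨x, hxU, hxI⟩ := hne
    rw [show phaseI = closure (Set.Ioo (-1 : ℝ) 1) from (closure_Ioo (by norm_num)).symm] at hxI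
    exact mem_closure_iff.1 hxI U hU hxU
  -- Adding the exterior of `W` makes these sets dense in the whole line, so that Baire's theorem
  -- applies there.
  set V : ℕ → Set ℝ := fun N => IsSUnimodal.largeTermSet f v N ∪ (closure W)ᶜ with hV
  have hVo : ∀ N, IsOpen (V N) := fun N =>
    (hf.isOpen_largeTermSet hvC N).union isClosed_closure.isOpen_compl
  have hVd : ∀ N, Dense (V N) := by
    intro N
    rw [dense_iff_inter_open]
    intro O hO hOne
    by_cases hOW : (O ∩ W).Nonempty
    · obtain ⟨x, hx⟩ := hOW
      obtain ⟨ε, hε, hball⟩ := Metric.isOpen_iff.1 (hO.inter hWo) x hx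
      rw [Real.ball_eq_Ioo] at hball
      have hx1 := (hball ⟨by linarith, by linarith⟩ : x ∈ O ∩ W).2.2
      have hx2 := (hball ⟨by linarith, by linarith⟩ : x + ε / 2 ∈ O ∩ W).2.2
      obtain ⟨y, hy, hyL⟩ := hf.exists_mem_largeTermSet hrep hvC hv0 N
        (Set.Ioo_subset_Icc_self hx1) (Set.Ioo_subset_Icc_self hx2) (by linarith)
      exact ⟨y, (hball ⟨by linarith [hy.1], by linarith [hy.2]⟩ : y ∈ O ∩ W).1, Or.inl hyL⟩
    · obtain ⟨x, hx⟩ := hOne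
      refine ⟨x, hx, Or.inr fun hcl => hOW ?_⟩
      exact mem_closure_iff.1 hcl O hO hx
  set G : Set ℝ := W ∩ ⋂ N, V N with hG
  have hGm : MeasurableSet G :=
    hWo.measurableSet.inter (MeasurableSet.iInter fun N => (hVo N).measurableSet)
  -- If `G` were countable, its complement would be a dense `Gδ`, and would meet `⋂ N, V N` inside
  -- `W`.
  have hGc : ¬ G.Countable := by
    intro hc
    have hd := Dense.inter_of_Gδ (IsGδ.iInter_of_isOpen hVo) hc.isGδ_compl
      (dense_iInter_of_isOpen_nat hVo hVd) (hc.dense_compl ℝ)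
    obtain ⟨x, hxW, hxV, hxG⟩ := dense_iff_inter_open.1 hd W hWo hWne
    exact hxG ⟨hxW, hxV⟩
  obtain ⟨K, hKG, hK⟩ := exists_cantorSet_of_not_countable hGm hGc
  refine ⟨K, fun x hxK => ?_, hK⟩
  obtain ⟨hxW, hxV⟩ := hKG hxK
  have hxI : x ∈ phaseI := Set.Ioo_subset_Icc_self hxW.2
  have hlarge : ∀ N, x ∈ IsSUnimodal.largeTermSet f v N := fun N =>
    (Set.mem_iInter.1 hxV N).resolve_right fun h => h (subset_closure hxW)
  refine ⟨⟨hxW.1, hxI⟩, hxI, fun n => ?_, not_tendsto_alphaCandPartial fun N => ?_⟩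
  · obtain ⟨_, m, hm, h0, _⟩ := hlarge n
    exact h0 n hm
  · obtain ⟨_, m, hm, _, hlt⟩ := hlarge N
    exact ⟨m, hm, hlt⟩
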